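/- Let $n\ge 1$, $r\ge 3$, $q=e^{2\pi i/r}$, and let $k$ be the order of $q^2$ (so $k=r$ for odd $r$, $k=r/2$ for even $r$). Write $[m]_Q=\frac{Q^m-Q^{-m}}{Q-Q^{-1}}$, and $Q^{x}=e^{x\log Q}$ with the principal logarithm. Let $V$ be the complex Fock space with basis $|m,s\rangle$, $m\in\mathbb N^n$, $s\in\{0,1\}^n$. On $V$ let $N_{A_i}|m,s\rangle=m_i|m,s\rangle$, $M_i|m,s\rangle=s_i|m,s\rangle$, let $A_i^-|\dots m_i\dots\rangle=\sqrt{[m_i]_Q}\,|\dots m_i-1\dots\rangle$ and $A_i^+|\dots m_i\dots\rangle=\sqrt{[m_i+1]_Q}\,|\dots m_i+1\dots\rangle$ be the $Q$-bosons, and $\Phi_i^\pm$ the $Q$-fermions, acting on the $s_i$ with the Jordan–Wigner signs. The square roots may be chosen arbitrarily, provided that $\sqrt{[m]_Q}$ is continuous at $Q=q$ for $k\nmid m$ and that $\sqrt{[ks]_Q}/\sqrt{[k]_Q}$ has a limit as $Q\to q$ for all $s$; put $([k]_Q!)^{1/2}=\prod_{j=1}^k\sqrt{[j]_Q}$. Limits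 of operators are limits, as $Q\to q$ with $Q\neq q$, of all matrix coefficients. Let $(a_{ij})_{1\le i\le n-1,\,1\le j\le n}$ be the Cartan matrix of $sl(n)$ with the additional last column $(0,\dots,0,-2)^t$. Let $\tilde P(n)$ be given by generators $X_1,\dots,X_n,Y_i,T_i,D$ ($1\le i\le n-1$), with $X_n$ odd and all others even, and relations $[X_j,Y_i]=\delta_{ij}T_i$, $[T_i,X_j]=a_{ij}X_j$, $[Y_i,T_j]=a_{ij}Y_i$, $[T_i,T_j]=0$, $[D,X_i]=[D,Y_i]=[D,T_i]=0$ ($i\le n-1$), $[D,X_n]=X_n$, $X_n^2=0$, and the classical Serre relations $\sum_t(-1)^t\binom{1-a_{ij}}{t}X_i^{1-a_{ij}-t}X_jX_i^t=0$ ($i\le n-1$, $j\le n$, $i\ne j$) and the same with $Y_i,Y_j$ ($i\neq j\le n-1$). Let $\tilde P_Q(n)$ be given by the same relations with $[X_j,Y_i]=\delta_{ij}\frac{Q^{T_i}-Q^{-T_i}}{Q-Q^{-1}}$ and $Q$-binomials in the Serre relations, where $Q^{\pm T_i}$ are further, mutually inverse generators, which commute with each other and with $T_j,D$ and satisfy $Q^{T_i}X_jQ^{-T_i}=Q^{a_{ij}}X_j$,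 $Q^{T_i}Y_jQ^{-T_i}=Q^{-a_{ij}}Y_j$. Let $U_q(sl(n))$ have its usual generators $E_i,F_i,K_i^{\pm1}$ and relations, including the Serre relations. Then such square roots exist, and for every choice of them the following holds. 1. For $Q\ne0$, $Q^2\neq1$, the operators $A_i^\pm,N_{A_i}$ satisfy the $Q$-boson relations, $\Phi_i^\pm,M_i$ the $Q$-fermion relations, $\phi_i^-=Q^{-M_i/2}\Phi_i^-$ and $\phi_i^+=\Phi_i^+Q^{-M_i/2}$ the relations of ordinary fermions, and $$\hat X_i=A_i^+A_{i+1}^-Q^{\frac12(M_i-M_{i+1})}+\Phi_i^+\Phi_{i+1}^-Q^{-\frac12(N_{A_i}-N_{A_{i+1}})},\qquad \hat X_n=A_n^+\Phi_n^+Q^{\frac12\sum_{i<n}N_{A_i}-\frac12\sum_{i<n}M_i},$$ $$\hat Y_i=A_{i+1}^+A_i^-Q^{\frac12(M_i-M_{i+1})}+\Phi_{i+1}^+\Phi_i^-Q^{-\frac12(N_{A_i}-N_{A_{i+1}})},$$ $$\hat T_i=N_{A_i}-N_{A_{i+1}}+M_i-M_{i+1},\qquad \hat D=\tfrac12\sum_iN_{A_i}+\tfrac12\sum_iM_i$$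 define a representation of $\tilde P_Q(n)$ on $V$. As $Q\to q$ these operators converge to their values at $Q=q$. 2. As $Q\to q$ the limits $$a_i^-=\lim\frac{Q^{-kN_{A_i}/2}(A_i^-)^k}{([k]_Q!)^{1/2}},\qquad a_i^+=\lim\frac{(A_i^+)^kQ^{-kN_{A_i}/2}}{([k]_Q!)^{1/2}},\qquad \lim\phi_i^\pm$$ exist. Denote $\lim\phi_i^\pm$ again by $\phi_i^\pm$, and put $N_{a_i}=a_i^+a_i^-$, $\chi_i^\pm=A_i^\pm|_{Q=q}\,q^{-kN_{a_i}/2}$, $N_{\chi_i}=N_{A_i}-kN_{a_i}$. Then the $a_i^\pm$ are ordinary bosons, the $\phi_i^\pm$ are ordinary fermions with $\phi_i^+\phi_i^-=M_i$, and the $\chi_i^\pm$ are $k$-fermions: $\chi_i^-\chi_i^+-q^{\mp1}\chi_i^+\chi_i^-=q^{\pm N_{\chi_i}}$, $[N_{\chi_i},\chi_i^\pm]=\pm\chi_i^\pm$, $(\chi_i^\pm)^k=0$, and different modes commute. All $\chi_i^\pm,N_{\chi_i}$ commute with all $a_j^\pm,\phi_j^\pm$, and the $a_i^\pm$ commute with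 the $\phi_j^\pm$. Moreover $\lim A_i^\pm=\chi_i^\pm q^{kN_{a_i}/2}$, and $V$ is isomorphic to the tensor product of the Fock space of $n$ $k$-fermions (with occupation numbers $0,\dots,k-1$) and the Fock space of $n$ bosons and $n$ fermions, with $\chi_i^\pm,N_{\chi_i}$ acting in the standard way on the first factor and $a_i^\pm,\phi_i^\pm$ in the standard way on the second. 3. The operators $X_i=a_i^+a_{i+1}^-+\phi_i^+\phi_{i+1}^-$, $X_n=a_n^+\phi_n^+$, $Y_i=a_{i+1}^+a_i^-+\phi_{i+1}^+\phi_i^-$, $T_i=N_{a_i}-N_{a_{i+1}}+\phi_i^+\phi_i^--\phi_{i+1}^+\phi_{i+1}^-$, $D=\frac12\sum_iN_{a_i}+\frac12\sum_i\phi_i^+\phi_i^-$ define a representation $\sigma$ of (the enveloping algebra of) $\tilde P(n)$ on $V$, compatible with the grading by fermion parity. The operators $E_i=\chi_i^-\chi_{i+1}^+$, $F_i=\chi_i^+\chi_{i+1}^-$, $K_i^{\pm1}=q^{\pm(-N_{\chi_i}+N_{\chi_{i+1}})}$ define a representation $\pi$ of $U_q(sl(n))$ on $V$ by even operators. 4.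 Let $\lim_{Q\to q}\tilde P_Q(n)$ denote the algebra of operators on $V$ that the oscillators obtained in the limit generate in this way, i.e. the algebra generated by the operators $X_1,\dots,X_n,Y_i,T_i,D$ and $E_i,F_i,K_i^{\pm1}$ of 3. The images of $\pi$ and $\sigma$ commute, and $u\otimes p\mapsto up$ is an isomorphism of algebras $$\pi\big(U_q(sl(n))\big)\otimes\sigma\big(\tilde P(n)\big)\;\cong\;\lim_{Q\to q}\tilde P_Q(n).$$ 5. The operators of $\tilde P(n)$ in 3 extend to an injective representation $\rho$ on $V$ of the whole matrix Lie superalgebra of all $\begin{pmatrix}N&S\\R&-N^t\end{pmatrix}$ with $n\times n$ blocks, $S^t=S$, $R^t=-R$ (that is, $P(n)$, where $\operatorname{tr}N=0$, extended by $D=\mathrm{diag}(\frac12,-\frac12)$). In it $X_i,Y_i,T_i$ ($i\le n-1$) are the images of the matrices with $N=e_{i,i+1}$, $e_{i+1,i}$, $e_{ii}-e_{i+1,i+1}$ and $R=S=0$, and $X_n$ is the image of the matrix with $S=e_{nn}$ and $N=R=0$. The image of $\pi$ commutes with the algebra generated by the image of $\rho$, and the algebra that the two generate is their tensor product. -/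

import Mathlib

open scoped TensorProduct Topology
open Filter

namespace QStrange

/-! ### `Q`-numbers -/

/-- The `Q`-number `[m] = (Q ^ m - Q ^ (-m)) / (Q - Q⁻¹)`. -/
noncomputable def qInt (Q : ℂ) (m : ℕ) : ℂ := (Q ^ m - Q⁻¹ ^ m) / (Q - Q⁻¹)

/-- The Gaussian binomial coefficient `[m choose t] = [m]! / ([t]! [m - t]!)`, as the Laurent
polynomial in `Q` given by the Pascal rule, so that it makes sense at roots of unity. -/
noncomputable def qBinom (Q : ℂ) : ℕ → ℕ → ℂ
  | _, 0 => 1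
  | 0, _ + 1 => 0
  | m + 1, t + 1 => Q ^ (t + 1) * qBinom Q m (t + 1) + Q⁻¹ ^ (m - t) * qBinom Q m t

/-- The root of unity `q = exp (2 π i / r)`. -/
noncomputable def rootOfUnity (r : ℕ) : ℂ := Complex.exp (2 * Real.pi * Complex.I / r)

/-- The order `k` of `q ^ 2` for `q = exp (2 π i / r)`, i.e. the least `k ≥ 1` with `[k] = 0` at
`q`: it is `r` for odd `r` and `r / 2` for even `r`. -/
def rootOrder (r : ℕ) : ℕ := if Even r then r / 2 else r

/-! ### Cartan matrix and Serre relations, for `n = l + 1` -/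

/-- The Cartan matrix of the extended strange superalgebra with `n = l + 1`: rows `1, …, n - 1`,
columns `1, …, n`. Its first `n - 1` columns are the Cartan matrix of `sl(n)`, and the last column
is `(0, …, 0, -2)`. -/
def cartan (l : ℕ) (i : Fin l) (j : Fin (l + 1)) : ℤ :=
  if (j : ℕ) = i then 2
  else if (j : ℕ) = i + 1 then (if (j : ℕ) = l then -2 else -1)
  else if (j : ℕ) + 1 = i then -1
  else 0

/-- `∑_t (-1)^t [1 - a choose t]_Q x ^ (1 - a - t) y x ^ t`. -/
noncomputable def serre {A : Type*} [Ring A] [Algebra ℂ A] (Q : ℂ) (a : ℤ) (x y : A) : A :=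
  ∑ t ∈ Finset.range ((1 - a).toNat + 1),
    ((-1) ^ t * qBinom Q (1 - a).toNat t) • (x ^ ((1 - a).toNat - t) * y * x ^ t)

/-! ### The algebra `U_q(sl(n))` -/

inductive UqGen (l : ℕ) : Type
  | E (i : Fin l) | F (i : Fin l) | K (i : Fin l) | Kinv (i : Fin l)

namespace Uq

noncomputable def e {l : ℕ} (i : Fin l) : FreeAlgebra ℂ (UqGen l) := FreeAlgebra.ι ℂ (UqGen.E i)
noncomputable def f {l : ℕ} (i : Fin l) : FreeAlgebra ℂ (UqGen l) := FreeAlgebra.ι ℂ (UqGen.F i)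
noncomputable def k {l : ℕ} (i : Fin l) : FreeAlgebra ℂ (UqGen l) := FreeAlgebra.ι ℂ (UqGen.K i)
noncomputable def k' {l : ℕ} (i : Fin l) : FreeAlgebra ℂ (UqGen l) :=
  FreeAlgebra.ι ℂ (UqGen.Kinv i)

/-- The defining relations of `U_q(sl(n))`, `n = l + 1`. -/
inductive Rel (l : ℕ) (q : ℂ) : FreeAlgebra ℂ (UqGen l) → FreeAlgebra ℂ (UqGen l) → Prop
  | k_k' (i : Fin l) : Rel l q (k i * k' i) 1
  | k'_k (i : Fin l) : Rel l q (k' i * k i) 1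
  | k_k (i j : Fin l) : Rel l q (k i * k j) (k j * k i)
  | k_e (i j : Fin l) : Rel l q (k i * e j * k' i) (q ^ cartan l i j.castSucc • e j)
  | k_f (i j : Fin l) : Rel l q (k i * f j * k' i) (q ^ (-cartan l i j.castSucc) • f j)
  | e_f (i j : Fin l) : Rel l q (e i * f j - f j * e i)
      (if i = j then (q - q⁻¹)⁻¹ • (k i - k' i) else 0)
  | serre_e (i j : Fin l) (h : i ≠ j) : Rel l q (serre q (cartan l i j.castSucc) (e i) (e j)) 0
  | serre_f (i j : Fin l) (h : i ≠ j) : Rel l q (serre q (cartan l i j.castSucc) (f i) (f j)) 0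

end Uq

/-- `U_q(sl(l + 1))` (for `q ≠ 0`, `q ^ 2 ≠ 1`), by generators and relations. -/
abbrev UqSl (l : ℕ) (q : ℂ) : Type := RingQuot (Uq.Rel l q)

/-- The class in `U_q(sl(l + 1))` of a generator. -/
noncomputable def UqSl.gen {l : ℕ} (q : ℂ) (g : UqGen l) : UqSl l q :=
  RingQuot.mkAlgHom ℂ (Uq.Rel l q) (FreeAlgebra.ι ℂ g)

/-! ### The extended strange superalgebra `P̃(n)` in its Chevalley basis -/

inductive PGen (l : ℕ) : Type
  | X (j : Fin (l + 1)) | Y (i : Fin l) | T (i : Fin l) | D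

namespace P

noncomputable def x {l : ℕ} (j : Fin (l + 1)) : FreeAlgebra ℂ (PGen l) :=
  FreeAlgebra.ι ℂ (PGen.X j)
noncomputable def y {l : ℕ} (i : Fin l) : FreeAlgebra ℂ (PGen l) := FreeAlgebra.ι ℂ (PGen.Y i)
noncomputable def t {l : ℕ} (i : Fin l) : FreeAlgebra ℂ (PGen l) := FreeAlgebra.ι ℂ (PGen.T i)
noncomputable def d {l : ℕ} : FreeAlgebra ℂ (PGen l) := FreeAlgebra.ι ℂ PGen.D

/-- The defining relations of the extended strange superalgebra, `n = l + 1`. The last `X` is the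
fermionic generator; its superbracket with itself is twice its square. -/
inductive Rel (l : ℕ) : FreeAlgebra ℂ (PGen l) → FreeAlgebra ℂ (PGen l) → Prop
  | x_y (j : Fin (l + 1)) (i : Fin l) :
      Rel l (x j * y i - y i * x j) (if j = i.castSucc then t i else 0)
  | t_x (i : Fin l) (j : Fin (l + 1)) : Rel l (t i * x j - x j * t i) (cartan l i j • x j)
  | y_t (i j : Fin l) : Rel l (y i * t j - t j * y i) (cartan l i j.castSucc • y i)
  | t_t (i j : Fin l) : Rel l (t i * t j - t j * t i) 0
  | d_x (i : Fin l) : Rel l (d * x i.castSucc - x i.castSucc * d) 0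
  | d_y (i : Fin l) : Rel l (d * y i - y i * d) 0
  | d_t (i : Fin l) : Rel l (d * t i - t i * d) 0
  | d_x_last : Rel l (d * x (Fin.last l) - x (Fin.last l) * d) (x (Fin.last l))
  | x_last_sq : Rel l (x (Fin.last l) * x (Fin.last l)) 0
  | serre_x (i : Fin l) (j : Fin (l + 1)) (h : j ≠ i.castSucc) :
      Rel l (serre 1 (cartan l i j) (x i.castSucc) (x j)) 0
  | serre_y (i j : Fin l) (h : i ≠ j) :
      Rel l (serre 1 (cartan l i j.castSucc) (y i) (y j)) 0

end P

/-- The (enveloping algebra of the) extended strange superalgebra `P̃(l + 1)`, by Chevalley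
generators and relations. -/
abbrev UStrange (l : ℕ) : Type := RingQuot (P.Rel l)

/-- The class in `UStrange l` of a generator. -/
noncomputable def UStrange.gen {l : ℕ} (g : PGen l) : UStrange l :=
  RingQuot.mkAlgHom ℂ (P.Rel l) (FreeAlgebra.ι ℂ g)

/-! ### The quantum extended strange superalgebra `P̃_Q(n)` -/

/-- The generators of `P̃_Q(n)`; `K i` and `Kinv i` stand for `Q ^ T_i` and `Q ^ (-T_i)`. -/
inductive QPGen (l : ℕ) : Type
  | X (j : Fin (l + 1)) | Y (i : Fin l) | T (i : Fin l) | D | K (i : Fin l) | Kinv (i : Fin l)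

namespace QP

noncomputable def x {l : ℕ} (j : Fin (l + 1)) : FreeAlgebra ℂ (QPGen l) :=
  FreeAlgebra.ι ℂ (QPGen.X j)
noncomputable def y {l : ℕ} (i : Fin l) : FreeAlgebra ℂ (QPGen l) := FreeAlgebra.ι ℂ (QPGen.Y i)
noncomputable def t {l : ℕ} (i : Fin l) : FreeAlgebra ℂ (QPGen l) := FreeAlgebra.ι ℂ (QPGen.T i)
noncomputable def d {l : ℕ} : FreeAlgebra ℂ (QPGen l) := FreeAlgebra.ι ℂ QPGen.D
noncomputable def k {l : ℕ} (i : Fin l) : FreeAlgebra ℂ (QPGen l) := FreeAlgebra.ι ℂ (QPGen.K i)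
noncomputable def k' {l : ℕ} (i : Fin l) : FreeAlgebra ℂ (QPGen l) :=
  FreeAlgebra.ι ℂ (QPGen.Kinv i)

/-- The defining relations of `P̃_Q(n)`, `n = l + 1`. -/
inductive Rel (l : ℕ) (Q : ℂ) : FreeAlgebra ℂ (QPGen l) → FreeAlgebra ℂ (QPGen l) → Prop
  | x_y (j : Fin (l + 1)) (i : Fin l) :
      Rel l Q (x j * y i - y i * x j)
        (if j = i.castSucc then (Q - Q⁻¹)⁻¹ • (k i - k' i) else 0)
  | t_x (i : Fin l) (j : Fin (l + 1)) : Rel l Q (t i * x j - x j * t i) (cartan l i j • x j)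
  | y_t (i j : Fin l) : Rel l Q (y i * t j - t j * y i) (cartan l i j.castSucc • y i)
  | t_t (i j : Fin l) : Rel l Q (t i * t j - t j * t i) 0
  | d_x (i : Fin l) : Rel l Q (d * x i.castSucc - x i.castSucc * d) 0
  | d_y (i : Fin l) : Rel l Q (d * y i - y i * d) 0
  | d_t (i : Fin l) : Rel l Q (d * t i - t i * d) 0
  | d_x_last : Rel l Q (d * x (Fin.last l) - x (Fin.last l) * d) (x (Fin.last l))
  | x_last_sq : Rel l Q (x (Fin.last l) * x (Fin.last l)) 0
  | serre_x (i : Fin l) (j : Fin (l + 1)) (h : j ≠ i.castSucc) :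
      Rel l Q (serre Q (cartan l i j) (x i.castSucc) (x j)) 0
  | serre_y (i j : Fin l) (h : i ≠ j) :
      Rel l Q (serre Q (cartan l i j.castSucc) (y i) (y j)) 0
  | k_k' (i : Fin l) : Rel l Q (k i * k' i) 1
  | k'_k (i : Fin l) : Rel l Q (k' i * k i) 1
  | k_k (i j : Fin l) : Rel l Q (k i * k j) (k j * k i)
  | k_t (i j : Fin l) : Rel l Q (k i * t j) (t j * k i)
  | k_d (i : Fin l) : Rel l Q (k i * d) (d * k i)
  | k_x (i : Fin l) (j : Fin (l + 1)) : Rel l Q (k i * x j * k' i) (Q ^ cartan l i j • x j)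
  | k_y (i j : Fin l) : Rel l Q (k i * y j * k' i) (Q ^ (-cartan l i j.castSucc) • y j)

end QP

/-- The quantum extended strange superalgebra `P̃_Q(l + 1)`, by generators and relations. -/
abbrev QUStrange (l : ℕ) (Q : ℂ) : Type := RingQuot (QP.Rel l Q)

/-- The class in `QUStrange l Q` of a generator. -/
noncomputable def QUStrange.gen {l : ℕ} (Q : ℂ) (g : QPGen l) : QUStrange l Q :=
  RingQuot.mkAlgHom ℂ (QP.Rel l Q) (FreeAlgebra.ι ℂ g)

/-! ### The strange superalgebra `P̃(n)` as a matrix Lie superalgebra -/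

/-- Square matrices of size `n + n`, i.e. `ℓ(n, n)`. -/
abbrev SMat (n : ℕ) : Type := Matrix (Fin n ⊕ Fin n) (Fin n ⊕ Fin n) ℂ

/-- The matrices of `P̃(n)`: block matrices `(N, Q; R, S)` with `Nᵗ = -S`, `Qᵗ = Q`, `Rᵗ = -R`.
The matrices with `tr N = 0` among them form `P(n)`, which is extended here by the diagonal
matrix `matD`. -/
def IsStrange {n : ℕ} (M : SMat n) : Prop :=
  M.toBlocks₁₁.transpose = -M.toBlocks₂₂ ∧ M.toBlocks₁₂.transpose = M.toBlocks₁₂ ∧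
    M.toBlocks₂₁.transpose = -M.toBlocks₂₁

/-- The odd part of a matrix in `ℓ(n, n)`. -/
def oddPart {n : ℕ} (M : SMat n) : SMat n := Matrix.fromBlocks 0 M.toBlocks₁₂ M.toBlocks₂₁ 0

/-- The Lie superbracket of `ℓ(n, n)`: the anticommutator on two odd matrices, the commutator if
one of the two is even. -/
noncomputable def superBracket {n : ℕ} (M M' : SMat n) : SMat n :=
  M * M' - M' * M + 2 * (oddPart M' * oddPart M)

/-- The matrices of the Chevalley generators of `P̃(l + 1)`. -/
noncomputable def chevalleyMatrix {l : ℕ} : PGen l → SMat (l + 1)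
  | PGen.X j => Fin.snoc (α := fun _ => SMat (l + 1))
      (fun i : Fin l => Matrix.fromBlocks (Matrix.single i.castSucc i.succ 1) 0 0
        (-Matrix.single i.succ i.castSucc 1))
      (Matrix.fromBlocks 0 (Matrix.single (Fin.last l) (Fin.last l) 1) 0 0) j
  | PGen.Y i => Matrix.fromBlocks (Matrix.single i.succ i.castSucc 1) 0 0
      (-Matrix.single i.castSucc i.succ 1)
  | PGen.T i => Matrix.fromBlocks
      (Matrix.single i.castSucc i.castSucc 1 - Matrix.single i.succ i.succ 1) 0 0
      (-(Matrix.single i.castSucc i.castSucc 1 - Matrix.single i.succ i.succ 1))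
  | PGen.D => Matrix.fromBlocks ((1 / 2 : ℂ) • 1) 0 0 (-((1 / 2 : ℂ) • 1))

/-! ### Operators on spaces with a distinguished basis -/

section Operators

variable {B : Type*}

/-- The operator sending the basis vector `x` to `c x` times the basis vector `f x`. -/
noncomputable def wShift (f : B → B) (c : B → ℂ) : Module.End ℂ (B →₀ ℂ) :=
  Finsupp.linearCombination ℂ fun x => Finsupp.single (f x) (c x)

/-- The diagonal operator with eigenvalues `c`. -/
noncomputable def diagOp (c : B → ℂ) : Module.End ℂ (B →₀ ℂ) := wShift id c

/-- `Q ^ N` for an operator `N` that is diagonal in the distinguished basis: the eigenvalue `ν` of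
`N` is replaced by `Q ^ ν = exp (ν log Q)`, with the principal logarithm. -/
noncomputable def opPow (Q : ℂ) (N : Module.End ℂ (B →₀ ℂ)) : Module.End ℂ (B →₀ ℂ) :=
  diagOp fun x => Q ^ (N (Finsupp.single x 1) x)

/-- Convergence `f Q → L` as `Q → q`, `Q ≠ q`, of all matrix coefficients. -/
def HasOpLim (f : ℂ → Module.End ℂ (B →₀ ℂ)) (q : ℂ) (L : Module.End ℂ (B →₀ ℂ)) : Prop :=
  ∀ (v : B →₀ ℂ) (x : B), Tendsto (fun Q => f Q v x) (𝓝[≠] q) (𝓝 (L v x))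

end Operators

/-! ### The oscillator algebras -/

/-- The relations of a system of mutually commuting `Q`-bosons `A_i⁻, A_i⁺, N_i`. -/
structure IsQBosons {B ι : Type*} (Q : ℂ) (Am Ap N : ι → Module.End ℂ (B →₀ ℂ)) : Prop where
  rel_minus (i : ι) : Am i * Ap i - Q • (Ap i * Am i) = opPow Q (-N i)
  rel_plus (i : ι) : Am i * Ap i - Q⁻¹ • (Ap i * Am i) = opPow Q (N i)
  conj_minus (i : ι) : opPow Q (N i) * Am i * opPow Q (-N i) = Q⁻¹ • Am i
  conj_plus (i : ι) : opPow Q (N i) * Ap i * opPow Q (-N i) = Q • Ap i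
  pow_mul_pow_neg (i : ι) : opPow Q (N i) * opPow Q (-N i) = 1
  pow_neg_mul_pow (i : ι) : opPow Q (-N i) * opPow Q (N i) = 1
  comm (i j : ι) (h : i ≠ j) : Commute (Am i) (Am j) ∧ Commute (Ap i) (Ap j) ∧
    Commute (Am i) (Ap j) ∧ Commute (N i) (Am j) ∧ Commute (N i) (Ap j)
  comm_num (i j : ι) : Commute (N i) (N j)

/-- The relations of a system of `Q`-fermions `Φ_i⁻, Φ_i⁺, M_i`. -/
structure IsQFermions {B ι : Type*} [DecidableEq ι] (Q : ℂ)
    (Fm Fp M : ι → Module.End ℂ (B →₀ ℂ)) : Prop where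
  pow_mul_pow_neg (i : ι) : opPow Q (M i) * opPow Q (-M i) = 1
  pow_neg_mul_pow (i : ι) : opPow Q (-M i) * opPow Q (M i) = 1
  pow_comm (i j : ι) : Commute (opPow Q (M i)) (opPow Q (M j))
  conj_minus (i j : ι) :
    opPow Q (M i) * Fm j * opPow Q (-M i) = (if i = j then Q⁻¹ else 1) • Fm j
  conj_plus (i j : ι) : opPow Q (M i) * Fp j * opPow Q (-M i) = (if i = j then Q else 1) • Fp j
  rel_plus (i : ι) : Fm i * Fp i + Q • (Fp i * Fm i) = opPow Q (M i)
  rel_minus (i : ι) : Fm i * Fp i + Q⁻¹ • (Fp i * Fm i) = opPow Q (-M i)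
  anti_minus (i j : ι) : Fm i * Fm j + Fm j * Fm i = 0
  anti_plus (i j : ι) : Fp i * Fp j + Fp j * Fp i = 0
  anti (i j : ι) (h : i ≠ j) : Fp i * Fm j + Fm j * Fp i = 0

/-- The relations of a system of ordinary bosons `a_i⁻, a_i⁺`, with number operators
`a_i⁺ a_i⁻`. -/
structure IsBosons {A ι : Type*} [Ring A] [DecidableEq ι] (am ap : ι → A) : Prop where
  rel (i j : ι) : am i * ap j - ap j * am i = if i = j then 1 else 0
  comm_minus (i j : ι) : Commute (am i) (am j)
  comm_plus (i j : ι) : Commute (ap i) (ap j)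
  num_minus (i : ι) : ap i * am i * am i - am i * (ap i * am i) = -am i
  num_plus (i : ι) : ap i * am i * ap i - ap i * (ap i * am i) = ap i

/-- The relations of a system of ordinary fermions `φ_i⁻, φ_i⁺`. -/
structure IsFermions {A ι : Type*} [Ring A] [DecidableEq ι] (fm fp : ι → A) : Prop where
  rel (i j : ι) : fm i * fp j + fp j * fm i = if i = j then 1 else 0
  sq_minus (i : ι) : fm i ^ 2 = 0
  sq_plus (i : ι) : fp i ^ 2 = 0
  anti_minus (i j : ι) : fm i * fm j + fm j * fm i = 0
  anti_plus (i j : ι) : fp i * fp j + fp j * fp i = 0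

/-- The relations of a system of mutually commuting `k`-fermions `χ_i⁻, χ_i⁺, N_i`. -/
structure IsKFermions {B ι : Type*} (q : ℂ) (k : ℕ) (cm cp N : ι → Module.End ℂ (B →₀ ℂ)) :
    Prop where
  rel_plus (i : ι) : cm i * cp i - q⁻¹ • (cp i * cm i) = opPow q (N i)
  rel_minus (i : ι) : cm i * cp i - q • (cp i * cm i) = opPow q (-N i)
  num_minus (i : ι) : N i * cm i - cm i * N i = -cm i
  num_plus (i : ι) : N i * cp i - cp i * N i = cp i
  pow_minus (i : ι) : cm i ^ k = 0
  pow_plus (i : ι) : cp i ^ k = 0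
  comm (i j : ι) (h : i ≠ j) : Commute (cm i) (cm j) ∧ Commute (cp i) (cp j) ∧
    Commute (cm i) (cp j) ∧ Commute (N i) (cm j) ∧ Commute (N i) (cp j)
  comm_num (i j : ι) : Commute (N i) (N j)

/-! ### Fock space of `n = l + 1` bosons and `n` fermions -/

/-- Occupation numbers of the bosonic modes, and the set of occupied fermionic modes. -/
abbrev Occ (l : ℕ) : Type := (Fin (l + 1) → ℕ) × Finset (Fin (l + 1))

/-- The Fock space: it has the occupation numbers as a basis. -/
abbrev Fock (l : ℕ) : Type := Occ l →₀ ℂ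

/-- Operators on the Fock space. -/
abbrev Op (l : ℕ) : Type := Module.End ℂ (Fock l)

/-- The annihilation operator `|…, m_i, …⟩ ↦ w (m_i) |…, m_i - 1, …⟩`. -/
noncomputable def bosM {l : ℕ} (w : ℕ → ℂ) (i : Fin (l + 1)) : Op l :=
  wShift (fun x => (Function.update x.1 i (x.1 i - 1), x.2))
    (fun x => if x.1 i = 0 then 0 else w (x.1 i))

/-- The creation operator `|…, m_i, …⟩ ↦ w (m_i + 1) |…, m_i + 1, …⟩`. -/
noncomputable def bosP {l : ℕ} (w : ℕ → ℂ) (i : Fin (l + 1)) : Op l :=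
  wShift (fun x => (Function.update x.1 i (x.1 i + 1), x.2)) (fun x => w (x.1 i + 1))

/-- The number operator of the `i`-th bosonic mode. -/
noncomputable def numB {l : ℕ} (i : Fin (l + 1)) : Op l := diagOp fun x => (x.1 i : ℂ)

/-- The sign `(-1) ^ (number of occupied fermionic modes before the i-th)`. -/
def ferSign {l : ℕ} (i : Fin (l + 1)) (s : Finset (Fin (l + 1))) : ℂ :=
  (-1) ^ (s.filter (· < i)).card

/-- The fermionic annihilation operator. -/
noncomputable def ferM {l : ℕ} (i : Fin (l + 1)) : Op l :=
  wShift (fun x => (x.1, x.2.erase i)) (fun x => if i ∈ x.2 then ferSign i x.2 else 0)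

/-- The fermionic creation operator. -/
noncomputable def ferP {l : ℕ} (i : Fin (l + 1)) : Op l :=
  wShift (fun x => (x.1, insert i x.2)) (fun x => if i ∈ x.2 then 0 else ferSign i x.2)

/-- The number operator of the `i`-th fermionic mode. -/
noncomputable def numF {l : ℕ} (i : Fin (l + 1)) : Op l := diagOp fun x => if i ∈ x.2 then 1 else 0

/-- The fermion parity, which gives the `ℤ/2`-grading. -/
noncomputable def parity (l : ℕ) : Op l := diagOp fun x => (-1) ^ x.2.card

/-- A choice of square roots `w m Q` of the `Q`-numbers `[m]_Q`, regular at `q` in the only way in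
which it can be: `w m` is continuous at `q` if `[m]_q ≠ 0`, i.e. if `k ∤ m`, and
`√[k s] / √[k]` has a limit as `Q → q`. -/
structure RootBranch (q : ℂ) (k : ℕ) where
  w : ℕ → ℂ → ℂ
  sq (m : ℕ) (Q : ℂ) : w m Q ^ 2 = qInt Q m
  continuousAt (m : ℕ) (h : ¬ k ∣ m) : ContinuousAt (w m) q
  ratio (s : ℕ) : ∃ c : ℂ, Tendsto (fun Q => w (k * s) Q / w k Q) (𝓝[≠] q) (𝓝 c)

namespace RootBranch

variable {q : ℂ} {k : ℕ} (w : RootBranch q k)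

/-- `([m]_Q !) ^ (1/2)`. -/
noncomputable def sqrtFactorial (m : ℕ) (Q : ℂ) : ℂ := ∏ j ∈ Finset.Icc 1 m, w.w j Q

/-- The `Q`-boson `A_i⁻`. -/
noncomputable def Am {l : ℕ} (Q : ℂ) (i : Fin (l + 1)) : Op l := bosM (fun m => w.w m Q) i

/-- The `Q`-boson `A_i⁺`. -/
noncomputable def Ap {l : ℕ} (Q : ℂ) (i : Fin (l + 1)) : Op l := bosP (fun m => w.w m Q) i

/-- `Q ^ (-k N_i / 2) (A_i⁻) ^ k / ([k]!) ^ (1/2)`. -/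
noncomputable def preBosM {l : ℕ} (Q : ℂ) (i : Fin (l + 1)) : Op l :=
  (w.sqrtFactorial k Q)⁻¹ • (opPow Q ((-(k / 2) : ℂ) • numB i) * w.Am Q i ^ k)

/-- `(A_i⁺) ^ k Q ^ (-k N_i / 2) / ([k]!) ^ (1/2)`. -/
noncomputable def preBosP {l : ℕ} (Q : ℂ) (i : Fin (l + 1)) : Op l :=
  (w.sqrtFactorial k Q)⁻¹ • (w.Ap Q i ^ k * opPow Q ((-(k / 2) : ℂ) • numB i))

/-- The realization of `P̃_Q(n)` by `Q`-bosons and `Q`-fermions. -/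
noncomputable def realization {l : ℕ} (Q : ℂ) : QPGen l → Op l
  | QPGen.X j => Fin.snoc (α := fun _ => Op l)
      (fun i : Fin l =>
        w.Ap Q i.castSucc * w.Am Q i.succ *
            opPow Q ((1 / 2 : ℂ) • (numF i.castSucc - numF i.succ)) +
          ferP i.castSucc * ferM i.succ *
            opPow Q ((-(1 / 2) : ℂ) • (numB i.castSucc - numB i.succ)))
      (w.Ap Q (Fin.last l) * ferP (Fin.last l) *
        opPow Q ((1 / 2 : ℂ) • (∑ i : Fin l, numB i.castSucc) -
          (1 / 2 : ℂ) • (∑ i : Fin l, numF i.castSucc))) j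
  | QPGen.Y i =>
      w.Ap Q i.succ * w.Am Q i.castSucc *
          opPow Q ((1 / 2 : ℂ) • (numF i.castSucc - numF i.succ)) +
        ferP i.succ * ferM i.castSucc *
          opPow Q ((-(1 / 2) : ℂ) • (numB i.castSucc - numB i.succ))
  | QPGen.T i => numB i.castSucc - numB i.succ + numF i.castSucc - numF i.succ
  | QPGen.D => (1 / 2 : ℂ) • (∑ i, numB i) + (1 / 2 : ℂ) • (∑ i, numF i)
  | QPGen.K i => opPow Q (numB i.castSucc - numB i.succ + numF i.castSucc - numF i.succ)
  | QPGen.Kinv i => opPow Q (-(numB i.castSucc - numB i.succ + numF i.castSucc - numF i.succ))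

/-- The `k`-fermion `χ_i⁻ = A_i⁻ q ^ (-k N_a / 2)`, where `A_i⁻` is taken at `Q = q` and
`N_a = a_i⁺ a_i⁻`. -/
noncomputable def chiM {l : ℕ} (am ap : Fin (l + 1) → Op l) (i : Fin (l + 1)) : Op l :=
  w.Am q i * opPow q ((-(k / 2) : ℂ) • (ap i * am i))

/-- The `k`-fermion `χ_i⁺ = A_i⁺ q ^ (-k N_a / 2)`. -/
noncomputable def chiP {l : ℕ} (am ap : Fin (l + 1) → Op l) (i : Fin (l + 1)) : Op l :=
  w.Ap q i * opPow q ((-(k / 2) : ℂ) • (ap i * am i))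

end RootBranch

/-- The number operator `N_A - k N_a` of the `i`-th `k`-fermion. -/
noncomputable def chiN {l : ℕ} (k : ℕ) (am ap : Fin (l + 1) → Op l) (i : Fin (l + 1)) : Op l :=
  numB i - (k : ℂ) • (ap i * am i)

/-- `φ_i⁻ = Q ^ (-M_i / 2) Φ_i⁻`. -/
noncomputable def phiM {l : ℕ} (Q : ℂ) (i : Fin (l + 1)) : Op l :=
  opPow Q ((-(1 / 2) : ℂ) • numF i) * ferM i

/-- `φ_i⁺ = Φ_i⁺ Q ^ (-M_i / 2)`. -/
noncomputable def phiP {l : ℕ} (Q : ℂ) (i : Fin (l + 1)) : Op l :=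
  ferP i * opPow Q ((-(1 / 2) : ℂ) • numF i)

/-! ### The generators built from the limit oscillators -/

/-- The generators of `P̃(n)` in terms of ordinary bosons and fermions. -/
noncomputable def classicalGen {A : Type*} [Ring A] [Algebra ℂ A] {l : ℕ}
    (am ap fm fp : Fin (l + 1) → A) : PGen l → A
  | PGen.X j => Fin.snoc (α := fun _ => A)
      (fun i : Fin l => ap i.castSucc * am i.succ + fp i.castSucc * fm i.succ)
      (ap (Fin.last l) * fp (Fin.last l)) j
  | PGen.Y i => ap i.succ * am i.castSucc + fp i.succ * fm i.castSucc
  | PGen.T i => ap i.castSucc * am i.castSucc - ap i.succ * am i.succ +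
      fp i.castSucc * fm i.castSucc - fp i.succ * fm i.succ
  | PGen.D => (1 / 2 : ℂ) • (∑ i, ap i * am i) + (1 / 2 : ℂ) • (∑ i, fp i * fm i)

/-- The generators of `U_q(sl(n))` in terms of `k`-fermions. -/
noncomputable def kFermionGen {B : Type*} {l : ℕ} (q : ℂ)
    (cm cp N : Fin (l + 1) → Module.End ℂ (B →₀ ℂ)) : UqGen l → Module.End ℂ (B →₀ ℂ)
  | UqGen.E i => cm i.castSucc * cp i.succ
  | UqGen.F i => cp i.castSucc * cm i.succ
  | UqGen.K i => opPow q (-N i.castSucc + N i.succ)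
  | UqGen.Kinv i => opPow q (-(-N i.castSucc + N i.succ))

/-- The operator algebra that the oscillators obtained in the limit `Q → q` generate through the
realization: the one generated by the bilinears `classicalGen` in the ordinary bosons and fermions
together with the generators `kFermionGen` in the `k`-fermions. -/
noncomputable def limitAlgebra {l : ℕ} (q : ℂ) (am ap fm fp cm cp N : Fin (l + 1) → Op l) :
    Subalgebra ℂ (Op l) :=
  Algebra.adjoin ℂ (Set.range (kFermionGen q cm cp N) ∪ Set.range (classicalGen am ap fm fp))

/-- `L` is the internal tensor product of its subalgebras `U` and `P`. -/
def IsInternalTensor {A : Type*} [Semiring A] [Algebra ℂ A] (U P L : Subalgebra ℂ A) : Prop :=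
  (∀ u ∈ U, ∀ p ∈ P, Commute u p) ∧
    ∃ e : (U ⊗[ℂ] P) ≃ₐ[ℂ] L, ∀ (u : U) (p : P), (e (u ⊗ₜ[ℂ] p) : A) = (u : A) * (p : A)

/-! ### Fock space of `k`-fermions -/

/-- The Fock space of `n = l + 1` `k`-fermions, with occupation numbers `0, …, k - 1`. -/
abbrev KFock (l k : ℕ) : Type := (Fin (l + 1) → Fin k) →₀ ℂ

/-- `|…, t_i, …⟩ ↦ [t_i] |…, t_i - 1, …⟩`. -/
noncomputable def kFerM {l k : ℕ} (q : ℂ) (i : Fin (l + 1)) : Module.End ℂ (KFock l k) :=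
  wShift (fun t => Function.update t i ⟨(t i : ℕ) - 1, lt_of_le_of_lt (Nat.sub_le _ _) (t i).2⟩)
    (fun t => qInt q (t i))

/-- `|…, t_i, …⟩ ↦ |…, t_i + 1, …⟩` for `t_i < k - 1`, and `0` for `t_i = k - 1`. -/
noncomputable def kFerP {l k : ℕ} (i : Fin (l + 1)) : Module.End ℂ (KFock l k) :=
  wShift (fun t => if h : (t i : ℕ) + 1 < k then Function.update t i ⟨(t i : ℕ) + 1, h⟩ else t)
    (fun t => if (t i : ℕ) + 1 < k then 1 else 0)

/-- The number operator of the `i`-th `k`-fermion. -/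
noncomputable def kFerN {l k : ℕ} (i : Fin (l + 1)) : Module.End ℂ (KFock l k) :=
  diagOp fun t => ((t i : ℕ) : ℂ)

/-- The Fock space is the tensor product of the Fock space of the `k`-fermions and that of the
ordinary bosons and fermions, with `χ_i⁻, χ_i⁺, N_{χ_i}` acting on the first factor, and
`a_i⁻, a_i⁺, φ_i⁻, φ_i⁺` on the second, each in the standard way. -/
def FockSplits {l : ℕ} (q : ℂ) (k : ℕ) (am ap fm fp cm cp N : Fin (l + 1) → Op l) : Prop :=
  ∃ Θ : Fock l ≃ₗ[ℂ] KFock l k ⊗[ℂ] Fock l, ∀ (i : Fin (l + 1)) (v : Fock l),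
    Θ (cm i v) = (kFerM q i).rTensor (Fock l) (Θ v) ∧
    Θ (cp i v) = (kFerP i).rTensor (Fock l) (Θ v) ∧
    Θ (N i v) = (kFerN i).rTensor (Fock l) (Θ v) ∧
    Θ (am i v) = (bosM (fun m => ((√(m : ℝ) : ℝ) : ℂ)) i).lTensor (KFock l k) (Θ v) ∧
    Θ (ap i v) = (bosP (fun m => ((√(m : ℝ) : ℝ) : ℂ)) i).lTensor (KFock l k) (Θ v) ∧
    Θ (fm i v) = (ferM i).lTensor (KFock l k) (Θ v) ∧
    Θ (fp i v) = (ferP i).lTensor (KFock l k) (Θ v)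

end QStrange

open QStrange

/-!
All operators in question are sums of weighted shifts of the Fock basis, so that relations between
oscillators, and limits of oscillators, are statements on scalar coefficients. Everything else
follows from the relations of the oscillators.

*The realizations.* The even generators have the shape of a coproduct,
`e_i ⊗ K_i^{1/2} + K_i^{-1/2} ⊗ e_i'`, where `e_i` are bilinears in bosons and `e_i'` bilinears in
fermions. Each family satisfies the Serre relations by itself: for bosons they reduce to a cubic
relation in a single mode, and for fermions all monomials vanish. Hence the coproduct does
(`serre_coproduct`). The one cubic Serre relation, between `X_{n-1}` and `X_n`, follows from
`quadratic_Xo` and the nilpotency of the fermionic summand (`serre_neg_two_add`). These arguments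
use only how the factors `Q ^ (…)` commute with the oscillators, which `OscSystem` axiomatizes; with
trivial factors and `Q = 1` they give the classical realization. Only the commutators `[X_i, Y_i]`
have to be computed separately in the two cases.

*The limit.* `[m]` vanishes at `q` exactly if `k ∣ m`, and to first order, whence the existence of
admissible square roots (`nonempty_rootBranch`). A product of `k` consecutive roots `√[j]` contains
exactly one vanishing factor, which is compensated by the one in `√([k]!)`; so the normalized `k`-th
powers of the `Q`-bosons converge (`tendsto_coeff`). Whatever the choice of the roots, the squares
of the limit coefficients are determined: with `m = k d + t`, `t < k`, they are `d + 1` for the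
bosons (`alpha_sq`) and `[t]` for the `k`-fermions (`chiW_sq`). The relations depend on these squares
only. Splitting `m` into `t` and `d`, and rescaling the basis vectors to absorb the choice of roots,
identifies `V` with the tensor product of the two Fock spaces (`fockSplits_lim`).

*The tensor product of algebras.* `q ^ N` is quadratic in the `k`-fermions by their defining
relation, so that `U_q(sl(n))` acts on the first factor of `V` only, while `P̃(n)` acts on the second
factor only. Algebras of operators acting on different factors commute, and they are linearly
disjoint, as functionals on the first factor show (`eq_zero_of_mem_ops`).

*The matrix Lie superalgebra.* It acts by quadratic expressions in the bosons and fermions. Such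
expressions close under the super bracket up to the scalar `tr (S R)`, which vanishes since `S` is
symmetric and `R` antisymmetric (`strangeRep_superBracket`), and their coefficients are recovered
from commutators with the oscillators (`quad_eq_zero`).
-/

namespace QStrange

/-! ### Weighted shifts and diagonal operators -/

section Operators

variable {B : Type*}

theorem wShift_single (f : B → B) (c : B → ℂ) (x : B) (a : ℂ) :
    wShift f c (Finsupp.single x a) = Finsupp.single (f x) (a * c x) := by
  simp [wShift, Finsupp.linearCombination_single, Finsupp.smul_single]

/-- Operators on a space with a basis agree if they agree on the basis vectors. -/
theorem op_ext {S T : Module.End ℂ (B →₀ ℂ)}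
    (h : ∀ x, S (Finsupp.single x 1) = T (Finsupp.single x 1)) : S = T := by
  refine Finsupp.lhom_ext' fun x => LinearMap.ext_ring ?_
  simpa using h x

theorem wShift_mul (f g : B → B) (c d : B → ℂ) :
    wShift f c * wShift g d = wShift (f ∘ g) (fun x => d x * c (g x)) :=
  op_ext fun x => by simp [wShift_single]

/-- The map underlying a weighted shift matters only where the weight does not vanish. -/
theorem wShift_congr {f g : B → B} {c d : B → ℂ} (hc : ∀ x, c x = d x)
    (hf : ∀ x, c x ≠ 0 → f x = g x) : wShift f c = wShift g d :=
  op_ext fun x => by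
    rw [wShift_single, wShift_single, ← hc x]
    by_cases h : c x = 0
    · simp [h]
    · rw [hf x h]

theorem wShift_add (f : B → B) (c d : B → ℂ) :
    wShift f c + wShift f d = wShift f (fun x => c x + d x) :=
  op_ext fun x => by simp [wShift_single]

theorem smul_wShift (a : ℂ) (f : B → B) (c : B → ℂ) :
    a • wShift f c = wShift f (fun x => a * c x) :=
  op_ext fun x => by simp [wShift_single]

theorem diagOp_single (c : B → ℂ) (x : B) (a : ℂ) :
    diagOp c (Finsupp.single x a) = Finsupp.single x (a * c x) := wShift_single _ _ _ _

theorem diagOp_apply (c : B → ℂ) (v : B →₀ ℂ) (x : B) : diagOp c v x = c x * v x := by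
  classical
  induction v using Finsupp.induction_linear with
  | zero => simp
  | add v w hv hw => rw [map_add, Finsupp.add_apply, hv, hw, Finsupp.add_apply, mul_add]
  | single y a =>
    rw [diagOp_single, Finsupp.single_apply, Finsupp.single_apply]
    split_ifs with h
    · rw [h, mul_comm]
    · simp

theorem diagOp_add (c d : B → ℂ) : diagOp c + diagOp d = diagOp (fun x => c x + d x) :=
  wShift_add _ _ _

theorem smul_diagOp (a : ℂ) (c : B → ℂ) : a • diagOp c = diagOp (fun x => a * c x) :=
  smul_wShift _ _ _

theorem neg_diagOp (c : B → ℂ) : -diagOp c = diagOp (fun x => -c x) :=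
  op_ext fun x => by rw [LinearMap.neg_apply]; simp [diagOp_single]

theorem diagOp_sub (c d : B → ℂ) : diagOp c - diagOp d = diagOp (fun x => c x - d x) :=
  op_ext fun x => by rw [LinearMap.sub_apply]; simp [diagOp_single, Finsupp.single_sub]

theorem diagOp_zero : diagOp (fun _ : B => (0 : ℂ)) = 0 := op_ext fun x => by simp [diagOp_single]

theorem diagOp_one : diagOp (fun _ : B => (1 : ℂ)) = 1 := op_ext fun x => by simp [diagOp_single]

theorem sum_diagOp {ι : Type*} (s : Finset ι) (c : ι → B → ℂ) :
    ∑ i ∈ s, diagOp (c i) = diagOp (fun x => ∑ i ∈ s, c i x) := by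
  classical
  induction s using Finset.induction_on with
  | empty => simp [diagOp_zero]
  | insert i s hi ih => rw [Finset.sum_insert hi, ih, diagOp_add]; simp [Finset.sum_insert hi]

theorem diagOp_mul (c d : B → ℂ) : diagOp c * diagOp d = diagOp (fun x => c x * d x) := by
  rw [diagOp, diagOp, wShift_mul]
  exact wShift_congr (fun x => mul_comm _ _) fun x _ => rfl

theorem diagOp_commute (c d : B → ℂ) : Commute (diagOp c) (diagOp d) := by
  rw [Commute, SemiconjBy, diagOp_mul, diagOp_mul]; simp only [mul_comm]

theorem opPow_diagOp (Q : ℂ) (c : B → ℂ) : opPow Q (diagOp c) = diagOp (fun x => Q ^ c x) := by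
  simp [opPow, diagOp_single]

theorem opPow_mul_opPow_neg {Q : ℂ} (hQ : Q ≠ 0) (c : B → ℂ) :
    opPow Q (diagOp c) * opPow Q (-diagOp c) = 1 := by
  rw [neg_diagOp, opPow_diagOp, opPow_diagOp, diagOp_mul, ← diagOp_one]
  congr 1; ext x
  rw [← Complex.cpow_add _ _ hQ, add_neg_cancel, Complex.cpow_zero]

theorem opPow_neg_mul_opPow {Q : ℂ} (hQ : Q ≠ 0) (c : B → ℂ) :
    opPow Q (-diagOp c) * opPow Q (diagOp c) = 1 := by
  have h := opPow_mul_opPow_neg hQ (fun x => -c x)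
  rw [neg_diagOp] at h ⊢
  simpa only [neg_neg] using h

theorem HasOpLim.add {f g : ℂ → Module.End ℂ (B →₀ ℂ)} {q : ℂ} {S T : Module.End ℂ (B →₀ ℂ)}
    (hf : HasOpLim f q S) (hg : HasOpLim g q T) : HasOpLim (fun Q => f Q + g Q) q (S + T) :=
  fun v x => by simpa using (hf v x).add (hg v x)

theorem hasOpLim_const (q : ℂ) (T : Module.End ℂ (B →₀ ℂ)) : HasOpLim (fun _ => T) q T :=
  fun _ _ => tendsto_const_nhds

theorem wShift_apply (f : B → B) (c : B → ℂ) (v : B →₀ ℂ) (x : B) :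
    wShift f c v x = ∑ y ∈ v.support, Finsupp.single (f y) (v y * c y) x := by
  rw [wShift, Finsupp.linearCombination_apply, Finsupp.sum, Finsupp.finsetSum_apply]
  simp [Finsupp.smul_single]

/-- Weighted shifts along a fixed map converge as soon as all their weights do. -/
theorem hasOpLim_wShift {q : ℂ} {f : B → B} {c : ℂ → B → ℂ} {d : B → ℂ}
    (h : ∀ x, Tendsto (fun Q => c Q x) (𝓝[≠] q) (𝓝 (d x))) :
    HasOpLim (fun Q => wShift f (c Q)) q (wShift f d) := by
  classical
  intro v x
  simp only [wShift_apply]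
  refine tendsto_finsetSum _ fun y _ => ?_
  simp only [Finsupp.single_apply]
  split_ifs
  · exact (h y).const_mul _
  · exact tendsto_const_nhds

end Operators

/-! ### Commutation up to a scalar, and weights -/

section Weights

variable {A : Type*} [Ring A] [Algebra ℂ A]

/-- `x` and `y` commute up to the scalar `c`: `x y = c y x`. -/
def QComm (c : ℂ) (x y : A) : Prop := x * y = c • (y * x)

theorem QComm.of_commute {x y : A} (h : Commute x y) : QComm 1 x y := by
  rw [QComm, one_smul]; exact h

theorem QComm.commute {x y : A} (h : QComm 1 x y) : Commute x y := by
  rw [QComm, one_smul] at h; exact h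

theorem QComm.mul_left {c d : ℂ} {x y z : A} (hx : QComm c x z) (hy : QComm d y z) :
    QComm (c * d) (x * y) z := by
  rw [QComm, mul_assoc, hy, mul_smul_comm, ← mul_assoc, hx, smul_mul_assoc, smul_smul, mul_assoc,
    mul_comm]

theorem QComm.mul_right {c d : ℂ} {x y z : A} (hx : QComm c z x) (hy : QComm d z y) :
    QComm (c * d) z (x * y) := by
  rw [QComm, ← mul_assoc, hx, smul_mul_assoc, mul_assoc, hy, mul_smul_comm, smul_smul, mul_assoc]

theorem QComm.symm {c : ℂ} {x y : A} (h : QComm c x y) (hc : c ≠ 0) : QComm c⁻¹ y x := by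
  rw [QComm, h, smul_smul, inv_mul_cancel₀ hc, one_smul]

theorem QComm.congr {c d : ℂ} {x y : A} (h : QComm c x y) (hc : c = d) : QComm d x y := hc ▸ h

/-- If `K` is invertible, commutation up to a scalar is a statement on the conjugation by `K`. -/
theorem QComm.conj {c : ℂ} {x K K' : A} (h : QComm c K x) (hK : K * K' = 1) :
    K * x * K' = c • x := by
  rw [h, smul_mul_assoc, mul_assoc, hK, mul_one]

/-- `x` is an eigenvector of the commutator with `D`, of eigenvalue `δ`. -/
def HasWt (δ : ℂ) (D x : A) : Prop := D * x - x * D = δ • x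

theorem HasWt.of_commute {D x : A} (h : Commute D x) : HasWt 0 D x := by
  rw [HasWt, zero_smul, h.eq, sub_self]

theorem HasWt.commute {D x : A} (h : HasWt 0 D x) : Commute D x := by
  rw [HasWt, zero_smul, sub_eq_zero] at h; exact h

theorem HasWt.congr {c d : ℂ} {x y : A} (h : HasWt c x y) (hc : c = d) : HasWt d x y := hc ▸ h

theorem HasWt.eq_self {D x : A} (h : HasWt 1 D x) : D * x - x * D = x := by
  rw [h, one_smul]

theorem HasWt.eq_neg {D x : A} (h : HasWt (-1) D x) : D * x - x * D = -x := by
  rw [h, neg_one_smul]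

theorem HasWt.mul {c d : ℂ} {D x y : A} (hx : HasWt c D x) (hy : HasWt d D y) :
    HasWt (c + d) D (x * y) := by
  have h : D * (x * y) - x * y * D = (D * x - x * D) * y + x * (D * y - y * D) := by noncomm_ring
  rw [HasWt, h, hx, hy, smul_mul_assoc, mul_smul_comm, add_smul]

theorem HasWt.add_right {c : ℂ} {D x y : A} (hx : HasWt c D x) (hy : HasWt c D y) :
    HasWt c D (x + y) := by
  have h : D * (x + y) - (x + y) * D = (D * x - x * D) + (D * y - y * D) := by noncomm_ring
  rw [HasWt, h, hx, hy, smul_add]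

theorem HasWt.add_left {c d : ℂ} {D D' x : A} (h : HasWt c D x) (h' : HasWt d D' x) :
    HasWt (c + d) (D + D') x := by
  have e : (D + D') * x - x * (D + D') = (D * x - x * D) + (D' * x - x * D') := by noncomm_ring
  rw [HasWt, e, h, h', add_smul]

theorem HasWt.smul_left {c : ℂ} {D x : A} (a : ℂ) (h : HasWt c D x) : HasWt (a * c) (a • D) x := by
  rw [HasWt, smul_mul_assoc, mul_smul_comm, ← smul_sub, h, smul_smul]

theorem HasWt.neg_left {c : ℂ} {D x : A} (h : HasWt c D x) : HasWt (-c) (-D) x := by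
  simpa using h.smul_left (-1)

theorem HasWt.sub_left {c d : ℂ} {D D' x : A} (h : HasWt c D x) (h' : HasWt d D' x) :
    HasWt (c - d) (D - D') x := by
  simpa [sub_eq_add_neg] using h.add_left h'.neg_left

theorem HasWt.sum_left {ι : Type*} {s : Finset ι} {c : ι → ℂ} {D : ι → A} {x : A}
    (h : ∀ i ∈ s, HasWt (c i) (D i) x) : HasWt (∑ i ∈ s, c i) (∑ i ∈ s, D i) x := by
  classical
  induction s using Finset.induction_on with
  | empty => simp [HasWt]
  | insert i s hi ih =>
    rw [Finset.sum_insert hi, Finset.sum_insert hi]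
    exact (h i (Finset.mem_insert_self _ _)).add_left
      (ih fun j hj => h j (Finset.mem_insert_of_mem hj))

end Weights

/-- Exponentiating a weight: if the diagonal operator `N` shifts by `δ` across `x`, then `Q ^ N`
commutes with `x` up to `Q ^ δ`. -/
theorem HasWt.opPow {B : Type*} {Q δ : ℂ} (hQ : Q ≠ 0) {c : B → ℂ}
    {x : Module.End ℂ (B →₀ ℂ)} (h : HasWt δ (diagOp c) x) :
    QComm (Q ^ δ) (opPow Q (diagOp c)) x := by
  rw [opPow_diagOp]
  refine op_ext fun z => Finsupp.ext fun y => ?_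
  have e := congrArg (fun T : Module.End ℂ (B →₀ ℂ) => T (Finsupp.single z 1) y) h
  simp only [LinearMap.sub_apply, Module.End.mul_apply, LinearMap.smul_apply, Finsupp.sub_apply,
    Finsupp.smul_apply, diagOp_apply, diagOp_single, one_mul, smul_eq_mul] at e ⊢
  have hs : ∀ a : ℂ, x (Finsupp.single z a) y = a * x (Finsupp.single z 1) y := fun a => by
    rw [← mul_one a, ← smul_eq_mul, ← Finsupp.smul_single, map_smul]; simp
  rw [hs (c z)] at e
  rw [hs (Q ^ c z)]
  by_cases hv : x (Finsupp.single z 1) y = 0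
  · simp [hv]
  · have hc : c y = δ + c z := by
      have : (c y - c z - δ) * x (Finsupp.single z 1) y = 0 := by linear_combination e
      rcases mul_eq_zero.1 this with h0 | h0
      · linear_combination h0
      · exact absurd h0 hv
    rw [hc, Complex.cpow_add _ _ hQ, mul_assoc]

/-- A weighted shift has weight `δ` under a diagonal operator if the eigenvalue grows by `δ` along
every step of nonzero weight. -/
theorem hasWt_wShift {B : Type*} {δ : ℂ} {c d : B → ℂ} {f : B → B}
    (h : ∀ x, d x ≠ 0 → c (f x) = c x + δ) : HasWt δ (diagOp c) (wShift f d) := by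
  refine op_ext fun x => ?_
  simp only [LinearMap.sub_apply, Module.End.mul_apply, LinearMap.smul_apply, wShift_single,
    diagOp_single, ← Finsupp.single_sub, Finsupp.smul_single, smul_eq_mul]
  congr 1
  by_cases hd : d x = 0
  · simp [hd]
  · rw [h x hd]; ring

/-! ### Quantum Serre expressions -/

section Serre

variable {A : Type*} [Ring A] [Algebra ℂ A]

theorem serre_zero (Q : ℂ) (x y : A) : serre Q 0 x y = x * y - y * x := by
  simp [serre, Finset.sum_range_succ, qBinom, sub_eq_add_neg]

theorem serre_neg_one (Q : ℂ) (x y : A) :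
    serre Q (-1) x y = x * x * y - (Q + Q⁻¹) • (x * y * x) + y * x * x := by
  have h : ((1 : ℤ) - -1).toNat = 2 := rfl
  simp only [serre, h, Finset.sum_range_succ, qBinom, pow_succ, mul_assoc]
  simp [sub_eq_add_neg]
  module

theorem serre_neg_two {Q : ℂ} (hQ : Q ≠ 0) (x y : A) :
    serre Q (-2) x y = x * x * x * y - (Q ^ 2 + 1 + Q⁻¹ ^ 2) • (x * x * y * x) +
      (Q ^ 2 + 1 + Q⁻¹ ^ 2) • (x * y * x * x) - y * x * x * x := by
  have h : ((1 : ℤ) - -2).toNat = 3 := rfl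
  simp only [serre, h, Finset.sum_range_succ, qBinom, pow_succ, mul_assoc]
  simp [sub_eq_add_neg]
  match_scalars <;> field_simp <;> ring

/-- For `a = 0, -1` the Serre expression is invariant under `Q ↦ Q⁻¹`, since the `Q`-binomials are.
-/
theorem serre_inv {Q : ℂ} {a : ℤ} (ha : a = 0 ∨ a = -1) (x y : A) :
    serre Q⁻¹ a x y = serre Q a x y := by
  rcases ha with rfl | rfl
  · rw [serre_zero, serre_zero]
  · rw [serre_neg_one, serre_neg_one, inv_inv, add_comm Q]

/-- Factors that commute with everything can be pulled out of a Serre expression. -/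
theorem serre_mul (Q : ℂ) (a : ℤ) {u v x y : A} (hux : Commute u x) (huy : Commute u y)
    (hvx : Commute v x) (huv : Commute u v) :
    serre Q a (u * x) (v * y) = u ^ (1 - a).toNat * v * serre Q a x y := by
  rw [serre, serre, Finset.mul_sum]
  refine Finset.sum_congr rfl fun t ht => ?_
  obtain ⟨s, hs⟩ : ∃ s, (1 - a).toNat = s + t :=
    ⟨_, (Nat.sub_add_cancel (Nat.lt_succ_iff.1 (Finset.mem_range.1 ht))).symm⟩
  rw [mul_smul_comm, hs, Nat.add_sub_cancel, hux.mul_pow, hux.mul_pow, pow_add]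
  congr 1
  have h1 : x ^ s * v = v * x ^ s := (hvx.pow_right s).eq.symm
  have h2 : y * u ^ t = u ^ t * y := (huy.pow_left t).eq.symm
  have h3 : x ^ s * u ^ t = u ^ t * x ^ s := (hux.pow_pow t s).eq.symm
  have h4 : v * u ^ t = u ^ t * v := (huv.pow_left t).eq.symm
  calc u ^ s * x ^ s * (v * y) * (u ^ t * x ^ t)
      = u ^ s * (x ^ s * v) * (y * u ^ t) * x ^ t := by simp only [mul_assoc]
    _ = u ^ s * v * (x ^ s * u ^ t) * y * x ^ t := by rw [h1, h2]; simp only [mul_assoc]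
    _ = u ^ s * (v * u ^ t) * x ^ s * y * x ^ t := by rw [h3]; simp only [mul_assoc]
    _ = u ^ s * u ^ t * v * (x ^ s * y * x ^ t) := by rw [h4]; simp only [mul_assoc]

/-- If `s` squares to zero and commutes with `z` up to a scalar, then `s z s = 0`. -/
theorem QComm.sandwich {c : ℂ} {z s : A} (h : QComm c z s) (hs : s * s = 0) : s * z * s = 0 := by
  rw [mul_assoc, h, mul_smul_comm, ← mul_assoc, hs, zero_mul, smul_zero]

/-- A relation `b B = Q⁻¹ B b + K` with `K B = Q B K` implies the Serre relation of `B` and `b`: it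
is the relation between `K` and `B` with `K` eliminated. -/
theorem serre_neg_one_of_osc_plus {Q : ℂ} (hQ : Q ≠ 0) {b B K : A}
    (h : b * B - Q⁻¹ • (B * b) = K) (hK : QComm Q K B) : serre Q (-1) B b = 0 := by
  rw [serre_neg_one]
  rw [QComm, ← h] at hK
  simp only [mul_sub, sub_mul, smul_mul_assoc, mul_smul_comm, smul_sub, smul_smul,
    mul_assoc, mul_inv_cancel₀ hQ, one_smul] at hK ⊢
  linear_combination (norm := module) hK

/-- The counterpart of `serre_neg_one_of_osc_plus` with the roles of `b` and `B` exchanged, where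
now `K b = Q⁻¹ b K`. -/
theorem serre_neg_one_of_osc_minus {Q : ℂ} (hQ : Q ≠ 0) {b B K : A}
    (h : b * B - Q⁻¹ • (B * b) = K) (hK : QComm Q⁻¹ K b) : serre Q (-1) b B = 0 := by
  rw [serre_neg_one]
  rw [QComm, ← h] at hK
  have hK' := congrArg (fun z => -Q • z) hK
  simp only [mul_sub, sub_mul, smul_mul_assoc, mul_smul_comm, smul_sub, smul_smul,
    mul_assoc] at hK' ⊢
  linear_combination (norm := skip) hK'
  match_scalars <;> field_simp <;> ring

/-- The Serre relation for sums, in the situation of the coproduct of a quantum group: the two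
pairs `(a, c)`, `(b, d)` satisfy it, and the mixed pairs commute up to powers of `Q`. -/
theorem serre_neg_one_add {Q : ℂ} (hQ : Q ≠ 0) {a b c d : A} (hba : QComm (Q⁻¹ ^ 2) b a)
    (had : QComm Q⁻¹ a d) (hbc : QComm Q b c) (hac : serre Q (-1) a c = 0)
    (hbd : serre Q (-1) b d = 0) : serre Q (-1) (a + b) (c + d) = 0 := by
  have hda : QComm Q d a := (had.symm (inv_ne_zero hQ)).congr (inv_inv Q)
  have e : serre Q (-1) (a + b) (c + d) = serre Q (-1) a c + serre Q (-1) b d := by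
    have hba' : ∀ z, b * (a * z) = Q⁻¹ ^ 2 • (a * (b * z)) := fun z => by
      rw [← mul_assoc, hba, smul_mul_assoc, mul_assoc]
    have hda' : ∀ z, d * (a * z) = Q • (a * (d * z)) := fun z => by
      rw [← mul_assoc, hda, smul_mul_assoc, mul_assoc]
    have hbc' : ∀ z, b * (c * z) = Q • (c * (b * z)) := fun z => by
      rw [← mul_assoc, hbc, smul_mul_assoc, mul_assoc]
    rw [QComm] at hba hda hbc
    simp only [serre_neg_one, mul_add, add_mul, mul_assoc]
    simp only [hba, hba', hda, hda', hbc, hbc', mul_smul_comm, smul_smul, smul_add]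
    match_scalars <;> field_simp <;> ring
  rw [e, hac, hbd, add_zero]

/-- The cubic Serre relation for a sum `a + b` whose second summand is nilpotent of order two. -/
theorem serre_neg_two_add {Q : ℂ} (hQ : Q ≠ 0) {a b c : A} (hba : QComm (Q⁻¹ ^ 2) b a)
    (hac : a * a * c - (1 + Q⁻¹ ^ 2) • (a * c * a) + Q⁻¹ ^ 2 • (c * a * a) = 0)
    (hbb : b * b = 0) (hbcb : b * c * b = 0) : serre Q (-2) (a + b) c = 0 := by
  -- normal ordering, with `a` to the left of `b` inside the words
  have hba' : ∀ z, b * (a * z) = Q⁻¹ ^ 2 • (a * (b * z)) := fun z => by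
    rw [← mul_assoc, hba, smul_mul_assoc, mul_assoc]
  have hab : a * b = Q ^ 2 • (b * a) := by
    rw [hba, smul_smul]
    have : Q ^ 2 * Q⁻¹ ^ 2 = 1 := by field_simp
    rw [this, one_smul]
  have hbb' : ∀ z, b * (b * z) = 0 := fun z => by rw [← mul_assoc, hbb, zero_mul]
  rw [mul_assoc] at hbcb
  have hbcb' : ∀ z, b * (c * (b * z)) = 0 := fun z => by
    rw [← mul_assoc c, ← mul_assoc, hbcb, zero_mul]
  have hbcab : b * (c * (a * b)) = 0 := by
    rw [hab, mul_smul_comm, mul_smul_comm, hbcb', smul_zero]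
  rw [QComm] at hba
  have h1 := congrArg (fun z => a * z) hac
  have h2 := congrArg (fun z => z * a) hac
  have h3 := congrArg (fun z => b * z) hac
  have h4 := congrArg (fun z => z * b) hac
  simp only [mul_add, add_mul, mul_sub, sub_mul, mul_assoc, mul_smul_comm, smul_mul_assoc,
    mul_zero, zero_mul, hba', smul_smul] at h1 h2 h3 h4
  rw [serre_neg_two hQ]
  simp only [mul_add, add_mul, mul_assoc]
  simp only [hba, hba', hbb, hbb', hbcb, hbcab, mul_smul_comm, smul_smul, smul_add,
    smul_zero, mul_zero]
  -- the terms cubic and quadratic in `a` come from `hac`; the others vanish by `hbb`, `hbcb`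
  linear_combination (norm := skip)
    h1 - Q ^ 2 • h2 + (Q ^ 2 * (Q ^ 2 + 1 + Q⁻¹ ^ 2)) • h3 - (Q ^ 2 + 1 + Q⁻¹ ^ 2) • h4
  match_scalars <;> field_simp <;> ring

end Serre

/-! ### Root combinatorics -/

/-- The coefficient of the `j`-th coordinate in the `i`-th simple root `ε_i - ε_{i+1}` of
`sl(l + 1)`. -/
def rootCoeff {l : ℕ} (i : Fin l) (j : Fin (l + 1)) : ℤ :=
  (if j = i.castSucc then 1 else 0) - (if j = i.succ then 1 else 0)

/-- The coefficient of the `j`-th coordinate in `ε_1 + … + ε_{n-1}`. -/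
def bodyCoeff {l : ℕ} (j : Fin (l + 1)) : ℤ := if j = Fin.last l then 0 else 1

theorem castSucc_ne_last {l : ℕ} (i : Fin l) : i.castSucc ≠ Fin.last l :=
  (Fin.castSucc_lt_last i).ne

theorem rootCoeff_cast {l : ℕ} (i : Fin l) (j : Fin (l + 1)) : ((rootCoeff i j : ℤ) : ℂ) =
    (if j = i.castSucc then 1 else 0) - (if j = i.succ then 1 else 0) := by
  simp [rootCoeff]

theorem cartan_castSucc {l : ℕ} (i j : Fin l) :
    cartan l i j.castSucc = rootCoeff i j.castSucc - rootCoeff i j.succ := by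
  have hi := i.2
  have hj := j.2
  simp only [cartan, rootCoeff, Fin.ext_iff, Fin.val_castSucc, Fin.val_succ]
  split_ifs <;> omega

theorem cartan_last {l : ℕ} (i : Fin l) :
    cartan l i (Fin.last l) = 2 * rootCoeff i (Fin.last l) := by
  have hi := i.2
  simp only [cartan, rootCoeff, Fin.ext_iff, Fin.val_castSucc, Fin.val_succ, Fin.val_last]
  split_ifs <;> omega

theorem cartan_self {l : ℕ} (i : Fin l) : cartan l i i.castSucc = 2 := by simp [cartan]

theorem cartan_symm {l : ℕ} (i j : Fin l) : cartan l i j.castSucc = cartan l j i.castSucc := by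
  have hi := i.2
  have hj := j.2
  simp only [cartan, Fin.val_castSucc]
  split_ifs <;> omega

/-- Distinct nodes of the Dynkin diagram of type `A` are adjacent or orthogonal. -/
theorem cartan_cases {l : ℕ} {i j : Fin l} (h : i ≠ j) :
    (cartan l i j.castSucc = -1 ∧ i.succ = j.castSucc) ∨
    (cartan l i j.castSucc = -1 ∧ j.succ = i.castSucc) ∨
    (cartan l i j.castSucc = 0 ∧ i.succ ≠ j.castSucc ∧ j.succ ≠ i.castSucc) := by
  have hi := i.2
  have hj := j.2
  rw [Ne, Fin.ext_iff] at h
  simp only [cartan, Fin.val_castSucc, Fin.ext_iff, Fin.val_succ, Ne]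
  split_ifs <;> omega

/-! ### Bilinears in bosons and in fermions -/

theorem IsFermions.mul_self_minus {A ι : Type*} [Ring A] [DecidableEq ι] {fm fp : ι → A}
    (H : IsFermions fm fp) (i : ι) : fm i * fm i = 0 := by
  rw [← sq, H.sq_minus]

theorem IsFermions.mul_self_plus {A ι : Type*} [Ring A] [DecidableEq ι] {fm fp : ι → A}
    (H : IsFermions fm fp) (i : ι) : fp i * fp i = 0 := by
  rw [← sq, H.sq_plus]

section Bilinears

variable {A : Type*} [Ring A] [Algebra ℂ A]

/-- Bosonic modes: different modes commute, and each mode satisfies the cubic relations that make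
the bilinears `b_i⁺ b_{i+1}⁻` satisfy the Serre relations of `U_Q(sl(n))`. They hold for `Q`-bosons,
and for ordinary bosons with `Q = 1`. -/
structure IsBosonic {ι : Type*} (Q : ℂ) (bm bp : ι → A) : Prop where
  comm (i j : ι) (h : i ≠ j) :
    Commute (bm i) (bm j) ∧ Commute (bp i) (bp j) ∧ Commute (bm i) (bp j)
  cubic_minus (i : ι) : serre Q (-1) (bm i) (bp i) = 0
  cubic_plus (i : ι) : serre Q (-1) (bp i) (bm i) = 0

variable {ι : Type*} {Q : ℂ} {bm bp : ι → A}

theorem IsBosonic.comm_minus (H : IsBosonic Q bm bp) (i j : ι) : Commute (bm i) (bm j) := by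
  by_cases h : i = j
  · rw [h]
  · exact (H.comm i j h).1

theorem IsBosonic.comm_plus (H : IsBosonic Q bm bp) (i j : ι) : Commute (bp i) (bp j) := by
  by_cases h : i = j
  · rw [h]
  · exact (H.comm i j h).2.1

theorem IsBosonic.bilinear_commute (H : IsBosonic Q bm bp) {a b c d : ι} (had : a ≠ d)
    (hbc : b ≠ c) : Commute (bp a * bm b) (bp c * bm d) :=
  .mul_left
    (.mul_right (H.comm_plus _ _) (H.comm _ _ had.symm).2.2.symm)
    (.mul_right (H.comm _ _ hbc).2.2 (H.comm_minus _ _))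

/-- The outer factors `b_a⁺` and `b_c⁻` commute with the rest, which leaves the cubic relation of
`b_b⁻` with `b_b⁺`. -/
theorem IsBosonic.serre_up (H : IsBosonic Q bm bp) {a b c : ι} (hab : a ≠ b) (hac : a ≠ c)
    (hbc : b ≠ c) : serre Q (-1) (bp a * bm b) (bp b * bm c) = 0 := by
  rw [(H.comm c b hbc.symm).2.2.symm.eq,
    serre_mul Q (-1) (H.comm b a hab.symm).2.2.symm (H.comm_plus a b) (H.comm_minus c b)
      (H.comm c a hac.symm).2.2.symm, H.cubic_minus, mul_zero]

/-- The outer factors `b_c⁻` and `b_a⁺` commute with the rest, which leaves the cubic relation of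
`b_b⁺` with `b_b⁻`. -/
theorem IsBosonic.serre_down (H : IsBosonic Q bm bp) {a b c : ι} (hac : a ≠ c)
    (hbc : b ≠ c) : serre Q (-1) (bp b * bm c) (bp a * bm b) = 0 := by
  rw [(H.comm c b hbc.symm).2.2.symm.eq,
    serre_mul Q (-1) (H.comm c b hbc.symm).2.2 (H.comm_minus c b) (H.comm_plus a b)
      (H.comm c a hac.symm).2.2, H.cubic_plus, mul_zero]

/-- The raising operators `b_i⁺ b_{i+1}⁻` satisfy the Serre relations. -/
theorem IsBosonic.serre_raise {l : ℕ} {bm bp : Fin (l + 1) → A} (H : IsBosonic Q bm bp)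
    {i j : Fin l} (h : i ≠ j) :
    serre Q (cartan l i j.castSucc) (bp i.castSucc * bm i.succ)
      (bp j.castSucc * bm j.succ) = 0 := by
  rcases cartan_cases h with ⟨hc, hij⟩ | ⟨hc, hij⟩ | ⟨hc, h1, h2⟩
  · rw [hc, ← hij]
    refine H.serre_up i.castSucc_lt_succ.ne ?_ ?_ <;> simp [Fin.ext_iff] at hij ⊢ <;> omega
  · rw [hc, ← hij]
    refine H.serre_down ?_ ?_ <;> (simp [Fin.ext_iff] at hij ⊢; omega)
  · rw [hc, serre_zero, sub_eq_zero]
    exact H.bilinear_commute h2.symm h1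

/-- The lowering operators `b_{i+1}⁺ b_i⁻` satisfy the Serre relations. -/
theorem IsBosonic.serre_lower {l : ℕ} {bm bp : Fin (l + 1) → A} (H : IsBosonic Q bm bp)
    {i j : Fin l} (h : i ≠ j) :
    serre Q (cartan l i j.castSucc) (bp i.succ * bm i.castSucc)
      (bp j.succ * bm j.castSucc) = 0 := by
  rcases cartan_cases h with ⟨hc, hij⟩ | ⟨hc, hij⟩ | ⟨hc, h1, h2⟩
  · rw [hc, ← hij]
    refine H.serre_down ?_ i.castSucc_lt_succ.ne'; simp [Fin.ext_iff] at hij ⊢; omega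
  · rw [hc, ← hij]
    refine H.serre_up ?_ ?_ j.castSucc_lt_succ.ne' <;> simp [Fin.ext_iff] at hij ⊢ <;> omega
  · rw [hc, serre_zero, sub_eq_zero]
    exact H.bilinear_commute h1 h2.symm

variable [DecidableEq ι] {fm fp : ι → A}

theorem IsFermions.qcomm_minus (H : IsFermions fm fp) (i j : ι) : QComm (-1) (fm i) (fm j) := by
  rw [QComm, neg_one_smul]; exact eq_neg_of_add_eq_zero_left (H.anti_minus i j)

theorem IsFermions.qcomm_plus (H : IsFermions fm fp) (i j : ι) : QComm (-1) (fp i) (fp j) := by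
  rw [QComm, neg_one_smul]; exact eq_neg_of_add_eq_zero_left (H.anti_plus i j)

theorem IsFermions.qcomm (H : IsFermions fm fp) {i j : ι} (h : i ≠ j) :
    QComm (-1) (fm i) (fp j) := by
  rw [QComm, neg_one_smul]
  exact eq_neg_of_add_eq_zero_left (by rw [H.rel, if_neg h])

theorem IsFermions.qcomm' (H : IsFermions fm fp) {i j : ι} (h : i ≠ j) :
    QComm (-1) (fp i) (fm j) :=
  ((H.qcomm h.symm).symm (by norm_num)).congr (by norm_num)

theorem IsFermions.bilinear_commute (H : IsFermions fm fp) {a b c d : ι} (had : a ≠ d)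
    (hbc : b ≠ c) : Commute (fp a * fm b) (fp c * fm d) :=
  ((QComm.mul_left
    (.mul_right (H.qcomm_plus _ _) (H.qcomm' had))
    (.mul_right (H.qcomm hbc) (H.qcomm_minus _ _))).congr (by norm_num)).commute

theorem IsFermions.bilinear_mul_self (H : IsFermions fm fp) {a b : ι} (hab : a ≠ b) :
    fp a * fm b * (fp a * fm b) = 0 := by
  rw [← mul_assoc, QComm.sandwich (H.qcomm hab.symm) (H.mul_self_plus a), zero_mul]

/-- The fermionic bilinears satisfy the Serre relations for every `Q`, since each monomial in them
vanishes. -/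
theorem IsFermions.serre_up (H : IsFermions fm fp) (Q : ℂ) {a b c : ι} (hab : a ≠ b) (hac : a ≠ c) :
    serre Q (-1) (fp a * fm b) (fp b * fm c) = 0 := by
  have h : fp a * fm b * (fp b * fm c) * (fp a * fm b) = 0 := by
    have e := QComm.sandwich (((H.qcomm hab.symm).mul_left (H.qcomm_plus b a)).mul_left
      (H.qcomm hac.symm)) (H.mul_self_plus a)
    calc _ = fp a * (fm b * fp b * fm c) * fp a * fm b := by simp only [mul_assoc]
      _ = 0 := by rw [e, zero_mul]
  rw [serre_neg_one, H.bilinear_mul_self hab, h, mul_assoc, H.bilinear_mul_self hab]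
  simp

theorem IsFermions.serre_down (H : IsFermions fm fp) (Q : ℂ) {a b c : ι} (hac : a ≠ c)
    (hbc : b ≠ c) : serre Q (-1) (fp b * fm c) (fp a * fm b) = 0 := by
  have h : fp b * fm c * (fp a * fm b) * (fp b * fm c) = 0 := by
    have e := QComm.sandwich (((H.qcomm' hac).mul_left (H.qcomm_minus b c)).mul_left
      (H.qcomm' hbc)) (H.mul_self_minus c)
    calc _ = fp b * (fm c * (fp a * fm b * fp b) * fm c) := by simp only [mul_assoc]
      _ = 0 := by rw [e, mul_zero]
  rw [serre_neg_one, H.bilinear_mul_self hbc, h, mul_assoc, H.bilinear_mul_self hbc]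
  simp

theorem IsFermions.serre_raise {l : ℕ} {fm fp : Fin (l + 1) → A} (H : IsFermions fm fp) (Q : ℂ)
    {i j : Fin l} (h : i ≠ j) :
    serre Q (cartan l i j.castSucc) (fp i.castSucc * fm i.succ)
      (fp j.castSucc * fm j.succ) = 0 := by
  rcases cartan_cases h with ⟨hc, hij⟩ | ⟨hc, hij⟩ | ⟨hc, h1, h2⟩
  · rw [hc, ← hij]
    refine H.serre_up Q i.castSucc_lt_succ.ne ?_; simp [Fin.ext_iff] at hij ⊢; omega
  · rw [hc, ← hij]
    refine H.serre_down Q ?_ ?_ <;> simp [Fin.ext_iff] at hij ⊢ <;> omega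
  · rw [hc, serre_zero, sub_eq_zero]
    exact H.bilinear_commute h2.symm h1

theorem IsFermions.serre_lower {l : ℕ} {fm fp : Fin (l + 1) → A} (H : IsFermions fm fp) (Q : ℂ)
    {i j : Fin l} (h : i ≠ j) :
    serre Q (cartan l i j.castSucc) (fp i.succ * fm i.castSucc)
      (fp j.succ * fm j.castSucc) = 0 := by
  rcases cartan_cases h with ⟨hc, hij⟩ | ⟨hc, hij⟩ | ⟨hc, h1, h2⟩
  · rw [hc, ← hij]
    refine H.serre_down Q ?_ i.castSucc_lt_succ.ne'; simp [Fin.ext_iff] at hij ⊢; omega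
  · rw [hc, ← hij]
    refine H.serre_up Q ?_ ?_ <;> simp [Fin.ext_iff] at hij ⊢ <;> omega
  · rw [hc, serre_zero, sub_eq_zero]
    exact H.bilinear_commute h1 h2.symm

/-- `φ_i⁺ φ_i⁻` is the number operator of the `i`-th fermion. -/
theorem IsFermions.num_plus (H : IsFermions fm fp) (i j : ι) :
    HasWt (if j = i then 1 else 0) (fp i * fm i) (fp j) := by
  by_cases h : j = i
  · subst h
    have e := H.rel j j
    rw [if_pos rfl] at e
    rw [if_pos rfl, HasWt, one_smul, mul_assoc, eq_sub_of_add_eq e, ← mul_assoc,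
      H.mul_self_plus, mul_sub, ← mul_assoc, H.mul_self_plus]
    simp
  · rw [if_neg h]
    exact .of_commute ((((H.qcomm_plus i j).mul_left (H.qcomm (Ne.symm h))).congr
      (by norm_num)).commute)

theorem IsFermions.num_minus (H : IsFermions fm fp) (i j : ι) :
    HasWt (-if j = i then 1 else 0) (fp i * fm i) (fm j) := by
  by_cases h : j = i
  · subst h
    have e := H.rel j j
    rw [if_pos rfl] at e
    rw [if_pos rfl, HasWt, neg_one_smul, mul_assoc, H.mul_self_minus, ← mul_assoc,
      eq_sub_of_add_eq e, sub_mul, mul_assoc, H.mul_self_minus]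
    simp
  · rw [if_neg h, neg_zero]
    exact .of_commute ((((H.qcomm' (Ne.symm h)).mul_left (H.qcomm_minus i j)).congr
      (by norm_num)).commute)

/-- The commutator of two opposite fermionic bilinears. -/
theorem IsFermions.bilinear_commutator (H : IsFermions fm fp) {a b : ι} (hab : a ≠ b) :
    fp a * fm b * (fp b * fm a) - fp b * fm a * (fp a * fm b) = fp a * fm a - fp b * fm b := by
  have e1 : fp a * fm b * (fp b * fm a) = fp a * fm a - fp b * fm b * (fp a * fm a) := by
    have e := H.rel b b
    rw [if_pos rfl] at e
    have hc := (H.bilinear_commute hab.symm hab.symm : Commute (fp b * fm b) (fp a * fm a)).eq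
    have hc' : Commute (fp a) (fp b * fm b) :=
      ((((H.qcomm_plus a b).mul_right (H.qcomm' hab)).congr (by norm_num)).commute)
    calc fp a * fm b * (fp b * fm a) = fp a * (fm b * fp b) * fm a := by simp only [mul_assoc]
      _ = fp a * fm a - fp a * (fp b * fm b) * fm a := by
        rw [eq_sub_of_add_eq e, mul_sub, mul_one, sub_mul]
      _ = _ := by rw [hc'.eq]; simp only [mul_assoc]
  have e2 : fp b * fm a * (fp a * fm b) = fp b * fm b - fp b * fm b * (fp a * fm a) := by
    have e := H.rel a a
    rw [if_pos rfl] at e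
    have hc' : Commute (fm b) (fp a * fm a) :=
      ((((H.qcomm hab.symm).mul_right (H.qcomm_minus b a)).congr (by norm_num)).commute)
    calc fp b * fm a * (fp a * fm b) = fp b * (fm a * fp a) * fm b := by simp only [mul_assoc]
      _ = fp b * fm b - fp b * ((fp a * fm a) * fm b) := by
        rw [eq_sub_of_add_eq e, mul_sub, mul_one, sub_mul]; simp only [mul_assoc]
      _ = _ := by rw [← hc'.eq]; simp only [mul_assoc]
  rw [e1, e2]; abel

end Bilinears

/-! ### Coproduct of two families of bilinears -/

section Coproduct

variable {A : Type*} [Ring A] [Algebra ℂ A]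

/-- The two summands `e ⊗ m` and `n ⊗ e'` of coproducts commute up to the quotient of the scalars
that the Cartan parts `m`, `n` produce. -/
theorem coproduct_qcomm {c d : ℂ} (hd : d ≠ 0) {e m e' n : A} (hee : Commute e e')
    (hmn : Commute m n) (hme : QComm c m e') (hne : QComm d n e) :
    QComm (c * d⁻¹) (e * m) (e' * n) :=
  (QComm.mul_left (.mul_right (.of_commute hee) (hne.symm hd))
    (.mul_right hme (.of_commute hmn))).congr (by ring)

/-- The Serre relations for `Δ(e_i) = e_i ⊗ K_i^{1/2} + K_i^{-1/2} ⊗ e_i`, where `e`, `e'` stand for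
the action on the two tensor factors, and `m`, `n` for the square roots of the Cartan elements. -/
theorem serre_coproduct {ι : Type*} {h : ℂ} (hh : h ≠ 0) {c : ι → ι → ℤ}
    (hsymm : ∀ i j, c i j = c j i) (hdiag : ∀ i, c i i = 2) {e e' m n : ι → A}
    (hee : ∀ i j, Commute (e i) (e' j)) (hme : ∀ i j, Commute (m i) (e j))
    (hne : ∀ i j, Commute (n i) (e' j)) (hmm : ∀ i j, Commute (m i) (m j))
    (hnn : ∀ i j, Commute (n i) (n j)) (hmn : ∀ i j, Commute (m i) (n j))
    (hme' : ∀ i j, QComm (h ^ c i j) (m i) (e' j)) (hne' : ∀ i j, QComm (h ^ (-c i j)) (n i) (e j))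
    {i j : ι} (hc : c i j = 0 ∨ c i j = -1) (he : serre (h ^ 2) (c i j) (e i) (e j) = 0)
    (he' : serre (h ^ 2) (c i j) (e' i) (e' j) = 0) :
    serre (h ^ 2) (c i j) (e i * m i + e' i * n i) (e j * m j + e' j * n j) = 0 := by
  have hq : ∀ i j, QComm (h ^ (2 * c i j)) (e i * m i) (e' j * n j) := fun i j =>
    (coproduct_qcomm (zpow_ne_zero _ hh) (hee i j) (hmn i j) (hme' i j)
      (hne' j i)).congr (by rw [hsymm j i, zpow_neg, inv_inv, ← zpow_add₀ hh, two_mul])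
  have hq' : ∀ i j, QComm (h ^ (-2 * c i j)) (e' j * n j) (e i * m i) := fun i j =>
    ((hq i j).symm (zpow_ne_zero _ hh)).congr (by rw [← zpow_neg, neg_mul])
  have h1 : serre (h ^ 2) (c i j) (e i * m i) (e j * m j) = 0 := by
    rw [← (hme i i).eq, ← (hme j j).eq,
      serre_mul _ _ (hme i i) (hme i j) (hme j i) (hmm i j), he, mul_zero]
  have h2 : serre (h ^ 2) (c i j) (e' i * n i) (e' j * n j) = 0 := by
    rw [← (hne i i).eq, ← (hne j j).eq,
      serre_mul _ _ (hne i i) (hne i j) (hne j i) (hnn i j), he', mul_zero]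
  rcases hc with hc | hc
  · have a1 := hq i j
    have a2 := hq' j i
    rw [hsymm j i] at a2
    rw [hc] at h1 h2 a1 a2 ⊢
    rw [serre_zero, sub_eq_zero] at h1 h2 ⊢
    simp only [mul_zero, zpow_zero] at a1 a2
    rw [mul_add, add_mul, add_mul, add_mul, mul_add, mul_add, h1, h2, a1.commute.eq, a2.commute.eq]
  · have a1 := hq i j
    have a2 := hq' j i
    have a3 := hq' i i
    rw [hsymm j i] at a2
    rw [hc] at h1 h2 a1 a2 ⊢
    rw [hdiag] at a3
    exact serre_neg_one_add (pow_ne_zero 2 hh)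
      (a3.congr (by rw [← inv_pow, ← pow_mul, ← zpow_natCast, inv_zpow, ← zpow_neg]; rfl))
      (a1.congr (by rw [← zpow_natCast, ← zpow_neg]; rfl))
      (a2.congr (by rw [← zpow_natCast]; rfl)) h1 h2

/-- The commutator of `Δ(e)` and `Δ(f)`. -/
theorem coproduct_commutator {h : ℂ} (hh : h ≠ 0) {c : ℤ} {e e' m n f f' m' n' : A}
    (hef : Commute e f') (hef' : Commute e' f) (hmf : Commute m f) (hme : Commute m' e)
    (hnf : Commute n f') (hne : Commute n' e') (hmn : Commute m n') (hmn' : Commute m' n)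
    (hmm : Commute m m') (hnn : Commute n n')
    (h1 : QComm (h ^ (-c)) m f') (h2 : QComm (h ^ (-c)) n' e) (h3 : QComm (h ^ c) n f)
    (h4 : QComm (h ^ c) m' e') :
    (e * m + e' * n) * (f * m' + f' * n') - (f * m' + f' * n') * (e * m + e' * n) =
      (e * f - f * e) * (m * m') + (e' * f' - f' * e') * (n * n') := by
  have a1 : e * m * (f' * n') = f' * n' * (e * m) :=
    ((coproduct_qcomm (zpow_ne_zero _ hh) hef hmn h1 h2).congr
      (mul_inv_cancel₀ (zpow_ne_zero _ hh))).commute.eq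
  have a2 : e' * n * (f * m') = f * m' * (e' * n) :=
    ((coproduct_qcomm (zpow_ne_zero _ hh) hef' hmn'.symm h3 h4).congr
      (mul_inv_cancel₀ (zpow_ne_zero _ hh))).commute.eq
  have a3 : e * m * (f * m') = e * f * (m * m') := by
    rw [mul_assoc, ← mul_assoc m, hmf.eq]; simp only [mul_assoc]
  have a4 : f * m' * (e * m) = f * e * (m * m') := by
    rw [mul_assoc, ← mul_assoc m', hme.eq, hmm.eq]; simp only [mul_assoc]
  have a5 : e' * n * (f' * n') = e' * f' * (n * n') := by
    rw [mul_assoc, ← mul_assoc n, hnf.eq]; simp only [mul_assoc]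
  have a6 : f' * n' * (e' * n) = f' * e' * (n * n') := by
    rw [mul_assoc, ← mul_assoc n', hne.eq, hnn.eq]; simp only [mul_assoc]
  rw [mul_add, add_mul, add_mul, mul_add, add_mul, add_mul, a1, a2, a3, a4, a5, a6, sub_mul,
    sub_mul]
  abel

end Coproduct

/-! ### The oscillator realization -/

/-- The data from which both the quantum and the classical oscillator realization of the extended
strange superalgebra are built, with `h` a square root of `Q`: bosonic modes with number operators
`Nb`, ordinary fermions, and the dressing factors `m i = Q ^ ((M_i - M_{i+1}) / 2)`,
`n i = Q ^ (-(N_i - N_{i+1}) / 2)`, `G = Q ^ (∑_{i<n} (N_i - M_i) / 2)`, of which only the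
commutation rules matter. In the classical case `h = 1` and the dressing factors are `1`. -/
structure OscSystem (A : Type*) [Ring A] [Algebra ℂ A] (l : ℕ) (h : ℂ) where
  bm : Fin (l + 1) → A
  bp : Fin (l + 1) → A
  fm : Fin (l + 1) → A
  fp : Fin (l + 1) → A
  Nb : Fin (l + 1) → A
  m : Fin l → A
  n : Fin l → A
  G : A
  h_ne : h ≠ 0
  bosonic : IsBosonic (h ^ 2) bm bp
  fermions : IsFermions fm fp
  mixed (i j : Fin (l + 1)) : Commute (bm i) (fm j) ∧ Commute (bm i) (fp j) ∧
    Commute (bp i) (fm j) ∧ Commute (bp i) (fp j)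
  num_bm (i j : Fin (l + 1)) : HasWt (-if j = i then 1 else 0) (Nb i) (bm j)
  num_bp (i j : Fin (l + 1)) : HasWt (if j = i then 1 else 0) (Nb i) (bp j)
  num_f (i j : Fin (l + 1)) : Commute (Nb i) (fm j) ∧ Commute (Nb i) (fp j)
  diag : ∀ x ∈ Set.range Nb ∪ Set.range m ∪ Set.range n ∪ {G},
    ∀ y ∈ Set.range Nb ∪ Set.range m ∪ Set.range n ∪ {G}, Commute x y
  m_b (i : Fin l) (j : Fin (l + 1)) : Commute (m i) (bm j) ∧ Commute (m i) (bp j)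
  m_fm (i : Fin l) (j : Fin (l + 1)) : QComm (h ^ (-rootCoeff i j)) (m i) (fm j)
  m_fp (i : Fin l) (j : Fin (l + 1)) : QComm (h ^ rootCoeff i j) (m i) (fp j)
  n_f (i : Fin l) (j : Fin (l + 1)) : Commute (n i) (fm j) ∧ Commute (n i) (fp j)
  n_bm (i : Fin l) (j : Fin (l + 1)) : QComm (h ^ rootCoeff i j) (n i) (bm j)
  n_bp (i : Fin l) (j : Fin (l + 1)) : QComm (h ^ (-rootCoeff i j)) (n i) (bp j)
  G_bm (j : Fin (l + 1)) : QComm (h ^ (-bodyCoeff j)) G (bm j)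
  G_bp (j : Fin (l + 1)) : QComm (h ^ bodyCoeff j) G (bp j)
  G_fm (j : Fin (l + 1)) : QComm (h ^ bodyCoeff j) G (fm j)
  G_fp (j : Fin (l + 1)) : QComm (h ^ (-bodyCoeff j)) G (fp j)

namespace OscSystem

variable {A : Type*} [Ring A] [Algebra ℂ A] {l : ℕ} {h : ℂ} (O : OscSystem A l h)

/-- The number operator of the `i`-th fermion. -/
def Nf (i : Fin (l + 1)) : A := O.fp i * O.fm i

/-- The even raising generator `X_i`, `i < n`. -/
def Xe (i : Fin l) : A :=
  O.bp i.castSucc * O.bm i.succ * O.m i + O.fp i.castSucc * O.fm i.succ * O.n i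

/-- The odd generator `X_n`. -/
def Xo : A := O.bp (Fin.last l) * O.fp (Fin.last l) * O.G

/-- The generators `X_1, …, X_n`. -/
def X (j : Fin (l + 1)) : A := Fin.snoc (α := fun _ => A) O.Xe O.Xo j

/-- The lowering generator `Y_i`. -/
def Y (i : Fin l) : A :=
  O.bp i.succ * O.bm i.castSucc * O.m i + O.fp i.succ * O.fm i.castSucc * O.n i

/-- The Cartan generator `T_i`. -/
def T (i : Fin l) : A := O.Nb i.castSucc - O.Nb i.succ + O.Nf i.castSucc - O.Nf i.succ

/-- The extending generator `D`. -/
noncomputable def D : A := (1 / 2 : ℂ) • (∑ i, O.Nb i) + (1 / 2 : ℂ) • (∑ i, O.Nf i)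

theorem X_castSucc (i : Fin l) : O.X i.castSucc = O.Xe i := by simp [X]

theorem X_last : O.X (Fin.last l) = O.Xo := by simp [X]

theorem comm_Nb_Nb (i j) : Commute (O.Nb i) (O.Nb j) := O.diag _ (by simp) _ (by simp)
theorem comm_Nb_m (i j) : Commute (O.Nb i) (O.m j) := O.diag _ (by simp) _ (by simp)
theorem comm_Nb_n (i j) : Commute (O.Nb i) (O.n j) := O.diag _ (by simp) _ (by simp)
theorem comm_Nb_G (i) : Commute (O.Nb i) O.G := O.diag _ (by simp) _ (by simp)
theorem comm_m_m (i j) : Commute (O.m i) (O.m j) := O.diag _ (by simp) _ (by simp)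
theorem comm_m_n (i j) : Commute (O.m i) (O.n j) := O.diag _ (by simp) _ (by simp)
theorem comm_m_G (i) : Commute (O.m i) O.G := O.diag _ (by simp) _ (by simp)
theorem comm_n_n (i j) : Commute (O.n i) (O.n j) := O.diag _ (by simp) _ (by simp)
theorem comm_n_G (i) : Commute (O.n i) O.G := O.diag _ (by simp) _ (by simp)

theorem bilinear_mixed (a b c d) : Commute (O.bp a * O.bm b) (O.fp c * O.fm d) :=
  .mul_left (.mul_right (O.mixed a c).2.2.2 (O.mixed a d).2.2.1)
    (.mul_right (O.mixed b c).2.1 (O.mixed b d).1)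

theorem m_bilinear_b (i a b) : Commute (O.m i) (O.bp a * O.bm b) :=
  .mul_right (O.m_b i a).2 (O.m_b i b).1

theorem n_bilinear_f (i a b) : Commute (O.n i) (O.fp a * O.fm b) :=
  .mul_right (O.n_f i a).2 (O.n_f i b).1

theorem m_bilinear_f (i a b) :
    QComm (h ^ (rootCoeff i a - rootCoeff i b)) (O.m i) (O.fp a * O.fm b) :=
  ((O.m_fp i a).mul_right (O.m_fm i b)).congr (by rw [← zpow_add₀ O.h_ne, sub_eq_add_neg])

theorem n_bilinear_b (i a b) :
    QComm (h ^ (-(rootCoeff i a - rootCoeff i b))) (O.n i) (O.bp a * O.bm b) :=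
  ((O.n_bp i a).mul_right (O.n_bm i b)).congr (by rw [← zpow_add₀ O.h_ne]; congr 1; ring)

theorem serre_Xe {i j : Fin l} (hij : i ≠ j) :
    serre (h ^ 2) (cartan l i j.castSucc) (O.Xe i) (O.Xe j) = 0 :=
  serre_coproduct O.h_ne cartan_symm cartan_self
    (e := fun i => O.bp i.castSucc * O.bm i.succ) (e' := fun i => O.fp i.castSucc * O.fm i.succ)
    (fun _ _ => O.bilinear_mixed _ _ _ _) (fun _ _ => O.m_bilinear_b _ _ _)
    (fun _ _ => O.n_bilinear_f _ _ _) O.comm_m_m O.comm_n_n O.comm_m_n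
    (fun _ _ => (O.m_bilinear_f _ _ _).congr (by rw [cartan_castSucc]))
    (fun _ _ => (O.n_bilinear_b _ _ _).congr (by rw [cartan_castSucc]))
    (by rcases cartan_cases hij with h | h | h <;> simp [h.1]) (O.bosonic.serre_raise hij)
    (O.fermions.serre_raise _ hij)

/-- In the lowering generators the dressing factors shift weights in the opposite direction. This is
the same coproduct with `h⁻¹` for `h`, and the Serre expressions do not see the difference. -/
theorem serre_Y {i j : Fin l} (hij : i ≠ j) :
    serre (h ^ 2) (cartan l i j.castSucc) (O.Y i) (O.Y j) = 0 := by
  have hc : cartan l i j.castSucc = 0 ∨ cartan l i j.castSucc = -1 := by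
    rcases cartan_cases hij with h | h | h <;> simp [h.1]
  rw [← serre_inv hc, ← inv_pow]
  refine serre_coproduct (inv_ne_zero O.h_ne) cartan_symm cartan_self
    (e := fun i => O.bp i.succ * O.bm i.castSucc) (e' := fun i => O.fp i.succ * O.fm i.castSucc)
    (fun _ _ => O.bilinear_mixed _ _ _ _) (fun _ _ => O.m_bilinear_b _ _ _)
    (fun _ _ => O.n_bilinear_f _ _ _) O.comm_m_m O.comm_n_n O.comm_m_n
    (fun _ _ => (O.m_bilinear_f _ _ _).congr (by rw [cartan_castSucc, inv_zpow', neg_sub]))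
    (fun _ _ => (O.n_bilinear_b _ _ _).congr (by rw [cartan_castSucc, inv_zpow']; congr 1; ring))
    hc ?_ ?_
  · rw [inv_pow, serre_inv hc]; exact O.bosonic.serre_lower hij
  · exact O.fermions.serre_lower _ hij

/-- The mixed terms cancel, so that bosons and fermions contribute separately. -/
theorem Xe_Y_commutator (i j : Fin l) :
    O.Xe i * O.Y j - O.Y j * O.Xe i =
      (O.bp i.castSucc * O.bm i.succ * (O.bp j.succ * O.bm j.castSucc) -
        O.bp j.succ * O.bm j.castSucc * (O.bp i.castSucc * O.bm i.succ)) * (O.m i * O.m j) +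
      (O.fp i.castSucc * O.fm i.succ * (O.fp j.succ * O.fm j.castSucc) -
        O.fp j.succ * O.fm j.castSucc * (O.fp i.castSucc * O.fm i.succ)) * (O.n i * O.n j) :=
  coproduct_commutator O.h_ne (c := cartan l i j.castSucc)
    (O.bilinear_mixed _ _ _ _) (O.bilinear_mixed _ _ _ _).symm (O.m_bilinear_b _ _ _)
    (O.m_bilinear_b _ _ _) (O.n_bilinear_f _ _ _) (O.n_bilinear_f _ _ _) (O.comm_m_n _ _)
    (O.comm_m_n _ _) (O.comm_m_m _ _) (O.comm_n_n _ _)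
    ((O.m_bilinear_f _ _ _).congr (by rw [cartan_castSucc, neg_sub]))
    ((O.n_bilinear_b _ _ _).congr (by rw [cartan_symm, cartan_castSucc]))
    ((O.n_bilinear_b _ _ _).congr (by rw [cartan_castSucc, neg_sub]))
    ((O.m_bilinear_f _ _ _).congr (by rw [cartan_symm, cartan_castSucc]))

theorem Xe_Y_of_ne {i j : Fin l} (hij : i ≠ j) : O.Xe i * O.Y j - O.Y j * O.Xe i = 0 := by
  have h1 : i.castSucc ≠ j.castSucc := fun e => hij (Fin.castSucc_injective _ e)
  have h2 : i.succ ≠ j.succ := fun e => hij (Fin.succ_injective _ e)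
  rw [Xe_Y_commutator, (O.bosonic.bilinear_commute h1 h2).eq,
    (O.fermions.bilinear_commute h1 h2).eq, sub_self, sub_self, zero_mul, zero_mul, add_zero]

/-- The fermionic part is explicit; the bosonic part depends on the kind of bosons. -/
theorem Xe_Y_self (i : Fin l) : O.Xe i * O.Y i - O.Y i * O.Xe i =
    (O.bp i.castSucc * O.bm i.succ * (O.bp i.succ * O.bm i.castSucc) -
      O.bp i.succ * O.bm i.castSucc * (O.bp i.castSucc * O.bm i.succ)) * (O.m i * O.m i) +
    (O.Nf i.castSucc - O.Nf i.succ) * (O.n i * O.n i) := by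
  rw [Xe_Y_commutator, O.fermions.bilinear_commutator i.castSucc_lt_succ.ne]; rfl

/-- A dressed bosonic bilinear commutes up to a scalar with `X_n`. -/
theorem bilinear_b_Xo (i : Fin l) (a b) (hb : b ≠ Fin.last l) :
    QComm (h ^ (rootCoeff i (Fin.last l) - bodyCoeff a + bodyCoeff b))
      (O.bp a * O.bm b * O.m i) O.Xo := by
  have z : ∀ k : ℤ, h ^ k ≠ 0 := fun k => zpow_ne_zero _ O.h_ne
  have k1 := ((QComm.of_commute (O.bosonic.comm_plus a (Fin.last l))).mul_right
    (.of_commute (O.mixed a (Fin.last l)).2.2.2)).mul_right ((O.G_bp a).symm (z _))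
  have k2 := ((QComm.of_commute (O.bosonic.comm b _ hb).2.2).mul_right
    (.of_commute (O.mixed b (Fin.last l)).2.1)).mul_right ((O.G_bm b).symm (z _))
  have k3 := ((QComm.of_commute (O.m_b i (Fin.last l)).2).mul_right
    (O.m_fp i (Fin.last l))).mul_right (.of_commute (O.comm_m_G i))
  refine ((k1.mul_left k2).mul_left k3).congr ?_
  simp only [one_mul, mul_one, ← zpow_neg, ← zpow_add₀ O.h_ne]
  congr 1; ring

/-- A dressed fermionic bilinear commutes up to a scalar with `X_n`. -/
theorem bilinear_f_Xo (i : Fin l) (a b) (hb : b ≠ Fin.last l) :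
    QComm (h ^ (-rootCoeff i (Fin.last l) + bodyCoeff a - bodyCoeff b))
      (O.fp a * O.fm b * O.n i) O.Xo := by
  have z : ∀ k : ℤ, h ^ k ≠ 0 := fun k => zpow_ne_zero _ O.h_ne
  have k1 := ((QComm.of_commute (O.mixed (Fin.last l) a).2.2.2.symm).mul_right
    (O.fermions.qcomm_plus a (Fin.last l))).mul_right ((O.G_fp a).symm (z _))
  have k2 := ((QComm.of_commute (O.mixed (Fin.last l) b).2.2.1.symm).mul_right
    (O.fermions.qcomm hb)).mul_right ((O.G_fm b).symm (z _))
  have k3 := ((O.n_bp i (Fin.last l)).mul_right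
    (.of_commute (O.n_f i (Fin.last l)).2)).mul_right (.of_commute (O.comm_n_G i))
  refine ((k1.mul_left k2).mul_left k3).congr ?_
  simp only [one_mul, mul_one, neg_mul, mul_neg, neg_neg, ← zpow_neg, ← zpow_add₀ O.h_ne]
  congr 1; ring

/-- `X_n` commutes with the lowering generators: the scalars produced by `G` and by the dressing
factors cancel. -/
theorem Xo_Y (i : Fin l) : O.Xo * O.Y i - O.Y i * O.Xo = 0 := by
  have hc := castSucc_ne_last i
  have e : rootCoeff i (Fin.last l) = bodyCoeff i.succ - bodyCoeff i.castSucc := by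
    simp only [rootCoeff, bodyCoeff, if_neg hc, eq_comm (a := Fin.last l)]
    split_ifs <;> rfl
  have h1 := (O.bilinear_b_Xo i i.succ i.castSucc hc).congr (d := 1) (by
    rw [e, ← zpow_zero h]; congr 1; ring)
  have h2 := (O.bilinear_f_Xo i i.succ i.castSucc hc).congr (d := 1) (by
    rw [e, ← zpow_zero h]; congr 1; ring)
  rw [sub_eq_zero]
  exact ((h1.commute.add_left h2.commute).eq).symm

/-- `X_n` squares to zero because its fermionic factor does. -/
theorem Xo_mul_self : O.Xo * O.Xo = 0 := by
  have k := ((QComm.of_commute (O.mixed (Fin.last l) (Fin.last l)).2.2.2).mul_left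
    (O.G_fp (Fin.last l))).mul_left (.of_commute (O.mixed (Fin.last l) (Fin.last l)).2.2.2)
  have e := k.sandwich (O.fermions.mul_self_plus _)
  have c := (O.mixed (Fin.last l) (Fin.last l)).2.2.2
  calc O.Xo * O.Xo = O.bp (Fin.last l) * O.fp (Fin.last l) * (O.G * O.bp (Fin.last l) *
        O.fp (Fin.last l) * O.G) := by simp only [Xo, mul_assoc]
    _ = O.fp (Fin.last l) * (O.bp (Fin.last l) * O.G * O.bp (Fin.last l)) * O.fp (Fin.last l) *
        O.G := by rw [c.eq]; simp only [mul_assoc]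
    _ = 0 := by rw [e, zero_mul]

/-- The bosonic part of `X_i` and the fermionic part of `X_j` commute up to a scalar. -/
theorem dressed_qcomm (i j : Fin l) : QComm (h ^ (2 * cartan l i j.castSucc))
    (O.bp i.castSucc * O.bm i.succ * O.m i) (O.fp j.castSucc * O.fm j.succ * O.n j) :=
  (coproduct_qcomm (zpow_ne_zero _ O.h_ne) (O.bilinear_mixed _ _ _ _) (O.comm_m_n _ _)
    (O.m_bilinear_f _ _ _) (O.n_bilinear_b _ _ _)).congr (by
      rw [← cartan_castSucc, ← cartan_castSucc, cartan_symm j i, zpow_neg, inv_inv,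
        ← zpow_add₀ O.h_ne, two_mul])

/-- Sandwiching `z` between two copies of the fermionic part of `X_i` gives zero, because `φ_i⁺` can
be moved through `z` to meet its copy. -/
theorem fermionic_mul_fp (i : Fin l) {c : ℂ} {z : A} (hz : QComm c z (O.fp i.castSucc)) :
    O.fp i.castSucc * O.fm i.succ * O.n i * z * (O.fp i.castSucc * O.fm i.succ * O.n i) = 0 := by
  have k := ((O.fermions.qcomm (i.castSucc_lt_succ.ne')).mul_left
    (.of_commute (O.n_f i i.castSucc).2)).mul_left hz
  have e := k.sandwich (O.fermions.mul_self_plus _)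
  calc _ = O.fp i.castSucc * (O.fm i.succ * O.n i * z) * O.fp i.castSucc *
        (O.fm i.succ * O.n i) := by simp only [mul_assoc]
    _ = 0 := by rw [e, zero_mul]

/-- With `n` the last mode, the bosonic part of `X_{n-1}` satisfies a quadratic Serre relation with
`X_n`, inherited from that of `b_n⁻` with `b_n⁺`. -/
theorem quadratic_Xo (i : Fin l) (hi : i.succ = Fin.last l) :
    let a := O.bp i.castSucc * O.bm i.succ * O.m i
    a * a * O.Xo - (1 + (h ^ 2)⁻¹ ^ 2) • (a * O.Xo * a) + (h ^ 2)⁻¹ ^ 2 • (O.Xo * a * a) = 0 := by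
  intro a
  have hh := O.h_ne
  have hne : i.castSucc ≠ Fin.last l := castSucc_ne_last i
  -- split off the last mode: `a = b p` and `X_n = B r`, where `p` and `r` commute up to `h ^ 2`
  set b := O.bm (Fin.last l) with hb
  set B := O.bp (Fin.last l) with hB
  set p := O.bp i.castSucc * O.m i with hp
  set r := O.fp (Fin.last l) * O.G with hr
  have ha : a = b * p := by
    simp only [a, hi, hp, hb, ← mul_assoc, (O.bosonic.comm _ _ hne.symm).2.2.eq]
  have hc : O.Xo = B * r := by simp only [Xo, hr, hB, mul_assoc]
  have hpb : Commute p b := .mul_left (O.bosonic.comm _ _ hne.symm).2.2.symm (O.m_b _ _).1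
  have hpB : Commute p B := .mul_left (O.bosonic.comm_plus _ _) (O.m_b _ _).2
  have hrb : Commute r b :=
    .mul_left (O.mixed _ _).2.1.symm ((O.G_bm _).congr (by simp [bodyCoeff])).commute
  have hrp : r * p = h ^ 2 • (p * r) := by
    have k1 := (QComm.of_commute (O.mixed i.castSucc (Fin.last l)).2.2.2.symm).mul_right
      ((O.m_fp i (Fin.last l)).symm (zpow_ne_zero _ hh))
    have k2 := (O.G_bp i.castSucc).mul_right (.of_commute (O.comm_m_G i).symm)
    refine ((k1.mul_left k2).congr ?_ : QComm (h ^ 2) r p)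
    have h1 : rootCoeff i (Fin.last l) = -1 := by simp [rootCoeff, hi, hne.symm]
    have h2 : bodyCoeff i.castSucc = 1 := by simp [bodyCoeff, hne]
    rw [h1, h2]; simp [sq]
  have e1 : a * a * O.Xo = b * b * B * (p * p * r) := by
    rw [ha, hc]
    simp only [mul_assoc, hpb.left_comm, hpB.left_comm]
  have e2 : a * O.Xo * a = h ^ 2 • (b * B * b * (p * p * r)) := by
    rw [ha, hc]
    simp only [mul_assoc, hpb.left_comm, hpB.left_comm, hrb.left_comm, hrp, mul_smul_comm]
  have e3 : O.Xo * a * a = (h ^ 2 * h ^ 2) • (B * b * b * (p * p * r)) := by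
    rw [ha, hc]
    simp only [mul_assoc, hpb.left_comm, hrb.left_comm, hrp, mul_smul_comm, smul_mul_assoc,
      smul_smul]
  have key := congrArg (fun z => z * (p * p * r)) (O.bosonic.cubic_minus (Fin.last l))
  rw [serre_neg_one] at key
  simp only [add_mul, sub_mul, smul_mul_assoc, zero_mul] at key
  rw [e1, e2, e3]
  linear_combination (norm := skip) key
  match_scalars <;> field_simp <;> ring

/-- The Serre relations with `X_n` at second place. Only `X_{n-1}` does not commute with `X_n`, and
there the relation is cubic. -/
theorem serre_Xe_Xo (i : Fin l) :
    serre (h ^ 2) (cartan l i (Fin.last l)) (O.Xe i) O.Xo = 0 := by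
  have hne : i.castSucc ≠ Fin.last l := castSucc_ne_last i
  by_cases hi : i.succ = Fin.last l
  · have hc : cartan l i (Fin.last l) = -2 := by
      rw [cartan_last]; simp [rootCoeff, hi, hne.symm]
    rw [hc]
    -- `X_n` commutes up to a scalar with the fermion `φ_{n-1}⁺` of the fermionic part
    have k := ((QComm.of_commute (O.mixed (Fin.last l) i.castSucc).2.2.2).mul_left
      (O.fermions.qcomm_plus (Fin.last l) i.castSucc)).mul_left (O.G_fp i.castSucc)
    refine serre_neg_two_add (pow_ne_zero 2 O.h_ne) ?_ (O.quadratic_Xo i hi) ?_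
      (O.fermionic_mul_fp i k)
    · refine ((O.dressed_qcomm i i).symm (zpow_ne_zero _ O.h_ne)).congr ?_
      rw [cartan_self, ← inv_pow, ← pow_mul, inv_pow]; rfl
    · simpa using O.fermionic_mul_fp i (c := 1) (z := 1) (by simp [QComm])
  · have e : rootCoeff i (Fin.last l) = 0 := by
      simp [rootCoeff, hne.symm, eq_comm (a := Fin.last l), hi]
    rw [cartan_last, e, mul_zero, serre_zero, sub_eq_zero]
    refine (Commute.add_left ((O.bilinear_b_Xo i i.castSucc i.succ hi).congr ?_).commute
      ((O.bilinear_f_Xo i i.castSucc i.succ hi).congr ?_).commute).eq <;>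
    simp [e, bodyCoeff, hi, hne]

/-! ### Weights of the generators -/

theorem Nf_fp (i j) : HasWt (if j = i then 1 else 0) (O.Nf i) (O.fp j) := O.fermions.num_plus i j

theorem Nf_fm (i j) : HasWt (-if j = i then 1 else 0) (O.Nf i) (O.fm j) := O.fermions.num_minus i j

theorem Nf_b (i j) : Commute (O.Nf i) (O.bp j) ∧ Commute (O.Nf i) (O.bm j) :=
  ⟨.mul_left (O.mixed _ _).2.2.2.symm (O.mixed _ _).2.2.1.symm,
    .mul_left (O.mixed _ _).2.1.symm (O.mixed _ _).1.symm⟩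

theorem Nf_m (i j) : Commute (O.Nf i) (O.m j) :=
  ((O.m_bilinear_f j i i).congr (by simp)).commute.symm

theorem Nf_n (i j) : Commute (O.Nf i) (O.n j) := (O.n_bilinear_f j i i).symm

theorem Nf_G (i) : Commute (O.Nf i) O.G :=
  (((O.G_fp i).mul_right (O.G_fm i)).congr (by
    rw [← zpow_add₀ O.h_ne, neg_add_cancel, zpow_zero])).commute.symm

theorem Nf_Nf (i j) : Commute (O.Nf i) (O.Nf j) := by
  by_cases h : i = j
  · rw [h]
  · exact O.fermions.bilinear_commute h h

theorem Nf_Nb (i j) : Commute (O.Nf i) (O.Nb j) :=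
  (Commute.mul_right (O.num_f j i).2 (O.num_f j i).1).symm

/-- The weight of a dressed pair of bilinears under an operator of bosonic and fermionic weights
`c`. -/
theorem hasWt_dressed {E : A} {c : Fin (l + 1) → ℂ} (hbp : ∀ j, HasWt (c j) E (O.bp j))
    (hbm : ∀ j, HasWt (-c j) E (O.bm j)) (hfp : ∀ j, HasWt (c j) E (O.fp j))
    (hfm : ∀ j, HasWt (-c j) E (O.fm j)) (hm : ∀ i, Commute E (O.m i))
    (hn : ∀ i, Commute E (O.n i)) (a b : Fin (l + 1)) (i : Fin l) :
    HasWt (c a - c b) E (O.bp a * O.bm b * O.m i + O.fp a * O.fm b * O.n i) :=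
  .add_right
    ((((hbp a).mul (hbm b)).mul (.of_commute (hm i))).congr (by ring))
    ((((hfp a).mul (hfm b)).mul (.of_commute (hn i))).congr (by ring))

theorem T_bp (i j) : HasWt (rootCoeff i j : ℂ) (O.T i) (O.bp j) :=
  ((((O.num_bp _ j).sub_left (O.num_bp _ j)).add_left (.of_commute (O.Nf_b _ j).1)).sub_left
    (.of_commute (O.Nf_b _ j).1)).congr (by rw [rootCoeff_cast]; ring)

theorem T_bm (i j) : HasWt (-(rootCoeff i j : ℂ)) (O.T i) (O.bm j) :=
  ((((O.num_bm _ j).sub_left (O.num_bm _ j)).add_left (.of_commute (O.Nf_b _ j).2)).sub_left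
    (.of_commute (O.Nf_b _ j).2)).congr (by rw [rootCoeff_cast]; ring)

theorem T_fp (i j) : HasWt (rootCoeff i j : ℂ) (O.T i) (O.fp j) :=
  (((((HasWt.of_commute (O.num_f _ j).2).sub_left (.of_commute (O.num_f _ j).2))).add_left
    (O.Nf_fp _ j)).sub_left (O.Nf_fp _ j)).congr (by rw [rootCoeff_cast]; ring)

theorem T_fm (i j) : HasWt (-(rootCoeff i j : ℂ)) (O.T i) (O.fm j) :=
  (((((HasWt.of_commute (O.num_f _ j).1).sub_left (.of_commute (O.num_f _ j).1))).add_left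
    (O.Nf_fm _ j)).sub_left (O.Nf_fm _ j)).congr (by rw [rootCoeff_cast]; ring)

theorem T_commute {x : A} (hb : ∀ i, Commute (O.Nb i) x) (hf : ∀ i, Commute (O.Nf i) x) (i) :
    Commute (O.T i) x :=
  (((hb _).sub_left (hb _)).add_left (hf _)).sub_left (hf _)

theorem T_m (i j) : Commute (O.T i) (O.m j) :=
  O.T_commute (fun _ => O.comm_Nb_m _ _) (fun _ => O.Nf_m _ _) i

theorem T_n (i j) : Commute (O.T i) (O.n j) :=
  O.T_commute (fun _ => O.comm_Nb_n _ _) (fun _ => O.Nf_n _ _) i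

theorem T_G (i) : Commute (O.T i) O.G := O.T_commute O.comm_Nb_G O.Nf_G i

theorem T_Xe (i j : Fin l) : HasWt (cartan l i j.castSucc : ℂ) (O.T i) (O.Xe j) :=
  (O.hasWt_dressed (O.T_bp i) (O.T_bm i) (O.T_fp i) (O.T_fm i) (O.T_m i) (O.T_n i) _ _ j).congr
    (by rw [cartan_castSucc]; push_cast; ring)

theorem T_Y (i j : Fin l) : HasWt (-cartan l i j.castSucc : ℂ) (O.T i) (O.Y j) :=
  (O.hasWt_dressed (O.T_bp i) (O.T_bm i) (O.T_fp i) (O.T_fm i) (O.T_m i) (O.T_n i) _ _ j).congr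
    (by rw [cartan_castSucc]; push_cast; ring)

theorem T_Xo (i : Fin l) : HasWt (cartan l i (Fin.last l) : ℂ) (O.T i) O.Xo :=
  (((O.T_bp i _).mul (O.T_fp i _)).mul (.of_commute (O.T_G i))).congr
    (by rw [cartan_last]; push_cast; ring)

theorem T_X (i : Fin l) (j : Fin (l + 1)) : HasWt (cartan l i j : ℂ) (O.T i) (O.X j) := by
  refine Fin.lastCases ?_ (fun j => ?_) j
  · rw [X_last]; exact O.T_Xo i
  · rw [X_castSucc]; exact O.T_Xe i j

theorem T_T (i j : Fin l) : Commute (O.T i) (O.T j) :=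
  O.T_commute (fun _ => (O.T_commute (fun _ => O.comm_Nb_Nb _ _) (fun _ => O.Nf_Nb _ _) j).symm)
    (fun _ => (O.T_commute (fun _ => (O.Nf_Nb _ _).symm) (fun _ => O.Nf_Nf _ _) j).symm) i

theorem D_bp (j) : HasWt (1 / 2) O.D (O.bp j) :=
  (((HasWt.sum_left fun i _ => O.num_bp i j).smul_left _).add_left
    ((HasWt.sum_left fun i _ => HasWt.of_commute (O.Nf_b i j).1).smul_left _)).congr (by simp)

theorem D_bm (j) : HasWt (-(1 / 2)) O.D (O.bm j) :=
  (((HasWt.sum_left fun i _ => O.num_bm i j).smul_left _).add_left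
    ((HasWt.sum_left fun i _ => HasWt.of_commute (O.Nf_b i j).2).smul_left _)).congr (by simp)

theorem D_fp (j) : HasWt (1 / 2) O.D (O.fp j) :=
  (((HasWt.sum_left fun i _ => HasWt.of_commute (O.num_f i j).2).smul_left _).add_left
    ((HasWt.sum_left fun i _ => O.Nf_fp i j).smul_left _)).congr (by simp)

theorem D_fm (j) : HasWt (-(1 / 2)) O.D (O.fm j) :=
  (((HasWt.sum_left fun i _ => HasWt.of_commute (O.num_f i j).1).smul_left _).add_left
    ((HasWt.sum_left fun i _ => O.Nf_fm i j).smul_left _)).congr (by simp)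

theorem D_commute {x : A} (hb : ∀ i, Commute (O.Nb i) x) (hf : ∀ i, Commute (O.Nf i) x) :
    Commute O.D x :=
  ((Commute.sum_left _ _ _ fun i _ => hb i).smul_left _).add_left
    ((Commute.sum_left _ _ _ fun i _ => hf i).smul_left _)

theorem D_m (j) : Commute O.D (O.m j) :=
  O.D_commute (fun _ => O.comm_Nb_m _ _) (fun _ => O.Nf_m _ _)

theorem D_n (j) : Commute O.D (O.n j) :=
  O.D_commute (fun _ => O.comm_Nb_n _ _) (fun _ => O.Nf_n _ _)

theorem D_Xe (j : Fin l) : Commute O.D (O.Xe j) :=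
  ((O.hasWt_dressed O.D_bp O.D_bm O.D_fp O.D_fm O.D_m O.D_n _ _ j).congr (by ring)).commute

theorem D_Y (j : Fin l) : Commute O.D (O.Y j) :=
  ((O.hasWt_dressed O.D_bp O.D_bm O.D_fp O.D_fm O.D_m O.D_n _ _ j).congr (by ring)).commute

theorem D_T (j : Fin l) : Commute O.D (O.T j) :=
  (O.T_commute (fun _ => (O.D_commute (fun _ => O.comm_Nb_Nb _ _) (fun _ => O.Nf_Nb _ _)).symm)
    (fun _ => (O.D_commute (fun _ => (O.Nf_Nb _ _).symm) (fun _ => O.Nf_Nf _ _)).symm) j).symm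

theorem D_Xo : HasWt 1 O.D O.Xo :=
  (((O.D_bp _).mul (O.D_fp _)).mul (.of_commute (O.D_commute O.comm_Nb_G O.Nf_G))).congr
    (by ring)

end OscSystem

/-! ### Representations from generators and relations -/

section Lifts

variable {A : Type*} [Ring A] [Algebra ℂ A] {l : ℕ}

theorem map_serre {A' : Type*} [Ring A'] [Algebra ℂ A'] (f : A →ₐ[ℂ] A') (Q : ℂ) (a : ℤ)
    (x y : A) :
    f (serre Q a x y) = serre Q a (f x) (f y) := by
  simp [serre, map_sum]

/-- Any system of oscillators with `h ^ 2 = 1` represents `P̃(n)`, provided that the one relation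
that is not a consequence of the commutation rules, `[X_i, Y_i] = T_i`, holds. -/
theorem OscSystem.exists_strange {h : ℂ} (O : OscSystem A l h) (hh : h ^ 2 = 1)
    (hXY : ∀ i, O.Xe i * O.Y i - O.Y i * O.Xe i = O.T i) :
    ∃ σ : UStrange l →ₐ[ℂ] A, (∀ j, σ (UStrange.gen (PGen.X j)) = O.X j) ∧
      (∀ i, σ (UStrange.gen (PGen.Y i)) = O.Y i) ∧ (∀ i, σ (UStrange.gen (PGen.T i)) = O.T i) ∧
      σ (UStrange.gen PGen.D) = O.D := by
  let φ : PGen l → A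
    | PGen.X j => O.X j
    | PGen.Y i => O.Y i
    | PGen.T i => O.T i
    | PGen.D => O.D
  have hφ : ∀ x y, P.Rel l x y → FreeAlgebra.lift ℂ φ x = FreeAlgebra.lift ℂ φ y := by
    intro x y hxy
    cases hxy with
    | x_y j i =>
      refine Fin.lastCases ?_ (fun j => ?_) j
      · have := (castSucc_ne_last i).symm
        simpa [P.x, P.y, φ, this, X_last] using O.Xo_Y i
      · by_cases hij : j = i
        · subst hij
          simpa [P.x, P.y, P.t, φ, X_castSucc] using hXY j
        · simpa [P.x, P.y, φ, hij, X_castSucc] using O.Xe_Y_of_ne hij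
    | t_x i j => simpa [P.x, P.t, φ, HasWt, Int.cast_smul_eq_zsmul] using O.T_X i j
    | y_t i j =>
      have e := O.T_Y j i
      rw [HasWt, neg_smul, Int.cast_smul_eq_zsmul, cartan_symm] at e
      simpa [P.y, P.t, φ] using congrArg Neg.neg e
    | t_t i j => simpa [P.t, φ, sub_eq_zero] using (O.T_T i j).eq
    | d_x i => simpa [P.d, P.x, φ, sub_eq_zero, X_castSucc] using (O.D_Xe i).eq
    | d_y i => simpa [P.d, P.y, φ, sub_eq_zero] using (O.D_Y i).eq
    | d_t i => simpa [P.d, P.t, φ, sub_eq_zero] using (O.D_T i).eq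
    | d_x_last => simpa [P.d, P.x, φ, HasWt, X_last] using O.D_Xo
    | x_last_sq => simpa [P.x, φ, X_last] using O.Xo_mul_self
    | serre_x i j hj =>
      rw [map_serre, map_zero, ← hh]
      revert hj
      refine Fin.lastCases (fun _ => ?_) (fun j hj => ?_) j
      · simpa [P.x, φ, X_last, X_castSucc] using O.serre_Xe_Xo i
      · simpa [P.x, φ, X_castSucc] using O.serre_Xe fun e : i = j => hj (e ▸ rfl)
    | serre_y i j hij =>
      rw [map_serre, map_zero, ← hh]
      simpa [P.y, φ] using O.serre_Y hij
  refine ⟨RingQuot.liftAlgHom ℂ ⟨FreeAlgebra.lift ℂ φ, fun x y => hφ x y⟩, ?_, ?_, ?_, ?_⟩ <;>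
  simp [UStrange.gen, φ]

/-- Any system of oscillators with `h ^ 2 = Q` represents `P̃_Q(n)`, with `K`, `K'` in the role of
`Q ^ T_i`, `Q ^ (-T_i)`, provided that the commutators `[X_i, Y_i]` are as prescribed. -/
theorem OscSystem.exists_quantum {h Q : ℂ} (O : OscSystem A l h) (hh : h ^ 2 = Q)
    (K K' : Fin l → A)
    (hKK' : ∀ i, K i * K' i = 1) (hK'K : ∀ i, K' i * K i = 1) (hK : ∀ i j, Commute (K i) (K j))
    (hKT : ∀ i j, Commute (K i) (O.T j)) (hKD : ∀ i, Commute (K i) O.D)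
    (hKX : ∀ i j, QComm (Q ^ cartan l i j) (K i) (O.X j))
    (hKY : ∀ i j, QComm (Q ^ (-cartan l i j.castSucc)) (K i) (O.Y j))
    (hXY : ∀ i, O.Xe i * O.Y i - O.Y i * O.Xe i = (Q - Q⁻¹)⁻¹ • (K i - K' i)) :
    ∃ τ : QUStrange l Q →ₐ[ℂ] A, (∀ j, τ (QUStrange.gen Q (QPGen.X j)) = O.X j) ∧
      (∀ i, τ (QUStrange.gen Q (QPGen.Y i)) = O.Y i) ∧
      (∀ i, τ (QUStrange.gen Q (QPGen.T i)) = O.T i) ∧ τ (QUStrange.gen Q QPGen.D) = O.D ∧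
      (∀ i, τ (QUStrange.gen Q (QPGen.K i)) = K i) ∧
      (∀ i, τ (QUStrange.gen Q (QPGen.Kinv i)) = K' i) := by
  let φ : QPGen l → A
    | QPGen.X j => O.X j
    | QPGen.Y i => O.Y i
    | QPGen.T i => O.T i
    | QPGen.D => O.D
    | QPGen.K i => K i
    | QPGen.Kinv i => K' i
  have hφ : ∀ x y, QP.Rel l Q x y → FreeAlgebra.lift ℂ φ x = FreeAlgebra.lift ℂ φ y := by
    intro x y hxy
    cases hxy with
    | x_y j i =>
      refine Fin.lastCases ?_ (fun j => ?_) j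
      · have := (castSucc_ne_last i).symm
        simpa [QP.x, QP.y, φ, this, X_last] using O.Xo_Y i
      · by_cases hij : j = i
        · subst hij
          simpa [QP.x, QP.y, QP.k, QP.k', φ, X_castSucc] using hXY j
        · simpa [QP.x, QP.y, φ, hij, X_castSucc] using O.Xe_Y_of_ne hij
    | t_x i j => simpa [QP.x, QP.t, φ, HasWt, Int.cast_smul_eq_zsmul] using O.T_X i j
    | y_t i j =>
      have e := O.T_Y j i
      rw [HasWt, neg_smul, Int.cast_smul_eq_zsmul, cartan_symm] at e
      simpa [QP.y, QP.t, φ] using congrArg Neg.neg e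
    | t_t i j => simpa [QP.t, φ, sub_eq_zero] using (O.T_T i j).eq
    | d_x i => simpa [QP.d, QP.x, φ, sub_eq_zero, X_castSucc] using (O.D_Xe i).eq
    | d_y i => simpa [QP.d, QP.y, φ, sub_eq_zero] using (O.D_Y i).eq
    | d_t i => simpa [QP.d, QP.t, φ, sub_eq_zero] using (O.D_T i).eq
    | d_x_last => simpa [QP.d, QP.x, φ, HasWt, X_last] using O.D_Xo
    | x_last_sq => simpa [QP.x, φ, X_last] using O.Xo_mul_self
    | serre_x i j hj =>
      rw [map_serre, map_zero, ← hh]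
      revert hj
      refine Fin.lastCases (fun _ => ?_) (fun j hj => ?_) j
      · simpa [QP.x, φ, X_last, X_castSucc] using O.serre_Xe_Xo i
      · simpa [QP.x, φ, X_castSucc] using O.serre_Xe fun e : i = j => hj (e ▸ rfl)
    | serre_y i j hij =>
      rw [map_serre, map_zero, ← hh]
      simpa [QP.y, φ] using O.serre_Y hij
    | k_k' i => simpa [QP.k, QP.k', φ] using hKK' i
    | k'_k i => simpa [QP.k, QP.k', φ] using hK'K i
    | k_k i j => simpa [QP.k, φ] using (hK i j).eq
    | k_t i j => simpa [QP.k, QP.t, φ] using (hKT i j).eq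
    | k_d i => simpa [QP.k, QP.d, φ] using (hKD i).eq
    | k_x i j => simpa [QP.k, QP.k', QP.x, φ] using (hKX i j).conj (hKK' i)
    | k_y i j => simpa [QP.k, QP.k', QP.y, φ] using (hKY i j).conj (hKK' i)
  refine ⟨RingQuot.liftAlgHom ℂ ⟨FreeAlgebra.lift ℂ φ, fun x y => hφ x y⟩,
    ?_, ?_, ?_, ?_, ?_, ?_⟩ <;>
  simp [QUStrange.gen, φ]

/-- A representation of `U_q(sl(n))` on bilinears in bosonic modes. -/
theorem exists_uqSl {q : ℂ} {cm cp : Fin (l + 1) → A} (H : IsBosonic q cm cp) (K K' : Fin l → A)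
    (hKK' : ∀ i, K i * K' i = 1) (hK'K : ∀ i, K' i * K i = 1) (hK : ∀ i j, Commute (K i) (K j))
    (hKm : ∀ i j, QComm (q ^ rootCoeff i j) (K i) (cm j))
    (hKp : ∀ i j, QComm (q ^ (-rootCoeff i j)) (K i) (cp j)) (hq : q ≠ 0)
    (hEF : ∀ i : Fin l, cm i.castSucc * cp i.succ * (cp i.castSucc * cm i.succ) -
      cp i.castSucc * cm i.succ * (cm i.castSucc * cp i.succ) = (q - q⁻¹)⁻¹ • (K i - K' i)) :
    ∃ π : UqSl l q →ₐ[ℂ] A,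
      (∀ i, π (UqSl.gen q (UqGen.E i)) = cm i.castSucc * cp i.succ) ∧
      (∀ i, π (UqSl.gen q (UqGen.F i)) = cp i.castSucc * cm i.succ) ∧
      (∀ i, π (UqSl.gen q (UqGen.K i)) = K i) ∧ (∀ i, π (UqSl.gen q (UqGen.Kinv i)) = K' i) := by
  let φ : UqGen l → A
    | UqGen.E i => cm i.castSucc * cp i.succ
    | UqGen.F i => cp i.castSucc * cm i.succ
    | UqGen.K i => K i
    | UqGen.Kinv i => K' i
  have hE : ∀ i : Fin l, cm i.castSucc * cp i.succ = cp i.succ * cm i.castSucc := fun i =>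
    (H.comm _ _ i.castSucc_lt_succ.ne).2.2.eq
  have hφ : ∀ x y, Uq.Rel l q x y → FreeAlgebra.lift ℂ φ x = FreeAlgebra.lift ℂ φ y := by
    intro x y hxy
    cases hxy with
    | k_k' i => simpa [Uq.k, Uq.k', φ] using hKK' i
    | k'_k i => simpa [Uq.k, Uq.k', φ] using hK'K i
    | k_k i j => simpa [Uq.k, φ] using (hK i j).eq
    | k_e i j =>
      have e := (((hKm i j.castSucc).mul_right (hKp i j.succ)).congr
        (d := q ^ cartan l i j.castSucc)
        (by rw [← zpow_add₀ hq, cartan_castSucc, sub_eq_add_neg])).conj (hKK' i)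
      simpa [Uq.k, Uq.k', Uq.e, φ] using e
    | k_f i j =>
      have e := (((hKp i j.castSucc).mul_right (hKm i j.succ)).congr
        (d := q ^ (-cartan l i j.castSucc))
        (by rw [← zpow_add₀ hq, cartan_castSucc]; congr 1; ring)).conj (hKK' i)
      simpa [Uq.k, Uq.k', Uq.f, φ] using e
    | e_f i j =>
      by_cases hij : i = j
      · subst hij
        simpa [Uq.e, Uq.f, Uq.k, Uq.k', φ] using hEF i
      · have h1 : i.castSucc ≠ j.castSucc := fun e => hij (Fin.castSucc_injective _ e)
        have h2 : i.succ ≠ j.succ := fun e => hij (Fin.succ_injective _ e)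
        have e := (H.bilinear_commute h2 h1).eq
        rw [← sub_eq_zero, ← hE] at e
        simpa [Uq.e, Uq.f, φ, hij] using e
    | serre_e i j hij =>
      rw [map_serre, map_zero]
      simpa [Uq.e, φ, hE] using H.serre_lower hij
    | serre_f i j hij =>
      rw [map_serre, map_zero]
      simpa [Uq.f, φ] using H.serre_raise hij
  refine ⟨RingQuot.liftAlgHom ℂ ⟨FreeAlgebra.lift ℂ φ, fun x y => hφ x y⟩, ?_, ?_, ?_, ?_⟩ <;>
  simp [UqSl.gen, φ]

end Lifts

/-- The image of a representation given on generators is generated by their images. -/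
theorem range_eq_adjoin {X A : Type*} [Ring A] [Algebra ℂ A]
    {r : FreeAlgebra ℂ X → FreeAlgebra ℂ X → Prop} (f : RingQuot r →ₐ[ℂ] A) {φ : X → A}
    (h : ∀ g, f (RingQuot.mkAlgHom ℂ r (FreeAlgebra.ι ℂ g)) = φ g) :
    f.range = Algebra.adjoin ℂ (Set.range φ) := by
  have e : f.comp (RingQuot.mkAlgHom ℂ r) = FreeAlgebra.lift ℂ φ := by
    ext g; simpa using h g
  have : f.range = (f.comp (RingQuot.mkAlgHom ℂ r)).range := by
    rw [AlgHom.range_comp, (AlgHom.range_eq_top _).2 (RingQuot.mkAlgHom_surjective ℂ r),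
      Algebra.map_top]
  rw [this, e, Algebra.adjoin_range_eq_range_freeAlgebra_lift]

/-! ### Operators on a single mode of the Fock space -/

section Modes

variable {l : ℕ}

/-- The operator on the `i`-th bosonic mode sending `|m⟩` to `c m` times `|f m⟩`. -/
noncomputable def modeOp (i : Fin (l + 1)) (f : ℕ → ℕ) (c : ℕ → ℂ) : Op l :=
  wShift (fun x => (Function.update x.1 i (f (x.1 i)), x.2)) (fun x => c (x.1 i))

/-- The operator on the fermionic modes sending `|s⟩` to `c s` times `|f s⟩`. -/
noncomputable def spinOp (f : Finset (Fin (l + 1)) → Finset (Fin (l + 1)))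
    (c : Finset (Fin (l + 1)) → ℂ) : Op l :=
  wShift (fun x => (x.1, f x.2)) (fun x => c x.2)

theorem bosM_eq (w : ℕ → ℂ) (i : Fin (l + 1)) :
    bosM w i = modeOp i (fun m => m - 1) (fun m => if m = 0 then 0 else w m) := rfl

theorem bosP_eq (w : ℕ → ℂ) (i : Fin (l + 1)) :
    bosP w i = modeOp i (fun m => m + 1) (fun m => w (m + 1)) := rfl

theorem modeOp_mul (i : Fin (l + 1)) (f g : ℕ → ℕ) (c d : ℕ → ℂ) :
    modeOp i f c * modeOp i g d = modeOp i (f ∘ g) (fun m => d m * c (g m)) := by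
  rw [modeOp, modeOp, wShift_mul]
  exact wShift_congr (fun x => by simp) (fun x _ => by simp)

theorem modeOp_congr (i : Fin (l + 1)) {f g : ℕ → ℕ} {c d : ℕ → ℂ} (hc : ∀ m, c m = d m)
    (hf : ∀ m, c m ≠ 0 → f m = g m) : modeOp i f c = modeOp i g d :=
  wShift_congr (fun _ => hc _) fun x hx => by rw [hf _ hx]

theorem modeOp_id (i : Fin (l + 1)) (c : ℕ → ℂ) : modeOp i id c = diagOp fun x => c (x.1 i) :=
  wShift_congr (fun _ => rfl) fun x _ => by simp

theorem modeOp_eq_diagOp (i : Fin (l + 1)) {f : ℕ → ℕ} {c d : ℕ → ℂ} (hc : ∀ m, c m = d m)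
    (hf : ∀ m, c m ≠ 0 → f m = m) : modeOp i f c = diagOp fun x => d (x.1 i) := by
  rw [← modeOp_id]; exact modeOp_congr i hc hf

theorem modeOp_commute {i j : Fin (l + 1)} (h : i ≠ j) (f g : ℕ → ℕ) (c d : ℕ → ℂ) :
    Commute (modeOp i f c) (modeOp j g d) := by
  rw [Commute, SemiconjBy, modeOp, modeOp, wShift_mul, wShift_mul]
  refine wShift_congr (fun x => ?_) (fun x _ => ?_)
  · simp [Function.update_of_ne h, Function.update_of_ne h.symm, mul_comm]
  · simp [Function.update_of_ne h, Function.update_of_ne h.symm, Function.update_comm h]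

theorem modeOp_commute_spinOp (i : Fin (l + 1)) (f c g d) :
    Commute (modeOp i f c) (spinOp g d) := by
  rw [Commute, SemiconjBy, modeOp, spinOp, wShift_mul, wShift_mul]
  exact wShift_congr (fun x => mul_comm _ _) (fun x _ => rfl)

theorem modeOp_pow (i : Fin (l + 1)) (f : ℕ → ℕ) (c : ℕ → ℂ) (k : ℕ) :
    modeOp i f c ^ k = modeOp i (f^[k]) (fun m => ∏ j ∈ Finset.range k, c (f^[j] m)) := by
  induction k with
  | zero =>
    rw [pow_zero, Function.iterate_zero, modeOp_id, ← diagOp_one]; simp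
  | succ k ih =>
    rw [pow_succ', ih, modeOp_mul, ← Function.iterate_succ']
    simp only [Finset.prod_range_succ]

theorem smul_modeOp (a : ℂ) (i : Fin (l + 1)) (f c) :
    a • modeOp i f c = modeOp i f (fun m => a * c m) := smul_wShift _ _ _

theorem modeOp_zero (i : Fin (l + 1)) (f : ℕ → ℕ) : modeOp i f (fun _ => 0) = 0 :=
  op_ext fun x => by simp [modeOp, wShift_single]

theorem ferM_eq (i : Fin (l + 1)) :
    ferM i = spinOp (fun s => s.erase i) (fun s => if i ∈ s then ferSign i s else 0) := rfl

theorem ferP_eq (i : Fin (l + 1)) :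
    ferP i = spinOp (fun s => insert i s) (fun s => if i ∈ s then 0 else ferSign i s) := rfl

theorem numF_eq (i : Fin (l + 1)) :
    numF i = spinOp id (fun s => if i ∈ s then 1 else 0) := rfl

theorem parity_eq : parity l = spinOp id (fun s => (-1) ^ s.card) := rfl

/-- A mode operator shifts the number operators of that mode only. -/
theorem hasWt_modeOp {i j : Fin (l + 1)} {f : ℕ → ℕ} {c d : ℕ → ℂ} {δ : ℂ}
    (h : ∀ m, c m ≠ 0 → d (f m) = d m + δ) :
    HasWt (if j = i then δ else 0) (diagOp fun x : Occ l => d (x.1 i)) (modeOp j f c) := by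
  refine hasWt_wShift fun x hx => ?_
  by_cases hij : j = i
  · subst hij; simpa using h _ hx
  · simp [hij, Function.update_of_ne (Ne.symm hij)]

theorem hasWt_spinOp {f : Finset (Fin (l + 1)) → Finset (Fin (l + 1))}
    {c d : Finset (Fin (l + 1)) → ℂ} {δ : ℂ} (h : ∀ s, c s ≠ 0 → d (f s) = d s + δ) :
    HasWt δ (diagOp fun x : Occ l => d x.2) (spinOp f c) :=
  hasWt_wShift fun x hx => h x.2 hx

theorem num_bosM (i j : Fin (l + 1)) (w : ℕ → ℂ) :
    HasWt (-if j = i then 1 else 0) (numB i) (bosM w j) := by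
  have h := hasWt_modeOp (i := i) (j := j) (f := fun m => m - 1)
    (c := fun m => if m = 0 then 0 else w m) (d := fun m => (m : ℂ)) (δ := -1) fun m hm => by
      have h : m ≠ 0 := fun h => hm (if_pos h)
      obtain ⟨m, rfl⟩ := Nat.exists_eq_succ_of_ne_zero h
      simp
  rw [numB, bosM_eq]
  exact h.congr (by split_ifs <;> simp)

theorem num_bosP (i j : Fin (l + 1)) (w : ℕ → ℂ) :
    HasWt (if j = i then 1 else 0) (numB i) (bosP w j) := by
  rw [numB, bosP_eq]
  exact hasWt_modeOp (d := fun m => (m : ℂ)) fun m _ => by simp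

theorem numB_eq (i : Fin (l + 1)) : numB i = modeOp i id (fun m => (m : ℂ)) := by
  rw [modeOp_id, numB]

theorem numB_commute_spinOp (i : Fin (l + 1)) (f c) : Commute (numB i) (spinOp f c) := by
  rw [numB_eq]; exact modeOp_commute_spinOp i _ _ _ _

theorem numF_ferP (i j : Fin (l + 1)) : HasWt (if j = i then 1 else 0) (numF i) (ferP j) := by
  rw [numF, ferP_eq]
  refine hasWt_spinOp (d := fun s => if i ∈ s then 1 else 0) fun s hs => ?_
  have h : j ∉ s := fun h => hs (if_pos h)
  by_cases hij : j = i
  · subst hij; simp [h]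
  · simp [hij, Ne.symm hij]

theorem numF_ferM (i j : Fin (l + 1)) : HasWt (-if j = i then 1 else 0) (numF i) (ferM j) := by
  rw [numF, ferM_eq]
  refine hasWt_spinOp (d := fun s => if i ∈ s then 1 else 0) fun s hs => ?_
  have h : j ∈ s := by by_contra h; exact hs (if_neg h)
  by_cases hij : j = i
  · subst hij; simp [h]
  · simp [hij, Ne.symm hij]

theorem numF_commute_modeOp (i j : Fin (l + 1)) (f c) : Commute (numF i) (modeOp j f c) := by
  rw [numF_eq]; exact (modeOp_commute_spinOp j f c _ _).symm

/-! ### The fermions -/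

theorem ferSign_mul_self (i : Fin (l + 1)) (s) : ferSign i s * ferSign i s = 1 := by
  rw [ferSign, ← mul_pow]; norm_num

theorem ferSign_insert {i j : Fin (l + 1)} {s : Finset (Fin (l + 1))} (h : j ∉ s) :
    ferSign i (insert j s) = (if j < i then -1 else 1) * ferSign i s := by
  rw [ferSign, ferSign, Finset.filter_insert]
  split_ifs
  · rw [Finset.card_insert_of_notMem (by simp [h]), pow_succ']
  · rw [one_mul]

theorem ferSign_erase {i j : Fin (l + 1)} {s : Finset (Fin (l + 1))} (h : j ∈ s) :
    ferSign i (s.erase j) = (if j < i then -1 else 1) * ferSign i s := by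
  have e := ferSign_insert (i := i) (Finset.notMem_erase j s)
  rw [Finset.insert_erase h] at e
  rw [e]; split_ifs <;> ring

theorem spinOp_mul (f g : Finset (Fin (l + 1)) → Finset (Fin (l + 1))) (c d) :
    spinOp f c * spinOp g d = spinOp (f ∘ g) (fun s => d s * c (g s)) := wShift_mul _ _ _ _

/-- It suffices to compare the weights, and the underlying maps where the weights do not vanish. -/
theorem spinOp_anticommute {f g : Finset (Fin (l + 1)) → Finset (Fin (l + 1))}
    {c d : Finset (Fin (l + 1)) → ℂ} (h : ∀ s, d s * c (g s) = -(c s * d (f s)))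
    (h' : ∀ s, d s * c (g s) ≠ 0 → f (g s) = g (f s)) :
    spinOp f c * spinOp g d + spinOp g d * spinOp f c = 0 := by
  rw [spinOp_mul, spinOp_mul]
  have : spinOp (f ∘ g) (fun s => d s * c (g s)) = spinOp (g ∘ f) (fun s => -(c s * d (f s))) :=
    wShift_congr (fun x => h _) (fun x hx => Prod.ext rfl (h' _ hx))
  rw [this]
  exact (wShift_add _ _ _).trans (op_ext fun x => by simp [wShift_single])

theorem ferM_anti (i j : Fin (l + 1)) : ferM i * ferM j + ferM j * ferM i = 0 := by
  rw [ferM_eq, ferM_eq]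
  refine spinOp_anticommute (fun s => ?_) (fun s _ => Finset.erase_right_comm)
  by_cases hij : i = j
  · subst hij; simp
  by_cases hi : i ∈ s <;> by_cases hj : j ∈ s <;>
    simp only [Finset.mem_erase, hi, hj, hij, Ne.symm hij, if_true, if_false, and_true, and_false,
      ne_eq, not_false_eq_true, ferSign_erase, mul_zero, zero_mul, neg_zero]
  rcases lt_or_gt_of_ne hij with h | h <;> simp [h, h.not_gt, mul_comm]

theorem ferP_anti (i j : Fin (l + 1)) : ferP i * ferP j + ferP j * ferP i = 0 := by
  rw [ferP_eq, ferP_eq]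
  refine spinOp_anticommute (fun s => ?_) (fun s _ => Finset.insert_comm _ _ _)
  by_cases hij : i = j
  · subst hij; simp
  by_cases hi : i ∈ s <;> by_cases hj : j ∈ s <;>
    simp only [Finset.mem_insert, hi, hj, hij, Ne.symm hij, if_true, if_false, or_true, or_false,
      ferSign_insert, mul_zero, zero_mul, neg_zero, not_false_eq_true]
  rcases lt_or_gt_of_ne hij with h | h <;> simp [h, h.not_gt, mul_comm]

theorem ferP_ferM_anti {i j : Fin (l + 1)} (hij : i ≠ j) :
    ferP i * ferM j + ferM j * ferP i = 0 := by
  rw [ferM_eq, ferP_eq]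
  refine spinOp_anticommute (fun s => ?_) (fun s _ => (Finset.erase_insert_of_ne hij).symm)
  by_cases hi : i ∈ s <;> by_cases hj : j ∈ s <;>
    simp only [Finset.mem_insert, Finset.mem_erase, hi, hj, hij, Ne.symm hij, if_true, if_false,
      or_true, or_false, ferSign_insert, ferSign_erase, mul_zero, zero_mul, neg_zero,
      not_false_eq_true, and_true, and_false, ne_eq]
  rcases lt_or_gt_of_ne hij with h | h <;> simp [h, h.not_gt, mul_comm]

theorem ferP_mul_ferM (i : Fin (l + 1)) : ferP i * ferM i = numF i := by
  rw [ferM_eq, ferP_eq, numF_eq, spinOp_mul]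
  refine wShift_congr (fun x => ?_) (fun x hx => ?_)
  · by_cases h : i ∈ x.2
    · simp [h, ferSign_erase, ferSign_mul_self]
    · simp [h]
  · have h : i ∈ x.2 := by by_contra h; simp [h] at hx
    simp [Finset.insert_erase h]

theorem ferM_mul_ferP (i : Fin (l + 1)) :
    ferM i * ferP i = diagOp fun x : Occ l => if i ∈ x.2 then 0 else 1 := by
  rw [ferM_eq, ferP_eq, spinOp_mul]
  refine wShift_congr (fun x => ?_) (fun x hx => ?_)
  · by_cases h : i ∈ x.2
    · simp [h]
    · simp [h, ferSign_insert, ferSign_mul_self]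
  · have h : i ∉ x.2 := by intro h; simp [h] at hx
    simp [Finset.erase_insert h]

theorem isFermions_fer : IsFermions (ferM : Fin (l + 1) → Op l) ferP where
  rel i j := by
    by_cases hij : i = j
    · subst hij
      rw [if_pos rfl, ferP_mul_ferM, ferM_mul_ferP, numF, diagOp_add, ← diagOp_one]
      congr 1; ext x; split_ifs <;> simp
    · rw [if_neg hij, add_comm]; exact ferP_ferM_anti (Ne.symm hij)
  sq_minus i := by
    have h := ferM_anti i i
    rw [← two_smul ℂ, smul_eq_zero] at h
    rw [sq]; exact h.resolve_left two_ne_zero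
  sq_plus i := by
    have h := ferP_anti i i
    rw [← two_smul ℂ, smul_eq_zero] at h
    rw [sq]; exact h.resolve_left two_ne_zero
  anti_minus := ferM_anti
  anti_plus := ferP_anti

theorem isQFermions_fer {Q : ℂ} (hQ : Q ≠ 0) :
    IsQFermions Q (ferM : Fin (l + 1) → Op l) ferP numF where
  pow_mul_pow_neg i := opPow_mul_opPow_neg hQ _
  pow_neg_mul_pow i := opPow_neg_mul_opPow hQ _
  pow_comm i j := diagOp_commute _ _
  conj_minus i j :=
    (((numF_ferM i j).opPow hQ).congr (by
      by_cases h : i = j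
      · subst h; simp [Complex.cpow_neg_one]
      · simp [h, Ne.symm h])).conj (opPow_mul_opPow_neg hQ _)
  conj_plus i j :=
    (((numF_ferP i j).opPow hQ).congr (by
      by_cases h : i = j
      · subst h; simp
      · simp [h, Ne.symm h])).conj (opPow_mul_opPow_neg hQ _)
  rel_plus i := by
    rw [ferP_mul_ferM, ferM_mul_ferP, numF, opPow_diagOp, smul_diagOp, diagOp_add]
    congr 1; ext x; split_ifs <;> simp
  rel_minus i := by
    rw [ferP_mul_ferM, ferM_mul_ferP, numF, neg_diagOp, opPow_diagOp, smul_diagOp, diagOp_add]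
    congr 1; ext x; split_ifs <;> simp [Complex.cpow_neg_one]
  anti_minus := ferM_anti
  anti_plus := ferP_anti
  anti i j h := ferP_ferM_anti h

/-- `Φ_i⁻` leaves the mode empty, so that the dressing of `φ_i⁻` is trivial. -/
theorem phiM_eq (Q : ℂ) (i : Fin (l + 1)) : phiM Q i = ferM i := by
  rw [phiM, numF, smul_diagOp, opPow_diagOp, diagOp, ferM, wShift_mul]
  refine wShift_congr (fun x => ?_) fun x _ => rfl
  simp

/-- `Φ_i⁺` vanishes unless the mode is empty, so that the dressing of `φ_i⁺` is trivial. -/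
theorem phiP_eq (Q : ℂ) (i : Fin (l + 1)) : phiP Q i = ferP i := by
  rw [phiP, numF, smul_diagOp, opPow_diagOp, diagOp, ferP, wShift_mul]
  refine wShift_congr (fun x => ?_) fun x _ => rfl
  by_cases h : i ∈ x.2 <;> simp [h]

/-! ### Bosonic ladder operators -/

theorem bosP_mul_bosM {w v : ℕ → ℂ} (hw : ∀ m, w m ^ 2 = v m) (h0 : v 0 = 0) (i : Fin (l + 1)) :
    bosP w i * bosM w i = diagOp fun x : Occ l => v (x.1 i) := by
  rw [bosP_eq, bosM_eq, modeOp_mul]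
  refine modeOp_eq_diagOp i (fun m => ?_) (fun m hm => ?_)
  · rcases m with _ | m
    · simp [h0]
    · simp [← hw, sq]
  · rcases m with _ | m
    · simp at hm
    · simp

theorem bosM_mul_bosP {w v : ℕ → ℂ} (hw : ∀ m, w m ^ 2 = v m) (i : Fin (l + 1)) :
    bosM w i * bosP w i = diagOp fun x : Occ l => v (x.1 i + 1) := by
  rw [bosP_eq, bosM_eq, modeOp_mul]
  exact modeOp_eq_diagOp i (d := fun m => v (m + 1)) (fun m => by simp [← hw, sq])
    (fun m _ => by simp)

theorem qInt_zero (Q : ℂ) : qInt Q 0 = 0 := by simp [qInt]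

theorem sub_inv_ne_zero {Q : ℂ} (hQ : Q ≠ 0) (hQ2 : Q ^ 2 ≠ 1) : Q - Q⁻¹ ≠ 0 := by
  intro h
  apply hQ2
  field_simp at h
  linear_combination h

theorem qInt_succ_sub_mul {Q : ℂ} (hQ : Q ≠ 0) (hQ2 : Q ^ 2 ≠ 1) (m : ℕ) :
    qInt Q (m + 1) - Q * qInt Q m = Q⁻¹ ^ m := by
  have h := sub_inv_ne_zero hQ hQ2
  rw [qInt, qInt, mul_div_assoc', ← sub_div, div_eq_iff h, pow_succ, pow_succ]; ring

theorem qInt_succ_sub_inv_mul {Q : ℂ} (hQ : Q ≠ 0) (hQ2 : Q ^ 2 ≠ 1) (m : ℕ) :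
    qInt Q (m + 1) - Q⁻¹ * qInt Q m = Q ^ m := by
  have h := sub_inv_ne_zero hQ hQ2
  rw [qInt, qInt, mul_div_assoc', ← sub_div, div_eq_iff h, pow_succ, pow_succ]; ring

theorem bosM_commute_bosM {i j : Fin (l + 1)} (h : i ≠ j) (w w' : ℕ → ℂ) :
    Commute (bosM w i) (bosM w' j) := by
  rw [bosM_eq, bosM_eq]; exact modeOp_commute h _ _ _ _

theorem bosP_commute_bosP {i j : Fin (l + 1)} (h : i ≠ j) (w w' : ℕ → ℂ) :
    Commute (bosP w i) (bosP w' j) := by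
  rw [bosP_eq, bosP_eq]; exact modeOp_commute h _ _ _ _

theorem bosM_commute_bosP {i j : Fin (l + 1)} (h : i ≠ j) (w w' : ℕ → ℂ) :
    Commute (bosM w i) (bosP w' j) := by
  rw [bosM_eq, bosP_eq]; exact modeOp_commute h _ _ _ _

theorem opPow_numB {Q : ℂ} (hQ : Q ≠ 0) (i : Fin (l + 1)) :
    opPow Q (numB i) * opPow Q (-numB i) = 1 ∧ opPow Q (-numB i) * opPow Q (numB i) = 1 := by
  rw [numB]; exact ⟨opPow_mul_opPow_neg hQ _, opPow_neg_mul_opPow hQ _⟩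

theorem opPow_numB_bosM {Q : ℂ} (hQ : Q ≠ 0) (i : Fin (l + 1)) (w : ℕ → ℂ) :
    QComm Q⁻¹ (opPow Q (numB i)) (bosM w i) := by
  have h := num_bosM i i w
  rw [numB] at h ⊢
  exact (h.opPow hQ).congr (by simp [Complex.cpow_neg_one])

theorem opPow_numB_bosP {Q : ℂ} (hQ : Q ≠ 0) (i : Fin (l + 1)) (w : ℕ → ℂ) :
    QComm Q (opPow Q (numB i)) (bosP w i) := by
  have h := num_bosP i i w
  rw [numB] at h ⊢
  exact (h.opPow hQ).congr (by simp)

theorem isQBosons_bos {Q : ℂ} (hQ : Q ≠ 0) (hQ2 : Q ^ 2 ≠ 1) {w : ℕ → ℂ}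
    (hw : ∀ m, w m ^ 2 = qInt Q m) :
    IsQBosons Q (bosM w : Fin (l + 1) → Op l) (bosP w) numB where
  rel_minus i := by
    rw [bosP_mul_bosM hw (qInt_zero Q), bosM_mul_bosP hw, smul_diagOp, diagOp_sub, numB,
      neg_diagOp, opPow_diagOp]
    congr 1; ext x
    rw [qInt_succ_sub_mul hQ hQ2, Complex.cpow_neg, Complex.cpow_natCast, inv_pow]
  rel_plus i := by
    rw [bosP_mul_bosM hw (qInt_zero Q), bosM_mul_bosP hw, smul_diagOp, diagOp_sub, numB,
      opPow_diagOp]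
    congr 1; ext x
    rw [qInt_succ_sub_inv_mul hQ hQ2, Complex.cpow_natCast]
  conj_minus i := (opPow_numB_bosM hQ i w).conj (opPow_numB hQ i).1
  conj_plus i := (opPow_numB_bosP hQ i w).conj (opPow_numB hQ i).1
  pow_mul_pow_neg i := (opPow_numB hQ i).1
  pow_neg_mul_pow i := (opPow_numB hQ i).2
  comm i j h := ⟨bosM_commute_bosM h w w, bosP_commute_bosP h w w, bosM_commute_bosP h w w,
    ((num_bosM i j w).congr (by simp [Ne.symm h])).commute,
    ((num_bosP i j w).congr (by simp [Ne.symm h])).commute⟩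
  comm_num i j := diagOp_commute _ _

/-- `Q`-bosons satisfy the cubic relations behind the Serre relations. -/
theorem IsQBosons.isBosonic {B ι : Type*} {Q : ℂ} (hQ : Q ≠ 0)
    {am ap N : ι → Module.End ℂ (B →₀ ℂ)} (H : IsQBosons Q am ap N) : IsBosonic Q am ap where
  comm i j h := ⟨(H.comm i j h).1, (H.comm i j h).2.1, (H.comm i j h).2.2.1⟩
  cubic_minus i := serre_neg_one_of_osc_minus hQ (H.rel_plus i) (by
    have e := congrArg (fun z => z * opPow Q (N i)) (H.conj_minus i)
    simp only [mul_assoc, H.pow_neg_mul_pow, mul_one, smul_mul_assoc] at e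
    exact e)
  cubic_plus i := serre_neg_one_of_osc_plus hQ (H.rel_plus i) (by
    have e := congrArg (fun z => z * opPow Q (N i)) (H.conj_plus i)
    simp only [mul_assoc, H.pow_neg_mul_pow, mul_one, smul_mul_assoc] at e
    exact e)

/-- Ordinary bosons satisfy the cubic relations with `Q = 1`. -/
theorem IsBosons.isBosonic {A ι : Type*} [Ring A] [Algebra ℂ A] [DecidableEq ι] {am ap : ι → A}
    (H : IsBosons am ap) : IsBosonic 1 am ap where
  comm i j h := ⟨H.comm_minus i j, H.comm_plus i j, by
    have e := H.rel i j
    rw [if_neg h, sub_eq_zero] at e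
    exact e⟩
  cubic_minus i := serre_neg_one_of_osc_minus (K := 1) one_ne_zero
    (by simpa using H.rel i i) (by simp [QComm])
  cubic_plus i := serre_neg_one_of_osc_plus (K := 1) one_ne_zero
    (by simpa using H.rel i i) (by simp [QComm])

end Modes

/-! ### The realization by `Q`-oscillators -/

section Diagonal

variable {B : Type*}

/-- The operator is diagonal in the distinguished basis. -/
def IsDiag (T : Module.End ℂ (B →₀ ℂ)) : Prop := ∃ c, T = diagOp c

theorem isDiag_opPow (Q : ℂ) (T : Module.End ℂ (B →₀ ℂ)) : IsDiag (opPow Q T) := ⟨_, rfl⟩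

variable {S T : Module.End ℂ (B →₀ ℂ)}

theorem IsDiag.add (hS : IsDiag S) (hT : IsDiag T) : IsDiag (S + T) := by
  obtain ⟨c, rfl⟩ := hS; obtain ⟨d, rfl⟩ := hT; exact ⟨_, diagOp_add c d⟩

theorem IsDiag.sub (hS : IsDiag S) (hT : IsDiag T) : IsDiag (S - T) := by
  obtain ⟨c, rfl⟩ := hS; obtain ⟨d, rfl⟩ := hT; exact ⟨_, diagOp_sub c d⟩

theorem IsDiag.neg (hS : IsDiag S) : IsDiag (-S) := by
  obtain ⟨c, rfl⟩ := hS; exact ⟨_, neg_diagOp c⟩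

theorem IsDiag.smul (a : ℂ) (hS : IsDiag S) : IsDiag (a • S) := by
  obtain ⟨c, rfl⟩ := hS; exact ⟨_, smul_diagOp a c⟩

theorem isDiag_sum {ι : Type*} {s : Finset ι} {S : ι → Module.End ℂ (B →₀ ℂ)}
    (hS : ∀ i, IsDiag (S i)) : IsDiag (∑ i ∈ s, S i) := by
  choose c hc using hS
  exact ⟨_, by rw [Finset.sum_congr rfl fun i _ => hc i]; exact sum_diagOp s c⟩

theorem IsDiag.commute (hS : IsDiag S) (hT : IsDiag T) : Commute S T := by
  obtain ⟨c, rfl⟩ := hS; obtain ⟨d, rfl⟩ := hT; exact diagOp_commute c d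

theorem IsDiag.qcomm_opPow {Q δ : ℂ} (hQ : Q ≠ 0) (hS : IsDiag S) (h : HasWt δ S T) :
    QComm (Q ^ δ) (opPow Q S) T := by
  obtain ⟨c, rfl⟩ := hS; exact h.opPow hQ

theorem IsDiag.opPow_mul_neg {Q : ℂ} (hQ : Q ≠ 0) (hS : IsDiag S) :
    opPow Q S * opPow Q (-S) = 1 ∧ opPow Q (-S) * opPow Q S = 1 := by
  obtain ⟨c, rfl⟩ := hS; exact ⟨opPow_mul_opPow_neg hQ c, opPow_neg_mul_opPow hQ c⟩

end Diagonal

variable {l : ℕ}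

theorem isDiag_numB (i : Fin (l + 1)) : IsDiag (numB i) := ⟨_, rfl⟩

theorem isDiag_numF (i : Fin (l + 1)) : IsDiag (numF i) := ⟨_, rfl⟩

theorem bos_commute_spinOp (w : ℕ → ℂ) (i : Fin (l + 1)) (f c) :
    Commute (bosM w i) (spinOp f c) ∧ Commute (bosP w i) (spinOp f c) := by
  rw [bosM_eq, bosP_eq]
  exact ⟨modeOp_commute_spinOp _ _ _ _ _, modeOp_commute_spinOp _ _ _ _ _⟩

theorem numF_commute_bos (w : ℕ → ℂ) (i j : Fin (l + 1)) :
    Commute (numF i) (bosM w j) ∧ Commute (numF i) (bosP w j) := by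
  rw [bosM_eq, bosP_eq]; exact ⟨numF_commute_modeOp _ _ _ _, numF_commute_modeOp _ _ _ _⟩

theorem numB_commute_fer (i j : Fin (l + 1)) :
    Commute (numB i) (ferM j) ∧ Commute (numB i) (ferP j) := by
  rw [ferM_eq, ferP_eq]; exact ⟨numB_commute_spinOp _ _ _, numB_commute_spinOp _ _ _⟩

theorem cpow_half_mul (Q : ℂ) (k : ℤ) : Q ^ ((1 / 2 : ℂ) * k) = (Q ^ (1 / 2 : ℂ)) ^ k :=
  Complex.cpow_mul_int _ _ _

theorem cpow_half_sq (Q : ℂ) : (Q ^ (1 / 2 : ℂ)) ^ 2 = Q := by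
  simp [← Complex.cpow_nat_mul]

/-- The exponent `(M_i - M_{i+1}) / 2` of the realization. -/
noncomputable def halfM (i : Fin l) : Op l := (1 / 2 : ℂ) • (numF i.castSucc - numF i.succ)

/-- The exponent `-(N_i - N_{i+1}) / 2` of the realization. -/
noncomputable def halfN (i : Fin l) : Op l := (-(1 / 2) : ℂ) • (numB i.castSucc - numB i.succ)

/-- The exponent `∑_{i<n} N_i / 2 - ∑_{i<n} M_i / 2` of the realization. -/
noncomputable def halfG (l : ℕ) : Op l :=
  (1 / 2 : ℂ) • (∑ i : Fin l, numB i.castSucc) - (1 / 2 : ℂ) • (∑ i : Fin l, numF i.castSucc)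

theorem isDiag_halfM (i : Fin l) : IsDiag (halfM i) :=
  ((isDiag_numF _).sub (isDiag_numF _)).smul _

theorem isDiag_halfN (i : Fin l) : IsDiag (halfN i) :=
  ((isDiag_numB _).sub (isDiag_numB _)).smul _

theorem isDiag_halfG : IsDiag (halfG l) :=
  ((isDiag_sum fun _ => isDiag_numB _).smul _).sub ((isDiag_sum fun _ => isDiag_numF _).smul _)

theorem sum_castSucc_eq (j : Fin (l + 1)) :
    (∑ i : Fin l, if j = i.castSucc then (1 : ℂ) else 0) = (bodyCoeff j : ℤ) := by
  refine Fin.lastCases ?_ (fun j => ?_) j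
  · simp [bodyCoeff, (castSucc_ne_last _).symm]
  · simp [bodyCoeff]

/-- The oscillators of the realization of `P̃_Q(n)`. -/
noncomputable def quantumSystem (l : ℕ) {Q : ℂ} (hQ : Q ≠ 0) (hQ2 : Q ^ 2 ≠ 1) {w : ℕ → ℂ}
    (hw : ∀ m, w m ^ 2 = qInt Q m) : OscSystem (Op l) l (Q ^ (1 / 2 : ℂ)) where
  bm := bosM w
  bp := bosP w
  fm := ferM
  fp := ferP
  Nb := numB
  m i := opPow Q (halfM i)
  n i := opPow Q (halfN i)
  G := opPow Q (halfG l)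
  h_ne := by simp [Complex.cpow_eq_zero_iff, hQ]
  bosonic := by rw [cpow_half_sq]; exact (isQBosons_bos hQ hQ2 hw).isBosonic hQ
  fermions := isFermions_fer
  mixed i j := by
    rw [ferM_eq, ferP_eq]
    exact ⟨(bos_commute_spinOp _ _ _ _).1, (bos_commute_spinOp _ _ _ _).1,
      (bos_commute_spinOp _ _ _ _).2, (bos_commute_spinOp _ _ _ _).2⟩
  num_bm i j := num_bosM i j w
  num_bp i j := num_bosP i j w
  num_f i j := numB_commute_fer i j
  diag x hx y hy := by
    have key : ∀ x ∈ Set.range (numB : Fin (l + 1) → Op l) ∪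
        Set.range (fun i : Fin l => opPow Q (halfM i)) ∪
        Set.range (fun i : Fin l => opPow Q (halfN i)) ∪ {opPow Q (halfG l)}, IsDiag x := by
      rintro x (((⟨i, rfl⟩ | ⟨i, rfl⟩) | ⟨i, rfl⟩) | rfl)
      · exact isDiag_numB i
      all_goals exact isDiag_opPow _ _
    exact (key x hx).commute (key y hy)
  m_b i j := by
    have k : ∀ x : Op l, (∀ a, Commute (numF a) x) → Commute (opPow Q (halfM i)) x := fun x hx =>
      (((isDiag_halfM i).qcomm_opPow hQ (((HasWt.of_commute (hx _)).sub_left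
        (.of_commute (hx _))).smul_left _)).congr (by simp)).commute
    exact ⟨k _ fun a => (numF_commute_bos w a j).1, k _ fun a => (numF_commute_bos w a j).2⟩
  m_fm i j := ((isDiag_halfM i).qcomm_opPow hQ
    (((numF_ferM _ _).sub_left (numF_ferM _ _)).smul_left _)).congr (by
      rw [← cpow_half_mul, Int.cast_neg, rootCoeff_cast]; congr 1; ring)
  m_fp i j := ((isDiag_halfM i).qcomm_opPow hQ
    (((numF_ferP _ _).sub_left (numF_ferP _ _)).smul_left _)).congr (by
      rw [← cpow_half_mul, rootCoeff_cast])
  n_f i j := by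
    have k : ∀ x : Op l, (∀ a, Commute (numB a) x) → Commute (opPow Q (halfN i)) x := fun x hx =>
      (((isDiag_halfN i).qcomm_opPow hQ (((HasWt.of_commute (hx _)).sub_left
        (.of_commute (hx _))).smul_left _)).congr (by simp)).commute
    exact ⟨k _ fun a => (numB_commute_fer a j).1, k _ fun a => (numB_commute_fer a j).2⟩
  n_bm i j := ((isDiag_halfN i).qcomm_opPow hQ
    (((num_bosM _ _ _).sub_left (num_bosM _ _ _)).smul_left _)).congr (by
      rw [← cpow_half_mul, rootCoeff_cast]; congr 1; ring)
  n_bp i j := ((isDiag_halfN i).qcomm_opPow hQ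
    (((num_bosP _ _ _).sub_left (num_bosP _ _ _)).smul_left _)).congr (by
      rw [← cpow_half_mul, Int.cast_neg, rootCoeff_cast]; congr 1; ring)
  G_bm j := (isDiag_halfG.qcomm_opPow hQ
    (((HasWt.sum_left fun _ _ => num_bosM _ _ _).smul_left _).sub_left
      ((HasWt.sum_left fun _ _ => HasWt.of_commute (numF_commute_bos w _ _).1).smul_left _))).congr
    (by
      rw [← cpow_half_mul, Int.cast_neg, ← sum_castSucc_eq, Finset.sum_neg_distrib]; simp)
  G_bp j := (isDiag_halfG.qcomm_opPow hQ
    (((HasWt.sum_left fun _ _ => num_bosP _ _ _).smul_left _).sub_left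
      ((HasWt.sum_left fun _ _ => HasWt.of_commute (numF_commute_bos w _ _).2).smul_left _))).congr
    (by rw [← cpow_half_mul, ← sum_castSucc_eq]; simp)
  G_fm j := (isDiag_halfG.qcomm_opPow hQ
    (((HasWt.sum_left fun _ _ => HasWt.of_commute (numB_commute_fer _ _).1).smul_left _).sub_left
      ((HasWt.sum_left fun _ _ => numF_ferM _ _).smul_left _))).congr
    (by rw [← cpow_half_mul, ← sum_castSucc_eq, Finset.sum_neg_distrib]; simp)
  G_fp j := (isDiag_halfG.qcomm_opPow hQ
    (((HasWt.sum_left fun _ _ => HasWt.of_commute (numB_commute_fer _ _).2).smul_left _).sub_left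
      ((HasWt.sum_left fun _ _ => numF_ferP _ _).smul_left _))).congr
    (by rw [← cpow_half_mul, Int.cast_neg, ← sum_castSucc_eq]; simp)

/-- A product of two opposite bosonic bilinears is diagonal. -/
theorem bilinear_bos_mul {w v : ℕ → ℂ} (hw : ∀ m, w m ^ 2 = v m) (h0 : v 0 = 0)
    {i j : Fin (l + 1)} (hij : i ≠ j) :
    bosP w i * bosM w j * (bosP w j * bosM w i) =
      diagOp fun x : Occ l => v (x.1 i) * v (x.1 j + 1) := by
  rw [mul_assoc, ← mul_assoc (bosM w j), bosM_mul_bosP hw j]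
  have hc : Commute (diagOp fun x : Occ l => v (x.1 j + 1)) (bosM w i) := by
    rw [← bosM_mul_bosP hw j]
    exact .mul_left (bosM_commute_bosM hij.symm w w) (bosM_commute_bosP hij w w).symm
  rw [hc.eq, ← mul_assoc, bosP_mul_bosM hw h0, diagOp_mul]

/-- `[a][b + 1] - [b][a + 1] = [a - b]`, written without subtraction of natural numbers. -/
theorem qInt_mul_sub {Q : ℂ} (hQ : Q ≠ 0) (hQ2 : Q ^ 2 ≠ 1) (a b : ℕ) :
    qInt Q a * qInt Q (b + 1) - qInt Q b * qInt Q (a + 1) =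
      (Q - Q⁻¹)⁻¹ * (Q ^ a * Q⁻¹ ^ b - Q ^ b * Q⁻¹ ^ a) := by
  have h := sub_inv_ne_zero hQ hQ2
  rw [qInt, qInt, qInt, qInt, div_mul_div_comm, div_mul_div_comm, ← sub_div,
    div_eq_iff (mul_ne_zero h h), mul_comm (Q - Q⁻¹)⁻¹, mul_assoc, inv_mul_cancel_left₀ h]
  have h1 : Q ^ a * Q⁻¹ ^ a = 1 := by rw [← mul_pow, mul_inv_cancel₀ hQ, one_pow]
  have h2 : Q ^ b * Q⁻¹ ^ b = 1 := by rw [← mul_pow, mul_inv_cancel₀ hQ, one_pow]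
  rw [pow_succ, pow_succ, pow_succ, pow_succ]
  ring

/-- On each basis vector the two sides are `Q`-numbers: the bosons contribute `[N_i - N_{i+1}] Q ^
(M_i - M_{i+1})` and the fermions `(M_i - M_{i+1}) Q ^ (N_{i+1} - N_i)`, which add up to `[T_i]`
because `M_i - M_{i+1}` is `0` or `±1`. -/
theorem quantum_commutator {Q : ℂ} (hQ : Q ≠ 0) (hQ2 : Q ^ 2 ≠ 1) {w : ℕ → ℂ}
    (hw : ∀ m, w m ^ 2 = qInt Q m) (i : Fin l) :
    (quantumSystem l hQ hQ2 hw).Xe i * (quantumSystem l hQ hQ2 hw).Y i -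
      (quantumSystem l hQ hQ2 hw).Y i * (quantumSystem l hQ hQ2 hw).Xe i =
    (Q - Q⁻¹)⁻¹ • (opPow Q (numB i.castSucc - numB i.succ + numF i.castSucc - numF i.succ) -
      opPow Q (-(numB i.castSucc - numB i.succ + numF i.castSucc - numF i.succ))) := by
  have hne := i.castSucc_lt_succ.ne
  have hd := sub_inv_ne_zero hQ hQ2
  rw [OscSystem.Xe_Y_self]
  simp only [quantumSystem, OscSystem.Nf]
  rw [bilinear_bos_mul hw (qInt_zero Q) hne, bilinear_bos_mul hw (qInt_zero Q) hne.symm,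
    ferP_mul_ferM, ferP_mul_ferM, halfM, halfN, numF, numF, numB, numB]
  simp only [diagOp_sub, diagOp_add, diagOp_mul, smul_diagOp, neg_diagOp, opPow_diagOp]
  congr 1; ext x
  rw [qInt_mul_sub hQ hQ2]
  -- the dressing factors enter squared
  have hs : ∀ (s : ℂ), Q ^ s * Q ^ s = Q ^ (2 * s) := fun s => by
    rw [← Complex.cpow_add _ _ hQ, two_mul]
  have hp : ∀ n : ℕ, Q ^ n ≠ 0 := fun n => pow_ne_zero n hQ
  have ha := hp (x.1 i.castSucc)
  have hb := hp (x.1 i.succ)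
  rw [hs, hs]
  by_cases h1 : i.castSucc ∈ x.2 <;> by_cases h2 : i.succ ∈ x.2 <;>
  · simp only [h1, h2, if_true, if_false, sub_self, sub_zero, zero_sub, add_zero, mul_zero,
      zero_mul, mul_one, one_mul, Complex.cpow_zero,
      Complex.cpow_sub _ _ hQ, Complex.cpow_natCast, Complex.cpow_neg, neg_sub,
      sub_add, Complex.cpow_one, mul_neg, neg_mul, inv_pow, ← mul_assoc,
      show (2 : ℂ) * (1 / 2) = 1 by norm_num]
    field_simp
    try ring

theorem exists_realization {Q q : ℂ} {k : ℕ} (W : RootBranch q k) (hQ : Q ≠ 0) (hQ2 : Q ^ 2 ≠ 1) :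
    ∃ τ : QUStrange l Q →ₐ[ℂ] Op l, ∀ g, τ (QUStrange.gen Q g) = W.realization Q g := by
  set O := quantumSystem l hQ hQ2 (w := fun m => W.w m Q) (fun m => W.sq m Q) with hO
  have hNf : ∀ i, O.Nf i = numF i := ferP_mul_ferM
  have hT : ∀ i, O.T i = numB i.castSucc - numB i.succ + numF i.castSucc - numF i.succ := by
    intro i
    rw [OscSystem.T, hNf, hNf]; rfl
  have hdT : ∀ i, IsDiag (O.T i) := fun i => by
    rw [hT]
    exact (((isDiag_numB _).sub (isDiag_numB _)).add (isDiag_numF _)).sub (isDiag_numF _)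
  have hdD : IsDiag O.D := by
    rw [OscSystem.D]; simp only [hNf]
    exact ((isDiag_sum fun _ => isDiag_numB _).smul _).add
      ((isDiag_sum fun _ => isDiag_numF _).smul _)
  obtain ⟨τ, hX, hY, hT', hD, hK, hK'⟩ := O.exists_quantum (cpow_half_sq Q)
    (fun i => opPow Q (O.T i)) (fun i => opPow Q (-O.T i))
    (fun i => ((hdT i).opPow_mul_neg hQ).1) (fun i => ((hdT i).opPow_mul_neg hQ).2)
    (fun i j => (isDiag_opPow _ _).commute (isDiag_opPow _ _))
    (fun i j => (isDiag_opPow _ _).commute (hdT j)) (fun i => (isDiag_opPow _ _).commute hdD)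
    (fun i j => ((hdT i).qcomm_opPow hQ (O.T_X i j)).congr (Complex.cpow_intCast _ _))
    (fun i j => ((hdT i).qcomm_opPow hQ (O.T_Y i j)).congr
      (by rw [← Int.cast_neg, Complex.cpow_intCast]))
    (fun i => by rw [hT]; exact quantum_commutator hQ hQ2 _ i)
  refine ⟨τ, fun g => ?_⟩
  cases g with
  | X j =>
    rw [hX]
    refine Fin.lastCases ?_ (fun j => ?_) j
    · rw [O.X_last, RootBranch.realization, Fin.snoc_last]; rfl
    · rw [O.X_castSucc, RootBranch.realization, Fin.snoc_castSucc]; rfl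
  | Y i => rw [hY]; rfl
  | T i => rw [hT', hT]; rfl
  | D => rw [hD, OscSystem.D]; simp only [hNf]; rfl
  | K i => rw [hK, hT]; rfl
  | Kinv i => rw [hK', hT]; rfl

/-! ### `Q`-numbers near a root of unity -/

/-- The properties of `q = exp (2 π i / r)` and of the order `k` of `q ^ 2` on which the limit
`Q → q` depends. -/
structure IsRootDatum (q : ℂ) (k : ℕ) : Prop where
  slit : q ∈ Complex.slitPlane
  pow_eq_one_iff (m : ℕ) : q ^ (2 * m) = 1 ↔ k ∣ m
  one_lt : 1 < k

theorem isRootDatum (r : ℕ) (hr : 3 ≤ r) : IsRootDatum (rootOfUnity r) (rootOrder r) where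
  slit := by
    have hr' : (3 : ℝ) ≤ r := by exact_mod_cast hr
    have hpi := Real.pi_pos
    have hpos : 0 < 2 * Real.pi / r := by positivity
    have hlt : 2 * Real.pi / r < Real.pi := by
      rw [div_lt_iff₀ (by positivity)]; nlinarith
    have e : rootOfUnity r = Complex.exp ((2 * Real.pi / r : ℝ) * Complex.I) := by
      rw [rootOfUnity]; congr 1; push_cast; ring
    rw [Complex.mem_slitPlane_iff, e]
    right
    rw [Complex.exp_ofReal_mul_I_im]
    exact (Real.sin_pos_of_pos_of_lt_pi hpos hlt).ne'
  pow_eq_one_iff m := by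
    have hp : IsPrimitiveRoot (rootOfUnity r) r := by
      simpa [rootOfUnity] using Complex.isPrimitiveRoot_exp r (by omega)
    rw [hp.pow_eq_one_iff_dvd, rootOrder]
    split_ifs with h
    · obtain ⟨s, rfl⟩ := h
      rw [← two_mul, Nat.mul_div_cancel_left _ two_pos, Nat.mul_dvd_mul_iff_left two_pos]
    · exact ((Nat.coprime_two_right.2 (Nat.not_even_iff_odd.1 h)).dvd_mul_left)
  one_lt := by
    rw [rootOrder]
    split_ifs with h
    · obtain ⟨s, rfl⟩ := h; omega
    · omega

namespace IsRootDatum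

variable {q : ℂ} {k : ℕ} (H : IsRootDatum q k)

include H

theorem q_ne : q ≠ 0 := Complex.slitPlane_ne_zero H.slit

theorem k_pos : 0 < k := zero_lt_one.trans H.one_lt

theorem sq_ne : q ^ 2 ≠ 1 := fun h => by
  have := (H.pow_eq_one_iff 1).1 (by simpa using h)
  have := Nat.le_of_dvd one_pos this
  have := H.one_lt
  omega

theorem pow_inv : q⁻¹ ^ k = q ^ k := by
  have h := (H.pow_eq_one_iff k).2 dvd_rfl
  have h0 := pow_ne_zero k H.q_ne
  rw [inv_pow, inv_eq_iff_eq_inv, ← mul_eq_one_iff_eq_inv₀ h0, ← pow_add, ← two_mul, h]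

theorem qInt_eq_zero_iff (m : ℕ) : qInt q m = 0 ↔ k ∣ m := by
  rw [qInt, div_eq_zero_iff, or_iff_left (sub_inv_ne_zero H.q_ne H.sq_ne), sub_eq_zero,
    ← H.pow_eq_one_iff, inv_pow, ← mul_eq_one_iff_eq_inv₀ (pow_ne_zero _ H.q_ne), ← pow_add,
    two_mul]

theorem qInt_add (m : ℕ) : qInt q (m + k) = q ^ k * qInt q m := by
  rw [qInt, qInt, pow_add, pow_add, H.pow_inv]; ring

/-- `[k]` vanishes at `q` but not nearby: `Q ^ (2 k)` has nonzero derivative at `q`. -/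
theorem eventually_qInt_ne : ∀ᶠ Q in 𝓝[≠] q, qInt Q k ≠ 0 := by
  have hd : HasDerivAt (fun Q : ℂ => Q ^ (2 * k)) ((2 * k : ℕ) * q ^ (2 * k - 1)) q :=
    hasDerivAt_pow _ _
  have hk := H.k_pos
  have h1 := hd.eventually_ne (c := 1)
    (mul_ne_zero (Nat.cast_ne_zero.2 (by omega)) (pow_ne_zero _ H.q_ne))
  have h2 : ∀ᶠ Q in 𝓝[≠] q, Q ≠ 0 := (eventually_ne_nhds H.q_ne).filter_mono nhdsWithin_le_nhds
  filter_upwards [h1, h2] with Q hQ hQ0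
  have hQ2 : Q ^ 2 ≠ 1 := fun h => hQ (by rw [pow_mul, h, one_pow])
  rw [qInt, div_ne_zero_iff]
  refine ⟨fun h => hQ ?_, sub_inv_ne_zero hQ0 hQ2⟩
  rw [sub_eq_zero, inv_pow, ← mul_eq_one_iff_eq_inv₀ (pow_ne_zero _ hQ0)] at h
  rw [two_mul, pow_add, h]

omit H in
/-- The ratio `[k s] / [k]`, as a Laurent polynomial in `Q`. -/
theorem qInt_mul (Q : ℂ) (k s : ℕ) : qInt Q (k * s) =
    (∑ j ∈ Finset.range s, (Q ^ k) ^ j * (Q⁻¹ ^ k) ^ (s - 1 - j)) * qInt Q k := by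
  rw [qInt, qInt, mul_div_assoc', geom_sum₂_mul, pow_mul, pow_mul]

/-- The value of the Laurent polynomial of `qInt_mul` at `q`, where all its terms coincide since
`q ^ (2 k) = 1`. -/
theorem ratio_at (s : ℕ) : ∑ j ∈ Finset.range s, (q ^ k) ^ j * (q⁻¹ ^ k) ^ (s - 1 - j) =
    s * (q ^ k) ^ (s - 1) := by
  rw [H.pow_inv, Finset.sum_congr rfl (g := fun _ => (q ^ k) ^ (s - 1)), Finset.sum_const,
    Finset.card_range, nsmul_eq_mul]
  intro j hj
  rw [← pow_add, Nat.add_sub_cancel' (Nat.le_sub_one_of_lt (Finset.mem_range.1 hj))]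

theorem continuousAt_ratio (s : ℕ) : ContinuousAt
    (fun Q : ℂ => ∑ j ∈ Finset.range s, (Q ^ k) ^ j * (Q⁻¹ ^ k) ^ (s - 1 - j)) q := by
  have := H.q_ne
  fun_prop (disch := assumption)

theorem continuousAt_qInt (m : ℕ) : ContinuousAt (fun Q => qInt Q m) q := by
  have := H.q_ne
  have := sub_inv_ne_zero H.q_ne H.sq_ne
  unfold qInt
  fun_prop (disch := assumption)

omit H in
/-- A function that is continuous and nonzero at a point has a square root that is continuous
there: divide by the value, and use the principal branch near `1`. -/
theorem exists_sqrt {f : ℂ → ℂ} (hf : ContinuousAt f q) (h0 : f q ≠ 0) :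
    ∃ g : ℂ → ℂ, (∀ Q, g Q ^ 2 = f Q) ∧ ContinuousAt g q := by
  refine ⟨fun Q => f q ^ (1 / 2 : ℂ) * (f Q / f q) ^ (1 / 2 : ℂ), fun Q => ?_, ?_⟩
  · rw [mul_pow, cpow_half_sq, cpow_half_sq, mul_div_cancel₀ _ h0]
  · have h1 : f q / f q ∈ Complex.slitPlane := by
      rw [div_self h0]; exact Complex.one_mem_slitPlane
    exact continuousAt_const.mul
      (ContinuousAt.comp (f := fun Q => f Q / f q) (continuousAt_cpow_const h1) (hf.div_const _))

/-- Admissible square roots of the `Q`-numbers exist. -/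
theorem nonempty_rootBranch : Nonempty (RootBranch q k) := by
  have hA : ∀ m, ∃ g : ℂ → ℂ, (∀ Q, g Q ^ 2 = qInt Q m) ∧ (¬k ∣ m → ContinuousAt g q) := by
    intro m
    by_cases h : k ∣ m
    · exact ⟨fun Q => qInt Q m ^ (1 / 2 : ℂ), fun Q => cpow_half_sq _, fun h' => absurd h h'⟩
    · obtain ⟨g, h1, h2⟩ := exists_sqrt (H.continuousAt_qInt m)
        (fun h0 => h ((H.qInt_eq_zero_iff m).1 h0))
      exact ⟨g, h1, fun _ => h2⟩
  -- for `k ∣ m` take the product of a root of `[m] / [k]`, continuous at `q`, and a root of `[k]`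
  have hB : ∀ s, ∃ g : ℂ → ℂ, (∀ Q, g Q ^ 2 =
      ∑ j ∈ Finset.range s, (Q ^ k) ^ j * (Q⁻¹ ^ k) ^ (s - 1 - j)) ∧ ContinuousAt g q ∧
      (s ≠ 0 → g q ≠ 0) := by
    intro s
    rcases Nat.eq_zero_or_pos s with rfl | hs
    · exact ⟨fun _ => 0, by simp, continuousAt_const, fun h => absurd rfl h⟩
    · have hne : (s : ℂ) * (q ^ k) ^ (s - 1) ≠ 0 :=
        mul_ne_zero (Nat.cast_ne_zero.2 hs.ne') (pow_ne_zero _ (pow_ne_zero _ H.q_ne))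
      rw [← H.ratio_at s] at hne
      obtain ⟨g, h1, h2⟩ := exists_sqrt (H.continuousAt_ratio s) hne
      exact ⟨g, h1, h2, fun _ h => hne (by rw [← h1, h]; simp)⟩
  choose A hA1 hA2 using hA
  choose B hB1 hB2 hB3 using hB
  have hkk : k ∣ k := dvd_rfl
  refine ⟨⟨fun m Q => if k ∣ m then B (m / k) Q * A k Q else A m Q, fun m Q => ?_, fun m h => ?_,
    fun s => ⟨B s q / B 1 q, ?_⟩⟩⟩
  · split_ifs with h
    · obtain ⟨s, rfl⟩ := h
      rw [Nat.mul_div_cancel_left _ H.k_pos, mul_pow, hB1, hA1, ← qInt_mul]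
    · exact hA1 m Q
  · simp only [h, if_false]
    exact hA2 m h
  · refine Tendsto.congr' (f₁ := fun Q => B s Q / B 1 Q) ?_ ?_
    · filter_upwards [H.eventually_qInt_ne] with Q hQ
      have : A k Q ≠ 0 := fun h => hQ (by rw [← hA1, h]; simp)
      simp only [dvd_mul_right, hkk, if_true, Nat.mul_div_cancel_left _ H.k_pos,
        Nat.div_self H.k_pos]
      rw [mul_div_mul_right _ _ this]
    · exact ((hB2 s).tendsto.mono_left nhdsWithin_le_nhds).div
        ((hB2 1).tendsto.mono_left nhdsWithin_le_nhds) (hB3 1 one_ne_zero)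

end IsRootDatum

/-! ### The limits of the normalized square roots -/

namespace RootBranch

variable {q : ℂ} {k : ℕ} (w : RootBranch q k)

/-- The limit at `q` of `√[m]` if `k ∤ m`, and of `√[m] / √[k]` if `k ∣ m`. -/
noncomputable def limW (m : ℕ) : ℂ := if k ∣ m then (w.ratio (m / k)).choose else w.w m q

/-- The product of the limits `limW`, the analogue of `√([m]!)`. -/
noncomputable def limFact (m : ℕ) : ℂ := ∏ j ∈ Finset.range m, w.limW (j + 1)

/-- The chosen square root `q ^ (k / 2)` of `q ^ k`. -/
noncomputable def qHalf (q : ℂ) (k : ℕ) : ℂ := q ^ ((k : ℂ) / 2)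

/-- The matrix coefficient of the limit bosons between `|m⟩` and `|m + k⟩`. -/
noncomputable def alpha (m : ℕ) : ℂ :=
  (qHalf q k)⁻¹ ^ m * (w.limFact (m + k) / (w.limFact m * w.limFact k))

/-- The matrix coefficient of the `k`-fermions between `|m - 1⟩` and `|m⟩`. -/
noncomputable def chiW (m : ℕ) : ℂ := (qHalf q k)⁻¹ ^ (m / k) * w.w m q

/-- The square of `limW`. -/
noncomputable def limV (q : ℂ) (k m : ℕ) : ℂ :=
  if k ∣ m then (m / k : ℕ) * (q ^ k) ^ (m / k - 1) else qInt q m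

theorem qHalf_sq : qHalf q k ^ 2 = q ^ k := by
  rw [qHalf, ← Complex.cpow_nat_mul, ← Complex.cpow_natCast]; congr 1; push_cast; ring

theorem cpow_neg_half_nat (m : ℕ) : q ^ ((-(k / 2) : ℂ) * m) = (qHalf q k)⁻¹ ^ m := by
  rw [Complex.cpow_mul_nat, Complex.cpow_neg, qHalf]

/-- `√[m]` with the vanishing factor `√[k]` divided out if `k ∣ m`. -/
noncomputable def normW (m : ℕ) (Q : ℂ) : ℂ := if k ∣ m then w.w m Q / w.w k Q else w.w m Q

theorem tendsto_normW (m : ℕ) : Tendsto (w.normW m) (𝓝[≠] q) (𝓝 (w.limW m)) := by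
  by_cases h : k ∣ m
  · have e := (w.ratio (m / k)).choose_spec
    have : w.normW m = fun Q => w.w (k * (m / k)) Q / w.w k Q := by
      ext Q; rw [normW, if_pos h, Nat.mul_div_cancel' h]
    rw [this, limW, if_pos h]
    exact e
  · have : w.normW m = w.w m := by ext Q; simp [normW, h]
    rw [this, limW, if_neg h]
    exact (w.continuousAt m h).tendsto.mono_left nhdsWithin_le_nhds

variable (H : IsRootDatum q k)

include H

theorem qHalf_ne : qHalf q k ≠ 0 := by simp [qHalf, Complex.cpow_eq_zero_iff, H.q_ne]

theorem eventually_w_ne : ∀ᶠ Q in 𝓝[≠] q, w.w k Q ≠ 0 := by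
  filter_upwards [H.eventually_qInt_ne] with Q hQ h
  exact hQ (by rw [← w.sq, h]; simp)

/-- Whatever the choice of the square roots, the limits have prescribed squares. -/
theorem limW_sq (m : ℕ) : w.limW m ^ 2 = limV q k m := by
  by_cases h : k ∣ m
  · obtain ⟨s, rfl⟩ := h
    have h1 := (w.tendsto_normW (k * s)).pow 2
    refine tendsto_nhds_unique h1 ?_
    rw [limV, if_pos (dvd_mul_right k s), Nat.mul_div_cancel_left _ H.k_pos, ← H.ratio_at]
    refine ((H.continuousAt_ratio s).tendsto.mono_left nhdsWithin_le_nhds).congr' ?_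
    filter_upwards [H.eventually_qInt_ne] with Q hQ
    rw [normW, if_pos (dvd_mul_right k s), div_pow, w.sq, w.sq, IsRootDatum.qInt_mul,
      mul_div_assoc, div_self hQ, mul_one]
  · rw [limW, if_neg h, limV, if_neg h, w.sq]

theorem limV_ne {m : ℕ} (hm : m ≠ 0) : limV q k m ≠ 0 := by
  rw [limV]
  split_ifs with h
  · obtain ⟨s, rfl⟩ := h
    rw [Nat.mul_div_cancel_left _ H.k_pos]
    exact mul_ne_zero (Nat.cast_ne_zero.2 fun h => hm (by rw [h, mul_zero]))
      (pow_ne_zero _ (pow_ne_zero _ H.q_ne))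
  · exact fun h0 => h ((H.qInt_eq_zero_iff m).1 h0)

theorem limW_ne {m : ℕ} (hm : m ≠ 0) : w.limW m ≠ 0 := fun h =>
  limV_ne H hm (by rw [← w.limW_sq H, h]; simp)

theorem limFact_ne (m : ℕ) : w.limFact m ≠ 0 :=
  Finset.prod_ne_zero_iff.2 fun j _ => w.limW_ne H j.succ_ne_zero

omit H in
theorem limFact_succ (m : ℕ) : w.limFact (m + 1) = w.limFact m * w.limW (m + 1) :=
  Finset.prod_range_succ _ _

/-- Compared with `m + 1`, the factor at `m + 1 + k` carries an additional `q ^ k`, and, if `k ∣ m +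
1`, the quotient of the occupation numbers `(m + 1) / k + 1` and `m / k + 1`. -/
theorem limV_add (m : ℕ) : limV q k (m + 1 + k) * ((m / k : ℕ) + 1) =
    limV q k (m + 1) * q ^ k * (((m + 1) / k : ℕ) + 1) := by
  have hk := H.k_pos
  by_cases h : k ∣ m + 1
  · have hd := Nat.succ_div_of_dvd h
    obtain ⟨s, hs⟩ := h
    have hs1 : (m + 1) / k = s := by rw [hs, Nat.mul_div_cancel_left _ hk]
    have hs2 : m + 1 + k = k * (s + 1) := by rw [hs]; ring
    have hs3 : m / k + 1 = s := by rw [← hd]; exact hs1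
    have hs0 : (k * s) / k = s := Nat.mul_div_cancel_left _ hk
    rw [hs1, hs2, hs, limV, limV, if_pos (dvd_mul_right _ _), if_pos (dvd_mul_right _ _),
      Nat.mul_div_cancel_left _ hk, hs0]
    obtain ⟨t, rfl⟩ : ∃ t, s = t + 1 := ⟨m / k, hs3.symm⟩
    have : m / k = t := by omega
    rw [this]
    simp only [Nat.add_sub_cancel]
    push_cast
    ring
  · have h' : ¬k ∣ m + 1 + k := by rwa [Nat.dvd_add_left dvd_rfl]
    rw [Nat.succ_div_of_not_dvd h, limV, limV, if_neg h, if_neg h', H.qInt_add]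
    ring

/-- The square of the fundamental ratio `limFact (m + k) / (limFact m * limFact k)`. -/
theorem limFact_sq (m : ℕ) : w.limFact (m + k) ^ 2 =
    (w.limFact m * w.limFact k) ^ 2 * (q ^ k) ^ m * ((m / k : ℕ) + 1) := by
  induction m with
  | zero => simp [limFact, zero_add]
  | succ m ih =>
    have h1 := limV_add H m
    have hne : ((m / k : ℕ) : ℂ) + 1 ≠ 0 := Nat.cast_add_one_ne_zero _
    apply mul_right_cancel₀ hne
    rw [show m + 1 + k = m + k + 1 by ring, limFact_succ, limFact_succ, mul_pow, ih, w.limW_sq H,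
      show m + k + 1 = m + 1 + k by ring, mul_assoc, h1, mul_pow, mul_pow, mul_pow, w.limW_sq H]
    ring

/-- The squares of the coefficients of the limit bosons do not depend on the choice of square roots,
and are those of ordinary bosons with occupation number `m / k`. -/
theorem alpha_sq (m : ℕ) : w.alpha m ^ 2 = (m / k : ℕ) + 1 := by
  have h0 := w.limFact_ne H m
  have h1 := w.limFact_ne H k
  have h2 : (qHalf q k ^ 2) ^ m ≠ 0 := pow_ne_zero _ (pow_ne_zero _ (qHalf_ne H))
  rw [alpha, mul_pow, div_pow, w.limFact_sq H, ← qHalf_sq (q := q) (k := k), inv_pow,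
    inv_pow, ← pow_mul, mul_comm m, pow_mul]
  field_simp

/-! ### The limits of the oscillators -/

theorem w_eq_zero {m : ℕ} (h : k ∣ m) : w.w m q = 0 := by
  have := w.sq m q
  rw [(H.qInt_eq_zero_iff m).2 h] at this
  exact pow_eq_zero_iff two_ne_zero |>.1 this

theorem chiW_eq_zero {m : ℕ} (h : k ∣ m) : w.chiW m = 0 := by
  rw [chiW, w.w_eq_zero H h, mul_zero]

/-- The roots are continuous at `q` even if `k ∣ m`, where this is not assumed: there `|√[m]|² =
|[m]|` tends to zero. -/
theorem tendsto_w (m : ℕ) : Tendsto (w.w m) (𝓝[≠] q) (𝓝 (w.w m q)) := by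
  by_cases h : k ∣ m
  · rw [w.w_eq_zero H h]
    have h1 : Tendsto (fun Q => ‖w.w m Q‖ ^ 2) (𝓝[≠] q) (𝓝 0) := by
      have := ((H.continuousAt_qInt m).tendsto.mono_left
        (nhdsWithin_le_nhds (s := {q}ᶜ))).norm
      rw [(H.qInt_eq_zero_iff m).2 h, norm_zero] at this
      simpa only [← w.sq, norm_pow] using this
    have h2 := h1.sqrt
    rw [Real.sqrt_zero] at h2
    rw [tendsto_zero_iff_norm_tendsto_zero]
    simpa only [Real.sqrt_sq (norm_nonneg _)] using h2
  · exact (w.continuousAt m h).tendsto.mono_left nhdsWithin_le_nhds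

theorem qInt_mod (m : ℕ) : qInt q m = (q ^ k) ^ (m / k) * qInt q (m % k) := by
  have key : ∀ s t : ℕ, qInt q (k * s + t) = (q ^ k) ^ s * qInt q t := by
    intro s t
    induction s with
    | zero => simp
    | succ s ih => rw [show k * (s + 1) + t = k * s + t + k by ring, H.qInt_add, ih]; ring
  rw [← key, Nat.div_add_mod]

/-- The squares of the coefficients of the `k`-fermions depend on the occupation number modulo `k`
only. -/
theorem chiW_sq (m : ℕ) : w.chiW m ^ 2 = qInt q (m % k) := by
  have h2 : (qHalf q k ^ 2) ^ (m / k) ≠ 0 := pow_ne_zero _ (pow_ne_zero _ (qHalf_ne H))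
  rw [chiW, mul_pow, w.sq, qInt_mod H m, ← qHalf_sq (q := q) (k := k), inv_pow, inv_pow,
    ← pow_mul, mul_comm (m / k), pow_mul]
  field_simp

omit H in
/-- Each block of `k` consecutive factors contains one multiple of `k`, so that normalizing the
factors of `√([m]!)` divides it by the power `m / k` of `√[k]`. -/
theorem prod_w (m : ℕ) {Q : ℂ} (hQ : w.w k Q ≠ 0) : ∏ j ∈ Finset.range m, w.w (j + 1) Q =
    (∏ j ∈ Finset.range m, w.normW (j + 1) Q) * w.w k Q ^ (m / k) := by
  induction m with
  | zero => simp
  | succ m ih =>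
    rw [Finset.prod_range_succ, Finset.prod_range_succ, ih, normW]
    by_cases h : k ∣ m + 1
    · rw [if_pos h, Nat.succ_div_of_dvd h, pow_succ]
      field_simp
    · rw [if_neg h, Nat.succ_div_of_not_dvd h]; ring

/-- The coefficient of the prelimit bosons between `|m⟩` and `|m + k⟩`. -/
theorem tendsto_coeff (m : ℕ) : Tendsto (fun Q => (w.sqrtFactorial k Q)⁻¹ *
      (Q ^ ((-(k / 2) : ℂ) * m) * ∏ j ∈ Finset.range k, w.w (m + j + 1) Q))
    (𝓝[≠] q) (𝓝 (w.alpha m)) := by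
  have hk := H.k_pos
  have hR : ∀ a, Tendsto (fun Q => ∏ j ∈ Finset.range a, w.normW (j + 1) Q) (𝓝[≠] q)
      (𝓝 (w.limFact a)) := fun a => tendsto_finsetProd _ fun j _ => w.tendsto_normW _
  have hpow : Tendsto (fun Q => Q ^ ((-(k / 2) : ℂ) * m)) (𝓝[≠] q) (𝓝 ((qHalf q k)⁻¹ ^ m)) := by
    rw [← cpow_neg_half_nat]
    exact (continuousAt_cpow_const H.slit).tendsto.mono_left nhdsWithin_le_nhds
  refine (hpow.mul ((hR (m + k)).div ((hR m).mul (hR k))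
    (mul_ne_zero (w.limFact_ne H m) (w.limFact_ne H k)))).congr' ?_
  filter_upwards [w.eventually_w_ne H, (hR m).eventually_ne (w.limFact_ne H m)] with Q h1 h2
  -- one more factor `√[k]` occurs up to `m + k` than up to `m`; it cancels that of `√([k]!)`
  have e1 := w.prod_w (m + k) h1
  rw [Finset.prod_range_add, w.prod_w m h1, Nat.add_div_right _ hk, pow_succ] at e1
  have e2 : w.sqrtFactorial k Q = (∏ j ∈ Finset.range k, w.normW (j + 1) Q) * w.w k Q := by
    have := w.prod_w k h1
    rw [Nat.div_self hk, pow_one] at this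
    rw [← this, sqrtFactorial, Finset.range_eq_Ico, Finset.prod_Ico_add' (fun j => w.w j Q) 0 k 1]
    rfl
  have e3 : ∏ j ∈ Finset.range k, w.w (m + j + 1) Q =
      (∏ j ∈ Finset.range (m + k), w.normW (j + 1) Q) * w.w k Q /
        (∏ j ∈ Finset.range m, w.normW (j + 1) Q) := by
    rw [eq_div_iff h2]
    apply mul_right_cancel₀ (pow_ne_zero (m / k) h1)
    linear_combination e1
  rw [e2, e3]
  simp only [Pi.div_apply]
  field_simp

end RootBranch

theorem mod_succ_of_not_dvd {k m : ℕ} (h : ¬k ∣ m + 1) : (m + 1) % k = m % k + 1 := by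
  have h1 := Nat.div_add_mod m k
  have h2 := Nat.div_add_mod (m + 1) k
  rw [Nat.succ_div_of_not_dvd h] at h2
  omega

namespace RootBranch

variable {q : ℂ} {k : ℕ} (w : RootBranch q k) {l : ℕ}

/-- The limit boson `a_i⁻`. -/
noncomputable def limAm (i : Fin (l + 1)) : Op l :=
  modeOp i (fun m => m - k) (fun m => if m < k then 0 else w.alpha (m - k))

/-- The limit boson `a_i⁺`. -/
noncomputable def limAp (i : Fin (l + 1)) : Op l := modeOp i (fun m => m + k) w.alpha

theorem opPow_smul_numB (Q a : ℂ) (i : Fin (l + 1)) :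
    opPow Q (a • numB i) = modeOp i id (fun m => Q ^ (a * m)) := by
  rw [numB, smul_diagOp, opPow_diagOp, modeOp_id]

theorem iterate_sub_one (k m : ℕ) : (fun m => m - 1)^[k] m = m - k := by
  induction k with
  | zero => rfl
  | succ k ih => rw [Function.iterate_succ_apply', ih]; omega

theorem iterate_add_one (k m : ℕ) : (fun m => m + 1)^[k] m = m + k := by
  induction k with
  | zero => rfl
  | succ k ih => rw [Function.iterate_succ_apply', ih]; omega

/-- The prelimit `a_i⁻` lowers the occupation number by `k`, with the coefficients of
`tendsto_coeff`. -/
theorem preBosM_eq (Q : ℂ) (i : Fin (l + 1)) : w.preBosM Q i =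
    modeOp i (fun m => m - k) (fun m => if m < k then 0 else (w.sqrtFactorial k Q)⁻¹ *
      (Q ^ ((-(k / 2) : ℂ) * (m - k : ℕ)) * ∏ j ∈ Finset.range k, w.w (m - k + j + 1) Q)) := by
  rw [preBosM, opPow_smul_numB, Am, bosM_eq, modeOp_pow, modeOp_mul, smul_modeOp]
  refine modeOp_congr i (fun m => ?_) (fun m _ => iterate_sub_one k m)
  simp only [iterate_sub_one]
  split_ifs with h
  · rw [Finset.prod_eq_zero (Finset.mem_range.2 h) (by simp), zero_mul, mul_zero]
  · obtain ⟨m, rfl⟩ := Nat.exists_eq_add_of_le' (not_lt.1 h)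
    rw [Nat.add_sub_cancel, ← Finset.prod_range_reflect, mul_comm (Q ^ _)]
    congr 2
    refine Finset.prod_congr rfl fun j hj => ?_
    have hj := Finset.mem_range.1 hj
    rw [if_neg (by omega)]
    congr 1; omega

/-- The prelimit `a_i⁺` raises the occupation number by `k`, with the coefficients of
`tendsto_coeff`. -/
theorem preBosP_eq (Q : ℂ) (i : Fin (l + 1)) : w.preBosP Q i =
    modeOp i (fun m => m + k) (fun m => (w.sqrtFactorial k Q)⁻¹ *
      (Q ^ ((-(k / 2) : ℂ) * m) * ∏ j ∈ Finset.range k, w.w (m + j + 1) Q)) := by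
  rw [preBosP, opPow_smul_numB, Ap, bosP_eq, modeOp_pow, modeOp_mul, smul_modeOp]
  refine modeOp_congr i (fun m => ?_) (fun m _ => iterate_add_one k m)
  simp only [iterate_add_one, id]

variable (H : IsRootDatum q k)

include H

theorem hasOpLim_preBosM (i : Fin (l + 1)) :
    HasOpLim (fun Q => w.preBosM Q i) q (w.limAm i) := by
  simp only [preBosM_eq]
  refine hasOpLim_wShift fun x => ?_
  dsimp only
  split_ifs
  · exact tendsto_const_nhds
  · exact w.tendsto_coeff H _

theorem hasOpLim_preBosP (i : Fin (l + 1)) :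
    HasOpLim (fun Q => w.preBosP Q i) q (w.limAp i) := by
  simp only [preBosP_eq]
  exact hasOpLim_wShift fun x => w.tendsto_coeff H _

theorem hasOpLim_Am (i : Fin (l + 1)) : HasOpLim (fun Q => w.Am Q i) q (w.Am q i) := by
  refine hasOpLim_wShift fun x => ?_
  dsimp only
  split_ifs
  · exact tendsto_const_nhds
  · exact w.tendsto_w H _

theorem hasOpLim_Ap (i : Fin (l + 1)) : HasOpLim (fun Q => w.Ap Q i) q (w.Ap q i) :=
  hasOpLim_wShift fun _ => w.tendsto_w H _

theorem limAm_mul_limAp (i : Fin (l + 1)) :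
    w.limAm i * w.limAp i = diagOp fun x : Occ l => ((x.1 i / k : ℕ) : ℂ) + 1 := by
  rw [limAm, limAp, modeOp_mul]
  refine modeOp_eq_diagOp i (d := fun m => ((m / k : ℕ) : ℂ) + 1) (fun m => ?_) (fun m _ => by simp)
  rw [if_neg (by omega), Nat.add_sub_cancel, ← pow_two, w.alpha_sq H]

/-- The number operator of the limit bosons is the quotient of the occupation number by `k`. -/
theorem limAp_mul_limAm (i : Fin (l + 1)) :
    w.limAp i * w.limAm i = diagOp fun x : Occ l => ((x.1 i / k : ℕ) : ℂ) := by
  rw [limAm, limAp, modeOp_mul]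
  refine modeOp_eq_diagOp i (d := fun m => ((m / k : ℕ) : ℂ)) (fun m => ?_) (fun m hm => ?_)
  · split_ifs with h
    · rw [Nat.div_eq_of_lt h]; simp
    · rw [← pow_two, w.alpha_sq H]
      obtain ⟨m, rfl⟩ := Nat.exists_eq_add_of_le' (not_lt.1 h)
      rw [Nat.add_sub_cancel, Nat.add_div_right _ H.k_pos]; push_cast; ring
  · have : ¬m < k := fun h => hm (by simp [h])
    simp only [Function.comp_apply]; omega

theorem isBosons_lim : IsBosons (w.limAm : Fin (l + 1) → Op l) w.limAp where
  rel i j := by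
    by_cases hij : i = j
    · subst hij
      rw [if_pos rfl, w.limAm_mul_limAp H, w.limAp_mul_limAm H, diagOp_sub, ← diagOp_one]
      simp
    · rw [if_neg hij]
      exact sub_eq_zero.2 (modeOp_commute hij _ _ _ _).eq
  comm_minus i j := by
    by_cases hij : i = j
    · exact hij ▸ Commute.refl _
    · exact modeOp_commute hij _ _ _ _
  comm_plus i j := by
    by_cases hij : i = j
    · exact hij ▸ Commute.refl _
    · exact modeOp_commute hij _ _ _ _
  num_minus i := by
    have h := hasWt_modeOp (i := i) (j := i) (f := fun m => m - k)
      (c := fun m => if m < k then 0 else w.alpha (m - k)) (d := fun m => ((m / k : ℕ) : ℂ))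
      (δ := -1) fun m hm => by
        have h : ¬m < k := fun h => hm (if_pos h)
        obtain ⟨m, rfl⟩ := Nat.exists_eq_add_of_le' (not_lt.1 h)
        rw [Nat.add_sub_cancel, Nat.add_div_right _ H.k_pos]; push_cast; ring
    rw [if_pos rfl] at h
    rw [w.limAp_mul_limAm H, limAm]
    exact h.eq_neg
  num_plus i := by
    have h := hasWt_modeOp (i := i) (j := i) (f := fun m => m + k)
      (c := w.alpha) (d := fun m => ((m / k : ℕ) : ℂ)) (δ := 1) fun m hm => by
        rw [Nat.add_div_right _ H.k_pos]; push_cast; ring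
    rw [if_pos rfl] at h
    rw [w.limAp_mul_limAm H, limAp]
    exact h.eq_self

/-! ### The `k`-fermions -/

theorem opPow_smul_num (a : ℂ) (i : Fin (l + 1)) :
    opPow q (a • (w.limAp i * w.limAm i)) = modeOp i id (fun m => q ^ (a * (m / k : ℕ))) := by
  rw [w.limAp_mul_limAm H, smul_diagOp, opPow_diagOp, modeOp_id]

theorem chiM_eq (i : Fin (l + 1)) : w.chiM w.limAm w.limAp i = bosM w.chiW i := by
  rw [chiM, w.opPow_smul_num H, Am, bosM_eq, bosM_eq, modeOp_mul]
  refine modeOp_congr i (fun m => ?_) fun m _ => rfl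
  rw [cpow_neg_half_nat]
  simp only [id, chiW]
  split_ifs <;> simp

theorem chiP_eq (i : Fin (l + 1)) : w.chiP w.limAm w.limAp i = bosP w.chiW i := by
  rw [chiP, w.opPow_smul_num H, Ap, bosP_eq, bosP_eq, modeOp_mul]
  refine modeOp_congr i (fun m => ?_) fun m _ => rfl
  rw [cpow_neg_half_nat]
  simp only [id]
  by_cases h : k ∣ m + 1
  · rw [w.chiW_eq_zero H h, w.w_eq_zero H h, mul_zero]
  · rw [chiW, Nat.succ_div_of_not_dvd h]

/-- The number operator of the `k`-fermions is the remainder of the occupation number modulo `k`. -/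
theorem chiN_eq (i : Fin (l + 1)) :
    chiN k w.limAm w.limAp i = diagOp fun x : Occ l => ((x.1 i % k : ℕ) : ℂ) := by
  rw [chiN, w.limAp_mul_limAm H, numB, smul_diagOp, diagOp_sub]
  congr 1; ext x
  rw [sub_eq_iff_eq_add, ← Nat.cast_mul, ← Nat.cast_add, Nat.mod_add_div]

theorem opPow_num_cancel (i : Fin (l + 1)) :
    opPow q ((-(k / 2) : ℂ) • (w.limAp i * w.limAm i)) *
      opPow q ((k / 2 : ℂ) • (w.limAp i * w.limAm i)) = 1 := by
  rw [w.limAp_mul_limAm H, smul_diagOp, smul_diagOp, opPow_diagOp, opPow_diagOp, diagOp_mul,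
    ← diagOp_one]
  congr 1; ext x
  rw [← Complex.cpow_add _ _ H.q_ne, neg_mul, neg_add_cancel, Complex.cpow_zero]

theorem chiM_mul_opPow (i : Fin (l + 1)) : w.chiM w.limAm w.limAp i *
    opPow q ((k / 2 : ℂ) • (w.limAp i * w.limAm i)) = w.Am q i := by
  rw [chiM, mul_assoc, w.opPow_num_cancel H, mul_one]

theorem chiP_mul_opPow (i : Fin (l + 1)) : w.chiP w.limAm w.limAp i *
    opPow q ((k / 2 : ℂ) • (w.limAp i * w.limAm i)) = w.Ap q i := by
  rw [chiP, mul_assoc, w.opPow_num_cancel H, mul_one]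

/-- Both sides vanish when the remainder wraps around. -/
theorem qInt_mod_succ (m : ℕ) : qInt q ((m + 1) % k) = qInt q (m % k + 1) := by
  by_cases h : k ∣ m + 1
  · rw [Nat.mod_eq_zero_of_dvd h, qInt_zero, eq_comm, H.qInt_eq_zero_iff]
    have e := Nat.div_add_mod m k
    rw [← e, add_assoc, Nat.dvd_add_right (dvd_mul_right _ _)] at h
    exact h
  · rw [mod_succ_of_not_dvd h]

theorem chi_mul (i : Fin (l + 1)) :
    bosP w.chiW i * bosM w.chiW i = (diagOp fun x : Occ l => qInt q (x.1 i % k)) ∧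
    bosM w.chiW i * bosP w.chiW i = diagOp fun x : Occ l => qInt q (x.1 i % k + 1) := by
  constructor
  · exact bosP_mul_bosM (v := fun m => qInt q (m % k)) (w.chiW_sq H) (by simp [qInt_zero]) i
  · rw [bosM_mul_bosP (v := fun m => qInt q (m % k)) (w.chiW_sq H)]
    simp only [qInt_mod_succ H]

/-- The shift of the number operator of the `k`-fermions. -/
theorem hasWt_chi (i j : Fin (l + 1)) :
    HasWt (-if j = i then 1 else 0) (diagOp fun x : Occ l => ((x.1 i % k : ℕ) : ℂ))
      (bosM w.chiW j) ∧
    HasWt (if j = i then 1 else 0) (diagOp fun x : Occ l => ((x.1 i % k : ℕ) : ℂ))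
      (bosP w.chiW j) := by
  have key : ∀ m, w.chiW (m + 1) ≠ 0 → (m + 1) % k = m % k + 1 := fun m hm =>
    mod_succ_of_not_dvd fun h => hm (w.chiW_eq_zero H h)
  rw [bosM_eq, bosP_eq]
  constructor
  · refine (hasWt_modeOp (d := fun m => ((m % k : ℕ) : ℂ)) (δ := -1) fun m hm => ?_).congr
      (by split_ifs <;> simp)
    rcases m with _ | m
    · simp at hm
    · rw [if_neg m.succ_ne_zero] at hm
      rw [key m hm, Nat.add_sub_cancel]; push_cast; ring
  · refine hasWt_modeOp (d := fun m => ((m % k : ℕ) : ℂ)) fun m hm => ?_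
    rw [key m hm]; push_cast; ring

theorem isKFermions_lim : IsKFermions q k (w.chiM w.limAm w.limAp : Fin (l + 1) → Op l)
    (w.chiP w.limAm w.limAp) (chiN k w.limAm w.limAp) := by
  have e1 : (w.chiM w.limAm w.limAp : Fin (l + 1) → Op l) = bosM w.chiW :=
    funext (w.chiM_eq H)
  have e2 : (w.chiP w.limAm w.limAp : Fin (l + 1) → Op l) = bosP w.chiW :=
    funext (w.chiP_eq H)
  have e3 : (chiN k w.limAm w.limAp : Fin (l + 1) → Op l) =
    fun i => diagOp fun x : Occ l => ((x.1 i % k : ℕ) : ℂ) := funext (w.chiN_eq H)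
  rw [e1, e2, e3]
  refine ⟨fun i => ?_, fun i => ?_, fun i => ?_, fun i => ?_, fun i => ?_, fun i => ?_,
    fun i j h => ⟨bosM_commute_bosM h _ _, bosP_commute_bosP h _ _, bosM_commute_bosP h _ _,
      ?_, ?_⟩, fun i j => diagOp_commute _ _⟩
  · rw [(w.chi_mul H i).1, (w.chi_mul H i).2, smul_diagOp, diagOp_sub, opPow_diagOp]
    simp only [qInt_succ_sub_inv_mul H.q_ne H.sq_ne, Complex.cpow_natCast]
  · rw [(w.chi_mul H i).1, (w.chi_mul H i).2, smul_diagOp, diagOp_sub, neg_diagOp, opPow_diagOp]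
    simp only [qInt_succ_sub_mul H.q_ne H.sq_ne, Complex.cpow_neg, Complex.cpow_natCast, inv_pow]
  · have h := (w.hasWt_chi H i i).1
    rw [if_pos rfl] at h
    exact h.eq_neg
  · have h := (w.hasWt_chi H i i).2
    rw [if_pos rfl] at h
    exact h.eq_self
  · -- among `k` consecutive levels one is a multiple of `k`, where the weight vanishes
    rw [bosM_eq, modeOp_pow, ← modeOp_zero i (fun m => m - 1)^[k]]
    refine modeOp_congr i (fun m => ?_) fun m _ => rfl
    refine Finset.prod_eq_zero (Finset.mem_range.2 (Nat.mod_lt m H.k_pos)) ?_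
    rw [iterate_sub_one]
    have : m - m % k = k * (m / k) := by have := Nat.div_add_mod m k; omega
    rw [this, w.chiW_eq_zero H (dvd_mul_right _ _), ite_self]
  · rw [bosP_eq, modeOp_pow, ← modeOp_zero i (fun m => m + 1)^[k]]
    refine modeOp_congr i (fun m => ?_) fun m _ => rfl
    have hlt := Nat.mod_lt m H.k_pos
    refine Finset.prod_eq_zero (Finset.mem_range.2 (show k - 1 - m % k < k by omega)) ?_
    rw [iterate_add_one]
    have : m + (k - 1 - m % k) + 1 = k * (m / k + 1) := by
      have := Nat.div_add_mod m k
      rw [Nat.mul_succ]; omega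
    rw [this, w.chiW_eq_zero H (dvd_mul_right _ _)]
  · exact ((w.hasWt_chi H i j).1.congr (by simp [Ne.symm h])).commute
  · exact ((w.hasWt_chi H i j).2.congr (by simp [Ne.symm h])).commute

end RootBranch

/-! ### Splitting of the Fock space -/

section Splitting

variable {l k : ℕ}

/-- Division with remainder by `k` in every bosonic mode. -/
def occEquiv (l : ℕ) {k : ℕ} (hk : 0 < k) : Occ l ≃ (Fin (l + 1) → Fin k) × Occ l where
  toFun x := (fun i => ⟨x.1 i % k, Nat.mod_lt _ hk⟩, (fun i => x.1 i / k, x.2))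
  invFun y := (fun i => k * y.2.1 i + y.1 i, y.2.2)
  left_inv x := by
    refine Prod.ext (funext fun i => ?_) rfl
    exact Nat.div_add_mod _ _
  right_inv y := by
    refine Prod.ext (funext fun i => Fin.ext ?_) (Prod.ext (funext fun i => ?_) rfl)
    · simp [Nat.mod_eq_of_lt (y.1 i).2]
    · simp [Nat.mul_add_div hk, Nat.div_eq_of_lt (y.1 i).2]

/-- The isomorphism `|m, s⟩ ↦ λ(m) |m mod k⟩ ⊗ |m / k, s⟩`, with nonzero scalars `λ` to be chosen.
-/
noncomputable def splitEquiv (hk : 0 < k) (c : Occ l → ℂˣ) : Fock l ≃ₗ[ℂ] KFock l k ⊗[ℂ] Fock l :=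
  (Finsupp.basisSingleOne (R := ℂ) (ι := Occ l)).equiv
    ((((Finsupp.basisSingleOne (R := ℂ) (ι := Fin (l + 1) → Fin k)).tensorProduct
      (Finsupp.basisSingleOne (R := ℂ) (ι := Occ l))).reindex (occEquiv l hk).symm).unitsSMul c)
    (Equiv.refl _)

theorem splitEquiv_single (hk : 0 < k) (c : Occ l → ℂˣ) (x : Occ l) (a : ℂ) :
    splitEquiv hk c (Finsupp.single x a) = (a * c x) •
      (Finsupp.single (occEquiv l hk x).1 (1 : ℂ) ⊗ₜ[ℂ]
        Finsupp.single (occEquiv l hk x).2 (1 : ℂ)) := by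
  have h : (Finsupp.single x a : Fock l) = a • Finsupp.basisSingleOne (R := ℂ) x := by simp
  rw [h, map_smul, splitEquiv, Module.Basis.equiv_apply, Module.Basis.unitsSMul_apply,
    Module.Basis.reindex_apply, Equiv.symm_symm, Equiv.refl_apply,
    Module.Basis.tensorProduct_apply', mul_smul]
  simp [Units.smul_def]

variable (hk : 0 < k) (c : Occ l → ℂˣ)

theorem single_eq_smul {B : Type*} (y : B) (a : ℂ) :
    (Finsupp.single y a : B →₀ ℂ) = a • Finsupp.single y 1 := by simp

/-- When a weighted shift acts on the remainders modulo `k`. -/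
theorem split_rTensor {f : Occ l → Occ l} {d : Occ l → ℂ}
    {g : (Fin (l + 1) → Fin k) → (Fin (l + 1) → Fin k)} {e : (Fin (l + 1) → Fin k) → ℂ}
    (h1 : ∀ x, d x * c (f x) = c x * e (occEquiv l hk x).1)
    (h2 : ∀ x, d x ≠ 0 → occEquiv l hk (f x) = (g (occEquiv l hk x).1, (occEquiv l hk x).2))
    (v : Fock l) : splitEquiv hk c (wShift f d v) =
      (wShift g e).rTensor (Fock l) (splitEquiv hk c v) := by
  suffices h : (splitEquiv hk c).toLinearMap ∘ₗ wShift f d =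
      (wShift g e).rTensor (Fock l) ∘ₗ (splitEquiv hk c).toLinearMap from LinearMap.congr_fun h v
  refine Finsupp.lhom_ext' fun x => LinearMap.ext_ring ?_
  simp only [LinearMap.comp_apply, Finsupp.lsingle_apply, LinearEquiv.coe_coe, wShift_single,
    splitEquiv_single, map_smul, LinearMap.rTensor_tmul, one_mul]
  rw [single_eq_smul _ (e _), ← TensorProduct.smul_tmul', smul_smul, h1 x]
  by_cases hd : d x = 0
  · have := h1 x
    rw [hd, zero_mul] at this
    rw [← this, zero_smul, zero_smul]
  · rw [h2 x hd]

/-- When a weighted shift acts on the quotients by `k` and on the fermions. -/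
theorem split_lTensor {f g : Occ l → Occ l} {d e : Occ l → ℂ}
    (h1 : ∀ x, d x * c (f x) = c x * e (occEquiv l hk x).2)
    (h2 : ∀ x, d x ≠ 0 → occEquiv l hk (f x) = ((occEquiv l hk x).1, g (occEquiv l hk x).2))
    (v : Fock l) : splitEquiv hk c (wShift f d v) =
      (wShift g e).lTensor (KFock l k) (splitEquiv hk c v) := by
  suffices h : (splitEquiv hk c).toLinearMap ∘ₗ wShift f d =
      (wShift g e).lTensor (KFock l k) ∘ₗ (splitEquiv hk c).toLinearMap from LinearMap.congr_fun h v
  refine Finsupp.lhom_ext' fun x => LinearMap.ext_ring ?_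
  simp only [LinearMap.comp_apply, Finsupp.lsingle_apply, LinearEquiv.coe_coe, wShift_single,
    splitEquiv_single, map_smul, LinearMap.lTensor_tmul, one_mul]
  rw [single_eq_smul _ (e _), TensorProduct.tmul_smul, smul_smul, h1 x]
  by_cases hd : d x = 0
  · have := h1 x
    rw [hd, zero_mul] at this
    rw [← this, zero_smul, zero_smul]
  · rw [h2 x hd]

/-- A scalar that is a product over the modes changes by one factor under a shift of one mode. -/
theorem prod_update (c : ℕ → ℂ) (x : Fin (l + 1) → ℕ) (i : Fin (l + 1)) (m : ℕ) :
    (∏ j, c (Function.update x i m j)) * c (x i) = (∏ j, c (x j)) * c m := by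
  rw [← Finset.mul_prod_erase _ _ (Finset.mem_univ i),
    ← Finset.mul_prod_erase _ (fun j => c (x j)) (Finset.mem_univ i), Function.update_self,
    Finset.prod_congr rfl fun j hj => by rw [Function.update_of_ne (Finset.ne_of_mem_erase hj)]]
  ring

theorem update_map {β : Type*} (p : ℕ → β) (x : Fin (l + 1) → ℕ) (i : Fin (l + 1)) (m : ℕ) :
    (fun j => p (Function.update x i m j)) = Function.update (fun j => p (x j)) i (p m) := by
  ext j
  by_cases h : j = i
  · subst h; simp
  · simp [Function.update_of_ne h]

theorem occEquiv_update (x : Occ l) (i : Fin (l + 1)) (m : ℕ) :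
    occEquiv l hk (Function.update x.1 i m, x.2) =
      (Function.update (occEquiv l hk x).1 i ⟨m % k, Nat.mod_lt _ hk⟩,
        (Function.update (occEquiv l hk x).2.1 i (m / k), x.2)) :=
  Prod.ext (update_map (fun m => (⟨m % k, Nat.mod_lt _ hk⟩ : Fin k)) _ _ _)
    (Prod.ext (update_map (fun m => m / k) _ _ _) rfl)

/-- A shift of one mode that preserves the quotient of the occupation number by `k`. -/
theorem occEquiv_update_mod {x : Occ l} {i : Fin (l + 1)} {m : ℕ} (h : m / k = x.1 i / k)
    (t : Fin k) (ht : m % k = t) : occEquiv l hk (Function.update x.1 i m, x.2) =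
      (Function.update (occEquiv l hk x).1 i t, (occEquiv l hk x).2) := by
  rw [occEquiv_update, h]
  exact Prod.ext (by dsimp only; congr 1; exact Fin.ext ht)
    (Prod.ext (Function.update_eq_self i (occEquiv l hk x).2.1) rfl)

/-- A shift of one mode that preserves the remainder of the occupation number modulo `k`. -/
theorem occEquiv_update_div {x : Occ l} {i : Fin (l + 1)} {m : ℕ} (h : m % k = x.1 i % k) :
    occEquiv l hk (Function.update x.1 i m, x.2) = ((occEquiv l hk x).1,
      (Function.update (occEquiv l hk x).2.1 i (m / k), (occEquiv l hk x).2.2)) := by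
  rw [occEquiv_update]
  refine Prod.ext ?_ rfl
  have : (⟨m % k, Nat.mod_lt _ hk⟩ : Fin k) = (occEquiv l hk x).1 i := Fin.ext h
  rw [this]
  exact Function.update_eq_self i (occEquiv l hk x).1

end Splitting

namespace RootBranch

variable {q : ℂ} {k : ℕ} (w : RootBranch q k) {l : ℕ}

/-- The exponent of `q ^ (k / 2)` in the rescaling of the basis. -/
def scaleExp (k m : ℕ) : ℕ := k * (m / k).choose 2 + (m / k) * (m % k)

/-- The rescaling `λ` of the basis vectors of one mode that turns the coefficients `chiW` and
`alpha`, which depend on the choice of square roots, into the standard ones. -/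
noncomputable def scale (m : ℕ) : ℂ :=
  (∏ j ∈ Finset.range (m / k), ((√((j + 1 : ℕ) : ℝ) : ℝ) : ℂ)) * w.limFact k ^ (m / k) *
    qHalf q k ^ scaleExp k m / w.limFact m

theorem sqrt_cast_sq (m : ℕ) : ((√((m : ℕ) : ℝ) : ℝ) : ℂ) ^ 2 = m := by
  rw [← Complex.ofReal_pow, Real.sq_sqrt (Nat.cast_nonneg _), Complex.ofReal_natCast]

theorem sqrt_cast_ne (m : ℕ) : ((√((m + 1 : ℕ) : ℝ) : ℝ) : ℂ) ≠ 0 := by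
  rw [Complex.ofReal_ne_zero, Real.sqrt_ne_zero']; positivity

variable (H : IsRootDatum q k)

include H

theorem scale_ne (m : ℕ) : w.scale m ≠ 0 :=
  div_ne_zero (mul_ne_zero (mul_ne_zero (Finset.prod_ne_zero_iff.2 fun j _ => sqrt_cast_ne j)
    (pow_ne_zero _ (w.limFact_ne H k))) (pow_ne_zero _ (qHalf_ne H))) (w.limFact_ne H m)

/-- The rescaling turns the coefficients of `χ⁺` into `1`, and hence those of `χ⁻` into their
squares. -/
theorem scale_succ {m : ℕ} (h : ¬k ∣ m + 1) : w.scale (m + 1) * w.chiW (m + 1) = w.scale m := by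
  have h1 : scaleExp k (m + 1) = scaleExp k m + m / k := by
    rw [scaleExp, scaleExp, Nat.succ_div_of_not_dvd h, mod_succ_of_not_dvd h]; ring
  have h2 := w.limW_ne H m.succ_ne_zero
  have h3 := w.limFact_ne H m
  have h4 := qHalf_ne H
  have h5 : w.limW (m + 1) = w.w (m + 1) q := by rw [limW, if_neg h]
  rw [scale, scale, h1, chiW, Nat.succ_div_of_not_dvd h, limFact_succ, ← h5, pow_add, inv_pow]
  field_simp

/-- The rescaling turns the coefficients of `a⁺` into the square roots of the occupation numbers. -/
theorem scale_add (m : ℕ) :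
    w.scale (m + k) * w.alpha m = w.scale m * ((√((m / k + 1 : ℕ) : ℝ) : ℝ) : ℂ) := by
  have h1 : scaleExp k (m + k) = scaleExp k m + m := by
    rw [scaleExp, scaleExp, Nat.add_div_right _ H.k_pos, Nat.add_mod_right,
      Nat.choose_succ_succ' _ 1, Nat.choose_one_right]
    conv_rhs => rw [← Nat.div_add_mod m k]
    have := Nat.div_add_mod m k
    rw [this]
    calc _ = k * (m / k).choose 2 + m / k * (m % k) + (k * (m / k) + m % k) := by ring
      _ = _ := by rw [this]
  have h2 := w.limFact_ne H (m + k)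
  have h3 := w.limFact_ne H m
  have h4 := qHalf_ne H
  have h5 := w.limFact_ne H k
  rw [scale, scale, h1, alpha, Nat.add_div_right _ H.k_pos, Finset.prod_range_succ, pow_add,
    pow_succ, inv_pow]
  field_simp
  rw [pow_add]; ring

/-- The same rescaling is also right for `a⁻`: the coefficients of `a⁺` and their images under the
rescaling have equal squares by `alpha_sq`. -/
theorem scale_add' (m : ℕ) :
    w.scale m * w.alpha m = w.scale (m + k) * ((√((m / k + 1 : ℕ) : ℝ) : ℝ) : ℂ) := by
  have h := w.alpha_sq H m
  have h' : ((√((m / k + 1 : ℕ) : ℝ) : ℝ) : ℂ) ^ 2 = (m / k : ℕ) + 1 := by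
    rw [sqrt_cast_sq, Nat.cast_succ]
  have h'' := w.scale_add H m
  have hne := sqrt_cast_ne (m / k)
  set S : ℂ := ((√((m / k + 1 : ℕ) : ℝ) : ℝ) : ℂ)
  apply mul_right_cancel₀ hne
  linear_combination (-w.alpha m) * h'' + w.scale (m + k) * (h - h')

/-- The scalars `λ(m)`, products of the scalars of the modes. -/
noncomputable def scaleUnit (l : ℕ) (x : Occ l) : ℂˣ :=
  Units.mk0 (∏ i, w.scale (x.1 i)) (Finset.prod_ne_zero_iff.2 fun _ _ => w.scale_ne H _)

/-- For operators on one mode, the rescaling may be checked on that mode. -/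
theorem scaleUnit_update {x : Occ l} {i : Fin (l + 1)} {m : ℕ} {d e : ℂ}
    (h : d * w.scale m = w.scale (x.1 i) * e) :
    d * (w.scaleUnit H l (Function.update x.1 i m, x.2) : ℂ) = w.scaleUnit H l x * e := by
  have h1 := prod_update w.scale x.1 i m
  have h2 := w.scale_ne H (x.1 i)
  simp only [scaleUnit, Units.val_mk0]
  apply mul_right_cancel₀ h2
  rw [mul_assoc, h1]
  linear_combination (∏ j, w.scale (x.1 j)) * h

theorem split_chiM (i : Fin (l + 1)) (v : Fock l) :
    splitEquiv H.k_pos (w.scaleUnit H l) (bosM w.chiW i v) =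
      (kFerM q i).rTensor (Fock l) (splitEquiv H.k_pos (w.scaleUnit H l) v) := by
  rw [bosM, kFerM]
  refine split_rTensor H.k_pos _ (fun x => w.scaleUnit_update H ?_) (fun x hx => ?_) v
  · change (if x.1 i = 0 then 0 else w.chiW (x.1 i)) * w.scale (x.1 i - 1) =
      w.scale (x.1 i) * qInt q (x.1 i % k)
    rcases x.1 i with _ | m
    · simp [qInt_zero]
    · rw [if_neg m.succ_ne_zero, Nat.add_sub_cancel, ← w.chiW_sq H]
      by_cases h : k ∣ m + 1
      · rw [w.chiW_eq_zero H h]; ring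
      · rw [← w.scale_succ H h]; ring
  · have hd : ∃ m, x.1 i = m + 1 ∧ ¬k ∣ m + 1 := by
      rcases hm : x.1 i with _ | m
      · simp [hm] at hx
      · exact ⟨m, rfl, fun h => hx (by simp only [hm]; rw [w.chiW_eq_zero H h, ite_self])⟩
    obtain ⟨m, hm, hd⟩ := hd
    refine occEquiv_update_mod H.k_pos ?_ _ ?_
    · rw [hm, Nat.succ_div_of_not_dvd hd, Nat.add_sub_cancel]
    · change (x.1 i - 1) % k = x.1 i % k - 1
      rw [hm, mod_succ_of_not_dvd hd, Nat.add_sub_cancel, Nat.add_sub_cancel]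

theorem split_chiP (i : Fin (l + 1)) (v : Fock l) :
    splitEquiv H.k_pos (w.scaleUnit H l) (bosP w.chiW i v) =
      (kFerP i).rTensor (Fock l) (splitEquiv H.k_pos (w.scaleUnit H l) v) := by
  rw [bosP, kFerP]
  refine split_rTensor H.k_pos _ (fun x => w.scaleUnit_update H ?_) (fun x hx => ?_) v
  · change w.chiW (x.1 i + 1) * w.scale (x.1 i + 1) =
      w.scale (x.1 i) * (if x.1 i % k + 1 < k then 1 else 0)
    by_cases h : k ∣ x.1 i + 1
    · have hlt : ¬x.1 i % k + 1 < k := fun hlt => by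
        have := (Nat.dvd_add_right (dvd_mul_right k (x.1 i / k))).1
          (by rwa [← add_assoc, Nat.div_add_mod])
        exact absurd (Nat.le_of_dvd (Nat.succ_pos _) this) (not_le.2 hlt)
      rw [w.chiW_eq_zero H h, if_neg hlt]; ring
    · have hlt : x.1 i % k + 1 < k := mod_succ_of_not_dvd h ▸ Nat.mod_lt _ H.k_pos
      rw [if_pos hlt, ← w.scale_succ H h]; ring
  · have hd : ¬k ∣ x.1 i + 1 := fun h => hx (w.chiW_eq_zero H h)
    have e1 := mod_succ_of_not_dvd hd
    have hlt : ((occEquiv l H.k_pos x).1 i : ℕ) + 1 < k := by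
      change x.1 i % k + 1 < k
      exact e1 ▸ Nat.mod_lt _ H.k_pos
    rw [dif_pos hlt]
    exact occEquiv_update_mod H.k_pos (Nat.succ_div_of_not_dvd hd) _ e1

theorem split_chiN (i : Fin (l + 1)) (v : Fock l) :
    splitEquiv H.k_pos (w.scaleUnit H l) (diagOp (fun x => ((x.1 i % k : ℕ) : ℂ)) v) =
      (kFerN i).rTensor (Fock l) (splitEquiv H.k_pos (w.scaleUnit H l) v) := by
  rw [kFerN, diagOp, diagOp]
  refine split_rTensor H.k_pos _ (fun x => ?_) (fun x _ => rfl) v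
  change ((x.1 i % k : ℕ) : ℂ) * (w.scaleUnit H l x : ℂ) =
    (w.scaleUnit H l x : ℂ) * ((x.1 i % k : ℕ) : ℂ)
  exact mul_comm _ _

theorem split_limAm (i : Fin (l + 1)) (v : Fock l) :
    splitEquiv H.k_pos (w.scaleUnit H l) (w.limAm i v) =
      (bosM (fun m => ((√(m : ℝ) : ℝ) : ℂ)) i).lTensor (KFock l k)
        (splitEquiv H.k_pos (w.scaleUnit H l) v) := by
  rw [limAm, modeOp, bosM]
  refine split_lTensor H.k_pos _ (fun x => w.scaleUnit_update H ?_) (fun x hx => ?_) v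
  · change (if x.1 i < k then 0 else w.alpha (x.1 i - k)) * w.scale (x.1 i - k) =
      w.scale (x.1 i) * (if x.1 i / k = 0 then 0 else ((√((x.1 i / k : ℕ) : ℝ) : ℝ) : ℂ))
    by_cases h : x.1 i < k
    · rw [if_pos h, if_pos (Nat.div_eq_of_lt h)]; ring
    · obtain ⟨m, hm⟩ := Nat.exists_eq_add_of_le' (not_lt.1 h)
      rw [if_neg h, hm, Nat.add_sub_cancel, Nat.add_div_right _ H.k_pos,
        if_neg (Nat.succ_ne_zero _), mul_comm, w.scale_add' H]
  · have h : ¬x.1 i < k := fun h => hx (if_pos h)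
    rw [occEquiv_update_div H.k_pos (Nat.mod_eq_sub_mod (not_lt.1 h)).symm]
    congr 3
    change _ = x.1 i / k - 1
    rw [Nat.div_eq_sub_div H.k_pos (not_lt.1 h), Nat.add_sub_cancel]

theorem split_limAp (i : Fin (l + 1)) (v : Fock l) :
    splitEquiv H.k_pos (w.scaleUnit H l) (w.limAp i v) =
      (bosP (fun m => ((√(m : ℝ) : ℝ) : ℂ)) i).lTensor (KFock l k)
        (splitEquiv H.k_pos (w.scaleUnit H l) v) := by
  rw [limAp, modeOp, bosP]
  refine split_lTensor H.k_pos _ (fun x => w.scaleUnit_update H ?_) (fun x hx => ?_) v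
  · change w.alpha (x.1 i) * w.scale (x.1 i + k) =
      w.scale (x.1 i) * ((√((x.1 i / k + 1 : ℕ) : ℝ) : ℝ) : ℂ)
    rw [mul_comm, w.scale_add H]
  · rw [occEquiv_update_div H.k_pos (Nat.add_mod_right _ _), Nat.add_div_right _ H.k_pos]
    rfl

theorem split_ferM (i : Fin (l + 1)) (v : Fock l) :
    splitEquiv H.k_pos (w.scaleUnit H l) (ferM i v) =
      (ferM i).lTensor (KFock l k) (splitEquiv H.k_pos (w.scaleUnit H l) v) := by
  rw [ferM]
  refine split_lTensor H.k_pos _ (fun x => ?_) (fun x _ => rfl) v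
  change (if i ∈ x.2 then ferSign i x.2 else 0) * (w.scaleUnit H l x : ℂ) =
    (w.scaleUnit H l x : ℂ) * (if i ∈ x.2 then ferSign i x.2 else 0)
  exact mul_comm _ _

theorem split_ferP (i : Fin (l + 1)) (v : Fock l) :
    splitEquiv H.k_pos (w.scaleUnit H l) (ferP i v) =
      (ferP i).lTensor (KFock l k) (splitEquiv H.k_pos (w.scaleUnit H l) v) := by
  rw [ferP]
  refine split_lTensor H.k_pos _ (fun x => ?_) (fun x _ => rfl) v
  change (if i ∈ x.2 then 0 else ferSign i x.2) * (w.scaleUnit H l x : ℂ) =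
    (w.scaleUnit H l x : ℂ) * (if i ∈ x.2 then 0 else ferSign i x.2)
  exact mul_comm _ _

/-- `V` is the tensor product of the Fock space of `k`-fermions and that of bosons and fermions, by
`|m, s⟩ ↦ λ(m) |m mod k⟩ ⊗ |m / k, s⟩`. -/
theorem fockSplits_lim : FockSplits q k (w.limAm : Fin (l + 1) → Op l) w.limAp ferM ferP
    (w.chiM w.limAm w.limAp) (w.chiP w.limAm w.limAp) (chiN k w.limAm w.limAp) := by
  refine ⟨splitEquiv H.k_pos (w.scaleUnit H l), fun i v => ⟨?_, ?_, ?_, w.split_limAm H i v,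
    w.split_limAp H i v, w.split_ferM H i v, w.split_ferP H i v⟩⟩
  · rw [w.chiM_eq H, w.split_chiM H]
  · rw [w.chiP_eq H, w.split_chiP H]
  · rw [w.chiN_eq H, w.split_chiN H]

end RootBranch

/-! ### Continuity of the realization at the root of unity -/

section ShiftLim

variable {B : Type*}

/-- A family of weighted shifts along one map, with weights that converge at `q` to their values. -/
def ShiftLim (F : ℂ → Module.End ℂ (B →₀ ℂ)) (q : ℂ) : Prop :=
  ∃ (f : B → B) (c : ℂ → B → ℂ), (∀ Q, F Q = wShift f (c Q)) ∧
    ∀ x, Tendsto (fun Q => c Q x) (𝓝[≠] q) (𝓝 (c q x))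

variable {F G : ℂ → Module.End ℂ (B →₀ ℂ)} {q : ℂ}

theorem ShiftLim.hasOpLim (hF : ShiftLim F q) : HasOpLim F q (F q) := by
  obtain ⟨f, c, h1, h2⟩ := hF
  rw [h1 q, show F = fun Q => wShift f (c Q) from funext h1]
  exact hasOpLim_wShift h2

theorem ShiftLim.mul (hF : ShiftLim F q) (hG : ShiftLim G q) :
    ShiftLim (fun Q => F Q * G Q) q := by
  obtain ⟨f, c, h1, h2⟩ := hF
  obtain ⟨g, d, h3, h4⟩ := hG
  exact ⟨f ∘ g, fun Q x => d Q x * c Q (g x), fun Q => by dsimp only; rw [h1, h3, wShift_mul],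
    fun x => (h4 x).mul (h2 _)⟩

theorem shiftLim_const (f : B → B) (c : B → ℂ) (q : ℂ) : ShiftLim (fun _ => wShift f c) q :=
  ⟨f, fun _ => c, fun _ => rfl, fun _ => tendsto_const_nhds⟩

theorem shiftLim_opPow {T : Module.End ℂ (B →₀ ℂ)} (hT : IsDiag T) (hq : q ∈ Complex.slitPlane) :
    ShiftLim (fun Q => opPow Q T) q := by
  obtain ⟨c, rfl⟩ := hT
  exact ⟨id, fun Q x => Q ^ c x, fun Q => opPow_diagOp Q c,
    fun x => (continuousAt_cpow_const hq).tendsto.mono_left nhdsWithin_le_nhds⟩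

end ShiftLim

namespace RootBranch

variable {q : ℂ} {k : ℕ} (w : RootBranch q k) {l : ℕ} (H : IsRootDatum q k)

include H

theorem shiftLim_Am (i : Fin (l + 1)) : ShiftLim (fun Q => w.Am Q i) q := by
  refine ⟨_, fun Q x => if x.1 i = 0 then 0 else w.w (x.1 i) Q, fun _ => rfl, fun x => ?_⟩
  dsimp only
  split_ifs
  · exact tendsto_const_nhds
  · exact w.tendsto_w H _

theorem shiftLim_Ap (i : Fin (l + 1)) : ShiftLim (fun Q => w.Ap Q i) q :=
  ⟨_, fun Q x => w.w (x.1 i + 1) Q, fun _ => rfl, fun _ => w.tendsto_w H _⟩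

theorem hasOpLim_realization (g : QPGen l) :
    HasOpLim (fun Q => w.realization Q g) q (w.realization q g) := by
  have hf : ∀ i j : Fin (l + 1), ShiftLim (fun _ => ferP i * ferM j) q := fun i j => by
    rw [ferP, ferM]; exact (shiftLim_const _ _ _).mul (shiftLim_const _ _ _)
  have hT : ∀ i : Fin l, IsDiag (numB i.castSucc - numB i.succ + numF i.castSucc - numF i.succ) :=
    fun i => (((isDiag_numB _).sub (isDiag_numB _)).add (isDiag_numF _)).sub (isDiag_numF _)
  cases g with
  | X j =>
    refine Fin.lastCases ?_ (fun i => ?_) j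
    · simp only [realization, Fin.snoc_last]
      refine ShiftLim.hasOpLim (F := fun Q => w.Ap Q (Fin.last l) * ferP (Fin.last l) *
        opPow Q (halfG l)) (((w.shiftLim_Ap H _).mul ?_).mul (shiftLim_opPow isDiag_halfG H.slit))
      rw [ferP]; exact shiftLim_const _ _ _
    · simp only [realization, Fin.snoc_castSucc]
      exact (((w.shiftLim_Ap H _).mul (w.shiftLim_Am H _)).mul
        (shiftLim_opPow (isDiag_halfM i) H.slit)).hasOpLim.add
        ((hf _ _).mul (shiftLim_opPow (isDiag_halfN i) H.slit)).hasOpLim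
  | Y i =>
    exact (((w.shiftLim_Ap H _).mul (w.shiftLim_Am H _)).mul
        (shiftLim_opPow (isDiag_halfM i) H.slit)).hasOpLim.add
        ((hf _ _).mul (shiftLim_opPow (isDiag_halfN i) H.slit)).hasOpLim
  | T i => exact hasOpLim_const _ _
  | D => exact hasOpLim_const _ _
  | K i => exact (shiftLim_opPow (hT i) H.slit).hasOpLim
  | Kinv i => exact (shiftLim_opPow (hT i).neg H.slit).hasOpLim

end RootBranch

/-! ### Tensor products of operator algebras -/

section Tensor

variable {V V₁ V₂ : Type*} [AddCommGroup V] [Module ℂ V] [AddCommGroup V₁] [Module ℂ V₁]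
  [AddCommGroup V₂] [Module ℂ V₂] (Θ : V ≃ₗ[ℂ] V₁ ⊗[ℂ] V₂)

/-- The operators on `V ≃ V₁ ⊗ V₂` that act on the first factor only. -/
def leftOps : Subalgebra ℂ (Module.End ℂ V) where
  carrier := {T | ∃ S : Module.End ℂ V₁, ∀ v, Θ (T v) = S.rTensor V₂ (Θ v)}
  mul_mem' := by
    rintro T T' ⟨S, h⟩ ⟨S', h'⟩
    refine ⟨S * S', fun v => ?_⟩
    rw [Module.End.mul_apply, h, h', Module.End.mul_eq_comp, LinearMap.rTensor_comp_apply]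
  add_mem' := by
    rintro T T' ⟨S, h⟩ ⟨S', h'⟩
    refine ⟨S + S', fun v => ?_⟩
    rw [LinearMap.add_apply, map_add, h, h', LinearMap.rTensor_add, LinearMap.add_apply]
  algebraMap_mem' r := by
    refine ⟨algebraMap ℂ _ r, fun v => ?_⟩
    rw [Algebra.algebraMap_eq_smul_one, Algebra.algebraMap_eq_smul_one, LinearMap.smul_apply,
      map_smul, LinearMap.rTensor_smul, LinearMap.smul_apply, Module.End.one_apply,
      show (1 : Module.End ℂ V₁) = LinearMap.id from rfl, LinearMap.rTensor_id, LinearMap.id_apply]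

/-- The operators on `V ≃ V₁ ⊗ V₂` that act on the second factor only. -/
def rightOps : Subalgebra ℂ (Module.End ℂ V) where
  carrier := {T | ∃ S : Module.End ℂ V₂, ∀ v, Θ (T v) = S.lTensor V₁ (Θ v)}
  mul_mem' := by
    rintro T T' ⟨S, h⟩ ⟨S', h'⟩
    refine ⟨S * S', fun v => ?_⟩
    rw [Module.End.mul_apply, h, h', Module.End.mul_eq_comp, LinearMap.lTensor_comp_apply]
  add_mem' := by
    rintro T T' ⟨S, h⟩ ⟨S', h'⟩
    refine ⟨S + S', fun v => ?_⟩
    rw [LinearMap.add_apply, map_add, h, h', LinearMap.lTensor_add, LinearMap.add_apply]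
  algebraMap_mem' r := by
    refine ⟨algebraMap ℂ _ r, fun v => ?_⟩
    rw [Algebra.algebraMap_eq_smul_one, Algebra.algebraMap_eq_smul_one, LinearMap.smul_apply,
      map_smul, LinearMap.lTensor_smul, LinearMap.smul_apply, Module.End.one_apply,
      show (1 : Module.End ℂ V₂) = LinearMap.id from rfl, LinearMap.lTensor_id, LinearMap.id_apply]

variable {Θ}

theorem commute_of_mem_ops {S T : Module.End ℂ V} (hS : S ∈ leftOps Θ) (hT : T ∈ rightOps Θ) :
    Commute S T := by
  obtain ⟨S', hS⟩ := hS
  obtain ⟨T', hT⟩ := hT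
  refine LinearMap.ext fun v => Θ.injective ?_
  rw [Module.End.mul_apply, Module.End.mul_apply, hS, hT, hT, hS, ← LinearMap.comp_apply,
    ← LinearMap.comp_apply, LinearMap.rTensor_comp_lTensor, LinearMap.lTensor_comp_rTensor]

/-- Linearly independent operators on the second factor stay independent when their coefficients
are operators on the first factor: apply a functional to the first factor of the values. -/
theorem eq_zero_of_mem_ops {U P : Subalgebra ℂ (Module.End ℂ V)} (hU : U ≤ leftOps Θ)
    (hP : P ≤ rightOps Θ) {f : U ⊗[ℂ] P →ₗ[ℂ] Module.End ℂ V}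
    (hf : ∀ (u : U) (p : P), f (u ⊗ₜ[ℂ] p) = (u : Module.End ℂ V) * (p : Module.End ℂ V))
    {z : U ⊗[ℂ] P} (hz : f z = 0) : z = 0 := by
  classical
  let b := Module.Free.chooseBasis ℂ P
  obtain ⟨c, rfl⟩ := TensorProduct.eq_repr_basis_right b z
  choose S hS using fun u : U => hU u.2
  choose T hT using fun p : P => hP p.2
  -- evaluate the operator on pure tensors
  have key (v₁ : V₁) (v₂ : V₂) : ∑ j ∈ c.support, S (c j) v₁ ⊗ₜ[ℂ] T (b j) v₂ = 0 := by
    have e := congrArg (fun F : Module.End ℂ V => Θ (F (Θ.symm (v₁ ⊗ₜ[ℂ] v₂)))) hz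
    simp only [Finsupp.sum, map_sum, hf, LinearMap.sum_apply, Module.End.mul_apply, hS, hT,
      LinearEquiv.apply_symm_apply, LinearMap.lTensor_tmul, LinearMap.rTensor_tmul,
      LinearMap.zero_apply, map_zero] at e
    exact e
  have hc : ∀ j ∈ c.support, c j = 0 := by
    intro j hj
    have hSj : S (c j) = 0 := by
      refine LinearMap.ext fun v₁ => ?_
      rw [LinearMap.zero_apply, ← Module.forall_dual_apply_eq_zero_iff ℂ]
      intro g
      -- applying `g` to the first factor leaves a linear relation between the `b j`
      have hlin : ∑ j ∈ c.support, g (S (c j) v₁) • b j = 0 := by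
        refine Subtype.ext (LinearMap.ext fun v => Θ.injective ?_)
        have hT0 : ∑ j ∈ c.support, g (S (c j) v₁) • T (b j) = 0 := by
          refine LinearMap.ext fun v₂ => ?_
          have e := congrArg (fun t => TensorProduct.lid ℂ V₂ (g.rTensor V₂ t)) (key v₁ v₂)
          simp only [map_sum, LinearMap.rTensor_tmul, TensorProduct.lid_tmul, map_zero] at e
          simpa [LinearMap.sum_apply] using e
        have e := congrArg (fun F : Module.End ℂ V₂ => LinearMap.lTensorHom V₁ F (Θ v)) hT0
        simp only [map_sum, map_smul, LinearMap.sum_apply, LinearMap.smul_apply, map_zero,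
          LinearMap.zero_apply, LinearMap.coe_lTensorHom] at e
        simp only [AddSubmonoidClass.coe_finsetSum, Subalgebra.coe_smul, LinearMap.sum_apply,
          LinearMap.smul_apply, map_sum, map_smul, hT, ZeroMemClass.coe_zero,
          LinearMap.zero_apply, map_zero]
        exact e
      exact linearIndependent_iff'.1 b.linearIndependent c.support _ hlin j hj
    refine Subtype.ext (LinearMap.ext fun v => Θ.injective ?_)
    rw [hS, hSj]
    simp
  exact Finset.sum_eq_zero fun j hj => by
    dsimp only; rw [hc j hj, TensorProduct.zero_tmul]

/-- Algebras of operators on different factors of a tensor product generate their tensor product. -/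
theorem isInternalTensor_of_mem_ops {U P : Subalgebra ℂ (Module.End ℂ V)} (hU : U ≤ leftOps Θ)
    (hP : P ≤ rightOps Θ) : IsInternalTensor U P (U ⊔ P) := by
  have hcomm : ∀ u ∈ U, ∀ p ∈ P, Commute u p := fun u hu p hp =>
    commute_of_mem_ops (hU hu) (hP hp)
  refine ⟨hcomm, ?_⟩
  let f : U ⊗[ℂ] P →ₐ[ℂ] Module.End ℂ V :=
    Algebra.TensorProduct.lift U.val P.val fun u p => hcomm _ u.2 _ p.2
  have hf : ∀ (u : U) (p : P), f (u ⊗ₜ[ℂ] p) = (u : Module.End ℂ V) * (p : Module.End ℂ V) :=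
    fun u p => Algebra.TensorProduct.lift_tmul _ _ _ _ _
  have hinj : Function.Injective f := by
    intro x y hxy
    have hy : (-1 : ℂ) • y + y = 0 := by
      nth_rw 2 [← one_smul ℂ y]
      rw [← add_smul, neg_add_cancel, zero_smul]
    have hz : f.toLinearMap (x + (-1 : ℂ) • y) = 0 := by
      rw [map_add, map_smul, AlgHom.toLinearMap_apply, AlgHom.toLinearMap_apply, hxy, neg_smul,
        one_smul, add_neg_cancel]
    have h0 := eq_zero_of_mem_ops hU hP hf hz
    rw [← add_zero x, ← hy, ← add_assoc, h0, zero_add]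
  have hrange : f.range = U ⊔ P := by
    refine le_antisymm ?_ (sup_le (fun u hu => ⟨⟨u, hu⟩ ⊗ₜ 1, ?_⟩) fun p hp => ⟨1 ⊗ₜ ⟨p, hp⟩, ?_⟩)
    · rintro _ ⟨z, rfl⟩
      induction z using TensorProduct.induction_on with
      | zero => exact (map_zero f.toRingHom).symm ▸ zero_mem _
      | tmul u p =>
        refine (hf u p).symm ▸ mul_mem ?_ ?_
        · exact (le_sup_left : U ≤ U ⊔ P) u.2
        · exact (le_sup_right : P ≤ U ⊔ P) p.2
      | add x y hx hy => exact (map_add f.toRingHom x y).symm ▸ add_mem hx hy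
    · exact (hf _ _).trans (mul_one _)
    · exact (hf _ _).trans (one_mul _)
  refine ⟨(AlgEquiv.ofInjective f hinj).trans (Subalgebra.equivOfEq _ _ hrange), fun u p => ?_⟩
  exact hf u p

end Tensor

/-! ### The classical limit -/

section Classical

variable {A : Type*} [Ring A] [Algebra ℂ A] {l : ℕ} {am ap fm fp : Fin (l + 1) → A}

/-- Ordinary bosons and fermions as a system of oscillators with trivial dressing factors. -/
def classicalSystem (hb : IsBosons am ap) (hf : IsFermions fm fp)
    (hm : ∀ i j, Commute (am i) (fm j) ∧ Commute (am i) (fp j) ∧ Commute (ap i) (fm j) ∧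
      Commute (ap i) (fp j)) : OscSystem A l 1 where
  bm := am
  bp := ap
  fm := fm
  fp := fp
  Nb i := ap i * am i
  m _ := 1
  n _ := 1
  G := 1
  h_ne := one_ne_zero
  bosonic := by rw [one_pow]; exact hb.isBosonic
  fermions := hf
  mixed := hm
  num_bm i j := by
    by_cases h : j = i
    · subst h
      rw [if_pos rfl, HasWt, neg_one_smul]
      exact hb.num_minus j
    · rw [if_neg h]
      exact (HasWt.of_commute (.mul_left (hb.isBosonic.comm j i h).2.2.symm
        (hb.comm_minus i j))).congr neg_zero.symm
  num_bp i j := by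
    by_cases h : j = i
    · subst h
      rw [if_pos rfl, HasWt, one_smul]
      exact hb.num_plus j
    · rw [if_neg h]
      exact HasWt.of_commute (.mul_left (hb.comm_plus i j) (hb.isBosonic.comm i j (Ne.symm h)).2.2)
  num_f i j := ⟨.mul_left (hm i j).2.2.1 (hm i j).1, .mul_left (hm i j).2.2.2 (hm i j).2.1⟩
  diag := by
    have hN : ∀ i j, Commute (ap i * am i) (ap j * am j) := fun i j => by
      by_cases h : i = j
      · rw [h]
      · exact .mul_left (.mul_right (hb.comm_plus i j) (hb.isBosonic.comm j i (Ne.symm h)).2.2.symm)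
          (.mul_right (hb.isBosonic.comm i j h).2.2 (hb.comm_minus i j))
    rintro x (((⟨i, rfl⟩ | ⟨i, rfl⟩) | ⟨i, rfl⟩) | rfl) y (((⟨j, rfl⟩ | ⟨j, rfl⟩) | ⟨j, rfl⟩) | rfl)
    · exact hN i j
    all_goals first | exact Commute.one_left _ | exact Commute.one_right _
  m_b i j := ⟨.one_left _, .one_left _⟩
  m_fm i j := by simp [QComm]
  m_fp i j := by simp [QComm]
  n_f i j := ⟨.one_left _, .one_left _⟩
  n_bm i j := by simp [QComm]
  n_bp i j := by simp [QComm]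
  G_bm j := by simp [QComm]
  G_bp j := by simp [QComm]
  G_fm j := by simp [QComm]
  G_fp j := by simp [QComm]

theorem IsBosons.bilinear_commutator (hb : IsBosons am ap) {i j : Fin (l + 1)} (h : i ≠ j) :
    ap i * am j * (ap j * am i) - ap j * am i * (ap i * am j) = ap i * am i - ap j * am j := by
  have e1 : am j * ap j = 1 + ap j * am j := sub_eq_iff_eq_add.1 ((hb.rel j j).trans (if_pos rfl))
  have e2 : am i * ap i = 1 + ap i * am i := sub_eq_iff_eq_add.1 ((hb.rel i i).trans (if_pos rfl))
  have c : Commute (ap i * am i) (ap j * am j) :=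
    .mul_left (.mul_right (hb.comm_plus i j) (hb.isBosonic.comm j i (Ne.symm h)).2.2.symm)
      (.mul_right (hb.isBosonic.comm i j h).2.2 (hb.comm_minus i j))
  have c1 : Commute (ap j * am j) (am i) :=
    .mul_left (hb.isBosonic.comm i j h).2.2.symm (hb.comm_minus j i)
  have c2 : Commute (ap i * am i) (am j) :=
    .mul_left (hb.isBosonic.comm j i (Ne.symm h)).2.2.symm (hb.comm_minus i j)
  have f1 : ap i * am j * (ap j * am i) = ap i * am i + ap i * am i * (ap j * am j) := by
    rw [mul_assoc, ← mul_assoc (am j), e1, add_mul, one_mul, mul_add, c1.eq, ← mul_assoc]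
  have f2 : ap j * am i * (ap i * am j) = ap j * am j + ap j * am j * (ap i * am i) := by
    rw [mul_assoc, ← mul_assoc (am i), e2, add_mul, one_mul, mul_add, c2.eq, ← mul_assoc]
  rw [f1, f2, c.eq, add_sub_add_right_eq_sub]

/-- The realization of `P̃(n)` by ordinary bosons and fermions. -/
theorem exists_classical (hb : IsBosons am ap) (hf : IsFermions fm fp)
    (hm : ∀ i j, Commute (am i) (fm j) ∧ Commute (am i) (fp j) ∧ Commute (ap i) (fm j) ∧
      Commute (ap i) (fp j)) :
    ∃ σ : UStrange l →ₐ[ℂ] A, ∀ g, σ (UStrange.gen g) = classicalGen am ap fm fp g := by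
  obtain ⟨σ, hX, hY, hT, hD⟩ := (classicalSystem hb hf hm).exists_strange (one_pow 2) fun i => by
    rw [OscSystem.Xe_Y_self]
    have e := hb.bilinear_commutator i.castSucc_lt_succ.ne
    simp only [classicalSystem, OscSystem.T, OscSystem.Nf, mul_one] at e ⊢
    rw [e, add_sub_assoc]
  refine ⟨σ, fun g => ?_⟩
  cases g with
  | X j =>
    rw [hX, classicalGen]
    refine Fin.lastCases ?_ (fun j => ?_) j
    · rw [OscSystem.X_last, Fin.snoc_last]
      simp [OscSystem.Xo, classicalSystem]
    · rw [OscSystem.X_castSucc, Fin.snoc_castSucc]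
      simp [OscSystem.Xe, classicalSystem]
  | Y i => rw [hY]; simp [OscSystem.Y, classicalSystem, classicalGen]
  | T i => rw [hT]; rfl
  | D => rw [hD]; rfl

/-- All generators except `X_n` are combinations of `a_i⁺ a_j⁻` and `φ_i⁺ φ_j⁻`. -/
theorem commute_classicalGen {p : A} (hb : ∀ i j, Commute p (ap i * am j))
    (hf : ∀ i j, Commute p (fp i * fm j)) {g : PGen l} (hg : g ≠ PGen.X (Fin.last l)) :
    Commute p (classicalGen am ap fm fp g) := by
  cases g with
  | X j =>
    obtain ⟨j, rfl⟩ := Fin.eq_castSucc_of_ne_last (x := j) fun h => hg (by rw [h])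
    rw [classicalGen, Fin.snoc_castSucc]
    exact (hb _ _).add_right (hf _ _)
  | Y i => exact (hb _ _).add_right (hf _ _)
  | T i => exact (((hb _ _).sub_right (hb _ _)).add_right (hf _ _)).sub_right (hf _ _)
  | D =>
    exact ((Commute.sum_right _ _ _ fun i _ => hb i i).smul_right (1 / 2 : ℂ)).add_right
      ((Commute.sum_right _ _ _ fun i _ => hf i i).smul_right (1 / 2 : ℂ))

end Classical

namespace RootBranch

variable {q : ℂ} {k : ℕ} (w : RootBranch q k) {l : ℕ}

theorem lim_commute_fer (i j : Fin (l + 1)) : Commute (w.limAm i) (ferM j) ∧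
    Commute (w.limAm i) (ferP j) ∧ Commute (w.limAp i) (ferM j) ∧ Commute (w.limAp i) (ferP j) := by
  rw [ferM_eq, ferP_eq]
  exact ⟨modeOp_commute_spinOp _ _ _ _ _, modeOp_commute_spinOp _ _ _ _ _,
    modeOp_commute_spinOp _ _ _ _ _, modeOp_commute_spinOp _ _ _ _ _⟩

variable (H : IsRootDatum q k)

include H

/-- The realization of `U_q(sl(n))` by `k`-fermions. -/
theorem exists_uqSl_lim : ∃ π : UqSl l q →ₐ[ℂ] Op l, ∀ g, π (UqSl.gen q g) =
    kFermionGen q (w.chiM w.limAm w.limAp) (w.chiP w.limAm w.limAp) (chiN k w.limAm w.limAp) g := by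
  let N : Fin (l + 1) → Op l := fun i => diagOp fun x : Occ l => ((x.1 i % k : ℕ) : ℂ)
  have hN : ∀ i, IsDiag (N i) := fun i => ⟨_, rfl⟩
  have hH := w.isKFermions_lim (l := l) H
  have e1 : (w.chiM w.limAm w.limAp : Fin (l + 1) → Op l) = bosM w.chiW := funext (w.chiM_eq H)
  have e2 : (w.chiP w.limAm w.limAp : Fin (l + 1) → Op l) = bosP w.chiW := funext (w.chiP_eq H)
  have e3 : (chiN k w.limAm w.limAp : Fin (l + 1) → Op l) = N := funext (w.chiN_eq H)
  rw [e1, e2, e3] at hH ⊢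
  have hb : IsBosonic q (bosM w.chiW : Fin (l + 1) → Op l) (bosP w.chiW) :=
    { comm := fun i j h => ⟨(hH.comm i j h).1, (hH.comm i j h).2.1, (hH.comm i j h).2.2.1⟩
      cubic_minus := fun i => serre_neg_one_of_osc_minus H.q_ne (hH.rel_plus i)
        (((hN i).qcomm_opPow H.q_ne (w.hasWt_chi H i i).1).congr
          (by rw [if_pos rfl, Complex.cpow_neg_one]))
      cubic_plus := fun i => serre_neg_one_of_osc_plus H.q_ne (hH.rel_plus i)
        (((hN i).qcomm_opPow H.q_ne (w.hasWt_chi H i i).2).congr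
          (by rw [if_pos rfl, Complex.cpow_one])) }
  have hd : ∀ i : Fin l, IsDiag (-N i.castSucc + N i.succ) := fun i => (hN _).neg.add (hN _)
  obtain ⟨π, hE, hF, hK, hK'⟩ := exists_uqSl (l := l) hb
    (fun i => opPow q (-N i.castSucc + N i.succ)) (fun i => opPow q (-(-N i.castSucc + N i.succ)))
    (fun i => ((hd i).opPow_mul_neg H.q_ne).1) (fun i => ((hd i).opPow_mul_neg H.q_ne).2)
    (fun i j => (isDiag_opPow _ _).commute (isDiag_opPow _ _))
    (fun i j => ((hd i).qcomm_opPow H.q_ne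
      ((w.hasWt_chi H _ j).1.neg_left.add_left (w.hasWt_chi H _ j).1)).congr (by
        rw [← Complex.cpow_intCast, rootCoeff_cast]; congr 1; ring))
    (fun i j => ((hd i).qcomm_opPow H.q_ne
      ((w.hasWt_chi H _ j).2.neg_left.add_left (w.hasWt_chi H _ j).2)).congr (by
        rw [← Complex.cpow_intCast, Int.cast_neg, rootCoeff_cast]; congr 1; ring)) H.q_ne
    (fun i => by
      have hne := i.castSucc_lt_succ.ne
      have hsq : ∀ m, w.chiW m ^ 2 = qInt q (m % k) := w.chiW_sq H
      have c := (bosM_commute_bosP hne w.chiW w.chiW).eq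
      rw [c, bilinear_bos_mul hsq (by simp [qInt_zero]) hne.symm,
        bilinear_bos_mul hsq (by simp [qInt_zero]) hne]
      simp only [N, qInt_mod_succ H, qInt_mul_sub H.q_ne H.sq_ne, neg_diagOp, diagOp_add,
        opPow_diagOp, diagOp_sub, smul_diagOp]
      congr 1; ext x
      rw [neg_add, neg_neg, Complex.cpow_add _ _ H.q_ne, Complex.cpow_add _ _ H.q_ne,
        Complex.cpow_neg, Complex.cpow_neg, Complex.cpow_natCast, Complex.cpow_natCast,
        inv_pow, inv_pow]
      ring)
  refine ⟨π, fun g => ?_⟩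
  cases g with
  | E i => exact hE i
  | F i => exact hF i
  | K i => exact hK i
  | Kinv i => exact hK' i

end RootBranch

/-! ### The grading by fermion parity -/

section Parity

variable {l : ℕ}

theorem parity_commute_modeOp (i : Fin (l + 1)) (f c) : Commute (parity l) (modeOp i f c) := by
  rw [parity_eq]; exact (modeOp_commute_spinOp i f c _ _).symm

theorem parity_fer (i : Fin (l + 1)) : QComm (-1) (parity l) (ferM i) ∧
    QComm (-1) (parity l) (ferP i) := by
  rw [parity_eq, ferM_eq, ferP_eq, QComm, QComm, spinOp_mul, spinOp_mul, spinOp_mul, spinOp_mul,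
    spinOp, spinOp, spinOp, spinOp, smul_wShift, smul_wShift]
  refine ⟨wShift_congr (fun x => ?_) fun x _ => rfl, wShift_congr (fun x => ?_) fun x _ => rfl⟩
  · by_cases h : i ∈ x.2
    · have e := Finset.card_erase_add_one h
      simp only [h, if_true, id]
      rw [← e, pow_succ]; ring
    · simp [h]
  · by_cases h : i ∈ x.2
    · simp [h]
    · simp only [h, if_false, id]
      rw [Finset.card_insert_of_notMem h, pow_succ]; ring

end Parity

namespace RootBranch

variable {q : ℂ} {k : ℕ} (w : RootBranch q k) {l : ℕ}

theorem parity_commute_classicalGen {g : PGen l} (hg : g ≠ PGen.X (Fin.last l)) :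
    Commute (parity l) (classicalGen w.limAm w.limAp ferM ferP g) := by
  have hb : ∀ i j : Fin (l + 1), Commute (parity l) (w.limAp i * w.limAm j) := fun i j =>
    .mul_right (parity_commute_modeOp _ _ _) (parity_commute_modeOp _ _ _)
  have hf : ∀ i j : Fin (l + 1), Commute (parity l) (ferP i * ferM j) := fun i j =>
    (((parity_fer i).2.mul_right (parity_fer j).1).congr (by norm_num)).commute
  exact commute_classicalGen hb hf hg

theorem parity_anticommute_classicalGen :
    QComm (-1) (parity l) (classicalGen w.limAm w.limAp ferM ferP (PGen.X (Fin.last l))) := by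
  rw [classicalGen, Fin.snoc_last]
  exact ((QComm.of_commute (parity_commute_modeOp _ _ _)).mul_right (parity_fer _).2).congr
    (one_mul _)

variable (H : IsRootDatum q k)

include H

theorem parity_commute_kFermionGen (g : UqGen l) :
    Commute (parity l) (kFermionGen q (w.chiM w.limAm w.limAp) (w.chiP w.limAm w.limAp)
      (chiN k w.limAm w.limAp) g) := by
  have hm : ∀ i : Fin (l + 1), Commute (parity l) (w.chiM w.limAm w.limAp i) := fun i => by
    rw [w.chiM_eq H, bosM_eq]; exact parity_commute_modeOp _ _ _
  have hp : ∀ i : Fin (l + 1), Commute (parity l) (w.chiP w.limAm w.limAp i) := fun i => by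
    rw [w.chiP_eq H, bosP_eq]; exact parity_commute_modeOp _ _ _
  have hd : ∀ T : Op l, Commute (parity l) (opPow q T) := fun T => by
    rw [parity, opPow]; exact diagOp_commute _ _
  cases g with
  | E i => exact (hm _).mul_right (hp _)
  | F i => exact (hp _).mul_right (hm _)
  | K i => exact hd _
  | Kinv i => exact hd _

end RootBranch

/-! ### The matrix Lie superalgebra -/

section Strange

open Matrix

/-- The super bracket in block form. -/
theorem superBracket_fromBlocks {n : ℕ} (N S R N' S' R' : Matrix (Fin n) (Fin n) ℂ) :
    superBracket (fromBlocks N S R (-Nᵀ)) (fromBlocks N' S' R' (-N'ᵀ)) =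
      fromBlocks (N * N' - N' * N + (S * R' + S' * R)) (N * S' + S' * Nᵀ - (N' * S + S * N'ᵀ))
        (N'ᵀ * R + R * N' - (Nᵀ * R' + R' * N)) (Nᵀ * N'ᵀ - N'ᵀ * Nᵀ + (R * S' + R' * S)) := by
  rw [superBracket, oddPart, oddPart, two_mul]
  simp only [toBlocks_fromBlocks₁₂, toBlocks_fromBlocks₂₁, fromBlocks_multiply, sub_eq_add_neg,
    fromBlocks_neg, fromBlocks_add, fromBlocks_inj]
  refine ⟨?_, ?_, ?_, ?_⟩ <;> noncomm_ring

theorem IsStrange.eq_fromBlocks {n : ℕ} {M : SMat n} (h : IsStrange M) :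
    M = fromBlocks M.toBlocks₁₁ M.toBlocks₁₂ M.toBlocks₂₁ (-M.toBlocks₁₁ᵀ) := by
  rw [h.1, neg_neg, fromBlocks_toBlocks]

theorem isStrange_fromBlocks {n : ℕ} {N S R T : Matrix (Fin n) (Fin n) ℂ} :
    IsStrange (fromBlocks N S R T) ↔ Nᵀ = -T ∧ Sᵀ = S ∧ Rᵀ = -R := by
  simp [IsStrange]

theorem IsStrange.superBracket {n : ℕ} {M M' : SMat n} (h : IsStrange M) (h' : IsStrange M') :
    IsStrange (superBracket M M') := by
  rw [h.eq_fromBlocks, h'.eq_fromBlocks, superBracket_fromBlocks, isStrange_fromBlocks]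
  obtain ⟨-, hS, hR⟩ := h
  obtain ⟨-, hS', hR'⟩ := h'
  refine ⟨?_, ?_, ?_⟩ <;>
    simp only [transpose_add, transpose_sub, transpose_mul, transpose_transpose, hS, hR, hS', hR']
      <;> noncomm_ring

theorem isStrange_chevalleyMatrix {l : ℕ} (g : PGen l) : IsStrange (chevalleyMatrix g) := by
  cases g with
  | X j =>
    rw [chevalleyMatrix]
    refine Fin.lastCases ?_ (fun j => ?_) j
    · rw [Fin.snoc_last]; simp [isStrange_fromBlocks]
    · rw [Fin.snoc_castSucc]; simp [isStrange_fromBlocks]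
  | Y i => simp [chevalleyMatrix, isStrange_fromBlocks]
  | T i => simp [chevalleyMatrix, isStrange_fromBlocks]
  | D => simp [chevalleyMatrix, isStrange_fromBlocks]

variable {A ι : Type*} [Ring A] [Algebra ℂ A] [Fintype ι] [DecidableEq ι]

/-- The quadratic expression `∑ N_ij x_i y_j`. -/
noncomputable def quad (x y : ι → A) : Matrix ι ι ℂ →ₗ[ℂ] A where
  toFun N := ∑ i, ∑ j, N i j • (x i * y j)
  map_add' N N' := by simp only [Matrix.add_apply, add_smul, Finset.sum_add_distrib]
  map_smul' c N := by
    simp only [Matrix.smul_apply, smul_assoc, Finset.smul_sum, RingHom.id_apply]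

omit [DecidableEq ι] in
theorem quad_apply (x y : ι → A) (N : Matrix ι ι ℂ) :
    quad x y N = ∑ i, ∑ j, N i j • (x i * y j) := rfl

theorem quad_single (x y : ι → A) (i j : ι) (c : ℂ) :
    quad x y (single i j c) = c • (x i * y j) := by
  rw [quad_apply, Finset.sum_eq_single i, Finset.sum_eq_single j]
  · simp
  · intro b _ hb; simp [hb.symm]
  · simp
  · intro b _ hb; simp [hb.symm]
  · simp

theorem quad_one (x y : ι → A) : quad x y 1 = ∑ i, x i * y i := by
  simp [quad_apply, Matrix.one_apply]

theorem single_mul_single (i j k l : ι) (c d : ℂ) :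
    single i j c * single k l d = if j = k then single i l (c * d) else 0 := by
  split_ifs with h
  · subst h; exact single_mul_single_same ..
  · exact single_mul_single_of_ne (h := h) ..

section Quadratic

variable {am ap fm fp : ι → A}

variable (am ap fm fp) in
/-- The even quadratic expressions `∑ N_ij (a_i⁺ a_j⁻ + φ_i⁺ φ_j⁻)`. -/
noncomputable def quadN : Matrix ι ι ℂ →ₗ[ℂ] A := quad ap am + quad fp fm

omit [DecidableEq ι] in
theorem quadN_apply (N : Matrix ι ι ℂ) : quadN am ap fm fp N = quad ap am N + quad fp fm N := rfl

theorem quadN_single (i j : ι) (c : ℂ) :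
    quadN am ap fm fp (single i j c) = c • (ap i * am j + fp i * fm j) := by
  rw [quadN_apply, quad_single, quad_single, smul_add]

omit [Algebra ℂ A] in
theorem commutator_mul (g x y : A) :
    g * (x * y) - x * y * g = (g * x - x * g) * y + x * (g * y - y * g) := by noncomm_ring

variable (hb : IsBosons am ap) (hf : IsFermions fm fp)
  (hm : ∀ i j, Commute (am i) (fm j) ∧ Commute (am i) (fp j) ∧ Commute (ap i) (fm j) ∧
    Commute (ap i) (fp j))

include hb hf hm

omit [Algebra ℂ A] [Fintype ι] in
/-- The even quadratic expressions act on the oscillators by matrices. -/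
theorem unit_commutator (i j k : ι) :
    ((ap i * am j + fp i * fm j) * ap k - ap k * (ap i * am j + fp i * fm j) =
      if j = k then ap i else 0) ∧
    ((ap i * am j + fp i * fm j) * am k - am k * (ap i * am j + fp i * fm j) =
      if k = i then -am j else 0) ∧
    ((ap i * am j + fp i * fm j) * fp k - fp k * (ap i * am j + fp i * fm j) =
      if j = k then fp i else 0) ∧
    ((ap i * am j + fp i * fm j) * fm k - fm k * (ap i * am j + fp i * fm j) =
      if k = i then -fm j else 0) := by
  refine ⟨?_, ?_, ?_, ?_⟩
  · have e1 := hb.rel j k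
    have e2 : Commute (fp i * fm j) (ap k) := .mul_left (hm k i).2.2.2.symm (hm k j).2.2.1.symm
    rw [add_mul, mul_add, e2.eq, add_sub_add_right_eq_sub, mul_assoc, sub_eq_iff_eq_add.1 e1,
      mul_add, ← mul_assoc (ap k), (hb.comm_plus k i).eq, mul_assoc, add_sub_cancel_right]
    split_ifs <;> simp
  · have e1 := hb.rel k i
    have e2 : Commute (fp i * fm j) (am k) := .mul_left (hm k i).2.1.symm (hm k j).1.symm
    rw [add_mul, mul_add, e2.eq, add_sub_add_right_eq_sub, ← mul_assoc (am k),
      sub_eq_iff_eq_add.1 e1, add_mul, mul_assoc, mul_assoc, (hb.comm_minus k j).eq,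
      sub_add_cancel_right]
    split_ifs <;> simp
  · have e1 := hf.rel j k
    have e3 := hf.anti_plus k i
    have e2 : Commute (ap i * am j) (fp k) := .mul_left (hm i k).2.2.2 (hm j k).2.1
    rw [add_mul, mul_add, e2.eq, add_sub_add_left_eq_sub, mul_assoc, eq_sub_iff_add_eq.2 e1,
      mul_sub, ← mul_assoc (fp k), eq_neg_of_add_eq_zero_left e3, neg_mul, mul_assoc,
      sub_neg_eq_add, sub_add_cancel]
    split_ifs <;> simp
  · have e1 := hf.rel k i
    have e3 := hf.anti_minus k j
    have e2 : Commute (ap i * am j) (fm k) := .mul_left (hm i k).2.2.1 (hm j k).1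
    rw [add_mul, mul_add, e2.eq, add_sub_add_left_eq_sub, ← mul_assoc (fm k),
      eq_sub_iff_add_eq.2 e1, sub_mul, mul_assoc, mul_assoc, eq_neg_of_add_eq_zero_left e3, mul_neg,
      sub_neg_eq_add, sub_add_cancel_right]
    split_ifs <;> simp

theorem quadN_commutator_quadN (N N' : Matrix ι ι ℂ) :
    quadN am ap fm fp N * quadN am ap fm fp N' - quadN am ap fm fp N' * quadN am ap fm fp N =
      quadN am ap fm fp (N * N' - N' * N) := by
  induction N using Matrix.induction_on' with
  | h_zero => simp
  | h_add p q hp hq =>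
    simp only [map_add, map_sub, add_mul, mul_add] at hp hq ⊢
    linear_combination (norm := abel) hp + hq
  | h_std_basis i j c =>
    induction N' using Matrix.induction_on' with
    | h_zero => simp
    | h_add p q hp hq =>
      simp only [map_add, map_sub, add_mul, mul_add] at hp hq ⊢
      linear_combination (norm := abel) hp + hq
    | h_std_basis k l d =>
      obtain ⟨h1, h2, h3, h4⟩ := unit_commutator hb hf hm i j k
      obtain ⟨h5, h6, h7, h8⟩ := unit_commutator hb hf hm i j l
      rw [quadN_single, quadN_single, smul_mul_smul_comm, smul_mul_smul_comm, mul_comm d c,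
        ← smul_sub, mul_add _ (ap k * am l), add_mul (ap k * am l), add_sub_add_comm,
        commutator_mul, commutator_mul, h1, h6, h3, h8, single_mul_single, single_mul_single]
      split_ifs <;> simp [quadN_single, mul_comm d c, smul_add] <;> abel

theorem quadN_commutator_plus (N S : Matrix ι ι ℂ) :
    quadN am ap fm fp N * quad ap fp S - quad ap fp S * quadN am ap fm fp N =
      quad ap fp (N * S + S * Nᵀ) := by
  induction N using Matrix.induction_on' with
  | h_zero => simp
  | h_add p q hp hq =>
    simp only [map_add, add_mul, mul_add, transpose_add] at hp hq ⊢
    linear_combination (norm := abel) hp + hq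
  | h_std_basis i j c =>
    induction S using Matrix.induction_on' with
    | h_zero => simp
    | h_add p q hp hq =>
      simp only [map_add, add_mul, mul_add] at hp hq ⊢
      linear_combination (norm := abel) hp + hq
    | h_std_basis k l d =>
      obtain ⟨h1, -⟩ := unit_commutator hb hf hm i j k
      obtain ⟨-, -, h7, -⟩ := unit_commutator hb hf hm i j l
      rw [quadN_single, quad_single, smul_mul_smul_comm, smul_mul_smul_comm, mul_comm d c,
        ← smul_sub, commutator_mul, h1, h7, transpose_single, single_mul_single, single_mul_single]
      simp only [@eq_comm _ l j]
      split_ifs <;> simp [quad_single, mul_comm d c, smul_add]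

theorem quadN_commutator_minus (N R : Matrix ι ι ℂ) :
    quadN am ap fm fp N * quad fm am R - quad fm am R * quadN am ap fm fp N =
      -quad fm am (Nᵀ * R + R * N) := by
  induction N using Matrix.induction_on' with
  | h_zero => simp
  | h_add p q hp hq =>
    simp only [map_add, add_mul, mul_add, transpose_add] at hp hq ⊢
    linear_combination (norm := abel) hp + hq
  | h_std_basis i j c =>
    induction R using Matrix.induction_on' with
    | h_zero => simp
    | h_add p q hp hq =>
      simp only [map_add, add_mul, mul_add] at hp hq ⊢
      linear_combination (norm := abel) hp + hq
    | h_std_basis k l d =>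
      obtain ⟨-, -, -, h1⟩ := unit_commutator hb hf hm i j k
      obtain ⟨-, h7, -, -⟩ := unit_commutator hb hf hm i j l
      rw [quadN_single, quad_single, smul_mul_smul_comm, smul_mul_smul_comm, mul_comm d c,
        ← smul_sub, commutator_mul, h1, h7, transpose_single, single_mul_single, single_mul_single]
      simp only [@eq_comm _ i k]
      split_ifs <;> simp [quad_single, mul_comm d c, smul_add, add_comm]

theorem quad_plus_anticommute (S S' : Matrix ι ι ℂ) :
    quad ap fp S * quad ap fp S' + quad ap fp S' * quad ap fp S = 0 := by
  induction S using Matrix.induction_on' with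
  | h_zero => simp
  | h_add p q hp hq =>
    simp only [map_add, add_mul, mul_add] at hp hq ⊢
    linear_combination (norm := abel) hp + hq
  | h_std_basis i j c =>
    induction S' using Matrix.induction_on' with
    | h_zero => simp
    | h_add p q hp hq =>
      simp only [map_add, add_mul, mul_add] at hp hq ⊢
      linear_combination (norm := abel) hp + hq
    | h_std_basis k l d =>
      have e : ap i * fp j * (ap k * fp l) + ap k * fp l * (ap i * fp j) =
          ap i * ap k * (fp j * fp l + fp l * fp j) := by
        rw [(hm k j).2.2.2.symm.mul_mul_mul_comm, (hm i l).2.2.2.symm.mul_mul_mul_comm,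
          (hb.comm_plus k i).eq, mul_add]
      rw [quad_single, quad_single, smul_mul_smul_comm, smul_mul_smul_comm, mul_comm d c,
        ← smul_add, e, hf.anti_plus, mul_zero, smul_zero]

theorem quad_minus_anticommute (R R' : Matrix ι ι ℂ) :
    quad fm am R * quad fm am R' + quad fm am R' * quad fm am R = 0 := by
  induction R using Matrix.induction_on' with
  | h_zero => simp
  | h_add p q hp hq =>
    simp only [map_add, add_mul, mul_add] at hp hq ⊢
    linear_combination (norm := abel) hp + hq
  | h_std_basis i j c =>
    induction R' using Matrix.induction_on' with
    | h_zero => simp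
    | h_add p q hp hq =>
      simp only [map_add, add_mul, mul_add] at hp hq ⊢
      linear_combination (norm := abel) hp + hq
    | h_std_basis k l d =>
      have e : fm i * am j * (fm k * am l) + fm k * am l * (fm i * am j) =
          (fm i * fm k + fm k * fm i) * (am j * am l) := by
        rw [(hm j k).1.mul_mul_mul_comm, (hm l i).1.mul_mul_mul_comm,
          (hb.comm_minus l j).eq, add_mul]
      rw [quad_single, quad_single, smul_mul_smul_comm, smul_mul_smul_comm, mul_comm d c,
        ← smul_add, e, hf.anti_minus, zero_mul, smul_zero]

/-- The scalar `tr (S R)` comes from normal ordering; it vanishes for symmetric `S` and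
antisymmetric `R`. -/
theorem quad_anticommutator (S R : Matrix ι ι ℂ) :
    quad ap fp S * quad fm am R + quad fm am R * quad ap fp S =
      quad ap am (S * R) + (S * R).trace • 1 - quad fp fm (Sᵀ * Rᵀ) := by
  induction S using Matrix.induction_on' with
  | h_zero => simp
  | h_add p q hp hq =>
    simp only [map_add, add_mul, mul_add, transpose_add, trace_add, add_smul] at hp hq ⊢
    linear_combination (norm := abel) hp + hq
  | h_std_basis i j c =>
    induction R using Matrix.induction_on' with
    | h_zero => simp
    | h_add p q hp hq =>
      simp only [map_add, add_mul, mul_add, transpose_add, trace_add, add_smul] at hp hq ⊢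
      linear_combination (norm := abel) hp + hq
    | h_std_basis k l d =>
      have e : ap i * fp j * (fm k * am l) + fm k * am l * (ap i * fp j) =
          ap i * am l * (fp j * fm k + fm k * fp j) +
            (am l * ap i - ap i * am l) * (fm k * fp j) := by
        have e1 : ap i * fp j * (fm k * am l) = ap i * am l * (fp j * fm k) := by
          rw [mul_assoc, ← mul_assoc (fp j),
            ← (Commute.mul_right (hm l j).2.1 (hm l k).1).eq, mul_assoc]
        have e2 : fm k * am l * (ap i * fp j) = am l * ap i * (fm k * fp j) := by
          rw [mul_assoc, ← mul_assoc (am l), ← mul_assoc,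
            ← (Commute.mul_left (hm l k).1 (hm i k).2.2.1).eq, mul_assoc]
        rw [e1, e2]; noncomm_ring
      have e3 := hf.rel k j
      rw [add_comm] at e3
      have e4 : fm k * fp j = (if k = j then 1 else 0) - fp j * fm k :=
        eq_sub_iff_add_eq.2 (hf.rel k j)
      rw [quad_single, quad_single, smul_mul_smul_comm, smul_mul_smul_comm, mul_comm d c,
        ← smul_add, e, e3, hb.rel, e4, transpose_single, transpose_single, single_mul_single,
        single_mul_single]
      simp only [@eq_comm _ k j, @eq_comm _ l i]
      split_ifs <;> simp_all [quad_single, smul_add, smul_sub]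
      abel

variable [Nontrivial A]

/-- The coefficients of a quadratic expression are recovered from its commutators with the
oscillators. -/
theorem quad_eq_zero {N S R : Matrix ι ι ℂ}
    (h : quadN am ap fm fp N + quad ap fp S + quad fm am R = 0) : N = 0 ∧ S = 0 ∧ R = 0 := by
  have hz : ∀ c : ℂ, c • (1 : A) = 0 → c = 0 := fun c hc =>
    (smul_eq_zero.1 hc).resolve_right one_ne_zero
  have n1 (k) (N : Matrix ι ι ℂ) : quadN am ap fm fp N * ap k - ap k * quadN am ap fm fp N =
      ∑ i, N i k • ap i := by
    simp only [quadN_apply, quad_apply, ← Finset.sum_add_distrib, ← smul_add, Finset.sum_mul,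
      Finset.mul_sum, ← Finset.sum_sub_distrib, smul_mul_assoc, mul_smul_comm, ← smul_sub,
      (unit_commutator hb hf hm _ _ k).1]
    simp
  have s1 (k) (S : Matrix ι ι ℂ) : quad ap fp S * ap k - ap k * quad ap fp S = 0 := by
    have e : ∀ i j, ap i * fp j * ap k - ap k * (ap i * fp j) = 0 := fun i j =>
      sub_eq_zero.2 (Commute.mul_left (hb.comm_plus i k) (hm k j).2.2.2.symm).eq
    simp only [quad_apply, Finset.sum_mul, Finset.mul_sum, ← Finset.sum_sub_distrib,
      smul_mul_assoc, mul_smul_comm, ← smul_sub, e, smul_zero, Finset.sum_const_zero]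
  have s2 (k) (S : Matrix ι ι ℂ) : am k * quad ap fp S - quad ap fp S * am k =
      ∑ j, S k j • fp j := by
    have e : ∀ i j, am k * (ap i * fp j) - ap i * fp j * am k = if k = i then fp j else 0 :=
      fun i j => by
        rw [mul_assoc, ← (hm k j).2.1.eq, ← mul_assoc, ← mul_assoc, ← sub_mul, hb.rel]
        split_ifs <;> simp
    simp only [quad_apply, Finset.sum_mul, Finset.mul_sum, ← Finset.sum_sub_distrib,
      smul_mul_assoc, mul_smul_comm, ← smul_sub, e]
    rw [Finset.sum_comm]
    simp
  have r1 (k) (R : Matrix ι ι ℂ) : quad fm am R * ap k - ap k * quad fm am R =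
      ∑ i, R i k • fm i := by
    have e : ∀ i j, fm i * am j * ap k - ap k * (fm i * am j) = if j = k then fm i else 0 :=
      fun i j => by
        rw [mul_assoc, ← mul_assoc (ap k), (hm k i).2.2.1.eq, mul_assoc, ← mul_sub, hb.rel]
        split_ifs <;> simp
    simp only [quad_apply, Finset.sum_mul, Finset.mul_sum, ← Finset.sum_sub_distrib,
      smul_mul_assoc, mul_smul_comm, ← smul_sub, e]
    simp
  have r2 (k) (R : Matrix ι ι ℂ) : am k * quad fm am R - quad fm am R * am k = 0 := by
    have e : ∀ i j, am k * (fm i * am j) - fm i * am j * am k = 0 := fun i j =>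
      sub_eq_zero.2 (Commute.mul_right (hm k i).1 (hb.comm_minus k j)).eq
    simp only [quad_apply, Finset.sum_mul, Finset.mul_sum, ← Finset.sum_sub_distrib,
      smul_mul_assoc, mul_smul_comm, ← smul_sub, e, smul_zero, Finset.sum_const_zero]
  -- `[·, a_k⁺]` leaves `∑ N_ik a_i⁺ + ∑ R_ik φ_i⁻`, and then `[a_j⁻, ·]` leaves `N_jk`
  have hN : N = 0 := by
    ext j k
    have e1 : ∑ i, N i k • ap i + ∑ i, R i k • fm i = 0 := by
      have e := congrArg (fun x => x * ap k - ap k * x) h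
      rw [← n1, ← r1]
      linear_combination (norm := noncomm_ring) e - s1 k S
    have e2 := congrArg (fun x => am j * x - x * am j) e1
    have e3 : ∀ i, am j * fm i - fm i * am j = 0 := fun i => sub_eq_zero.2 (hm j i).1.eq
    simp only [mul_add, add_mul, Finset.mul_sum, Finset.sum_mul, add_sub_add_comm,
      ← Finset.sum_sub_distrib, smul_mul_assoc, mul_smul_comm, ← smul_sub, hb.rel, e3, smul_zero,
      Finset.sum_const_zero, add_zero, mul_zero, zero_mul, sub_zero] at e2
    exact hz _ (by simpa using e2)
  subst hN
  rw [map_zero, zero_add] at h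
  refine ⟨rfl, ?_, ?_⟩
  · -- `[a_k⁻, ·]`, and then the anticommutator with `φ_j⁻`, leave `S_kj`
    ext k j
    have e1 : ∑ j, S k j • fp j = 0 := by
      have e := congrArg (fun x => am k * x - x * am k) h
      rw [← s2]
      linear_combination (norm := noncomm_ring) e - r2 k R
    have e2 := congrArg (fun x => fm j * x + x * fm j) e1
    simp only [Finset.mul_sum, Finset.sum_mul, ← Finset.sum_add_distrib, smul_mul_assoc,
      mul_smul_comm, ← smul_add, hf.rel, mul_zero, zero_mul, add_zero] at e2
    exact hz _ (by simpa using e2)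
  · -- `[·, a_k⁺]`, and then the anticommutator with `φ_j⁺`, leave `R_jk`
    ext j k
    have e1 : ∑ i, R i k • fm i = 0 := by
      have e := congrArg (fun x => x * ap k - ap k * x) h
      rw [← r1]
      linear_combination (norm := noncomm_ring) e - s1 k S
    have e2 := congrArg (fun x => x * fp j + fp j * x) e1
    simp only [Finset.mul_sum, Finset.sum_mul, ← Finset.sum_add_distrib, smul_mul_assoc,
      mul_smul_comm, ← smul_add, hf.rel, mul_zero, zero_mul, add_zero] at e2
    exact hz _ (by simpa using e2)

end Quadratic

section Representation

variable {l : ℕ} (am ap fm fp : Fin (l + 1) → A)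

/-- The representation of the matrix Lie superalgebra by quadratic expressions in the
oscillators. -/
noncomputable def strangeRep : SMat (l + 1) →ₗ[ℂ] A where
  toFun M := quadN am ap fm fp M.toBlocks₁₁ + quad ap fp M.toBlocks₁₂ + quad fm am M.toBlocks₂₁
  map_add' M M' := by
    have h : (M + M').toBlocks₁₁ = M.toBlocks₁₁ + M'.toBlocks₁₁ ∧
        (M + M').toBlocks₁₂ = M.toBlocks₁₂ + M'.toBlocks₁₂ ∧
        (M + M').toBlocks₂₁ = M.toBlocks₂₁ + M'.toBlocks₂₁ := ⟨rfl, rfl, rfl⟩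
    rw [h.1, h.2.1, h.2.2, map_add, map_add, map_add]
    abel
  map_smul' c M := by
    have h : (c • M).toBlocks₁₁ = c • M.toBlocks₁₁ ∧ (c • M).toBlocks₁₂ = c • M.toBlocks₁₂ ∧
        (c • M).toBlocks₂₁ = c • M.toBlocks₂₁ := ⟨rfl, rfl, rfl⟩
    rw [h.1, h.2.1, h.2.2, map_smul, map_smul, map_smul, RingHom.id_apply, smul_add, smul_add]

theorem strangeRep_fromBlocks (N S R T : Matrix (Fin (l + 1)) (Fin (l + 1)) ℂ) :
    strangeRep am ap fm fp (fromBlocks N S R T) =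
      quadN am ap fm fp N + quad ap fp S + quad fm am R := by
  rw [strangeRep]; simp

theorem strangeRep_chevalleyMatrix (g : PGen l) :
    strangeRep am ap fm fp (chevalleyMatrix g) = classicalGen am ap fm fp g := by
  cases g with
  | X j =>
    rw [chevalleyMatrix, classicalGen]
    refine Fin.lastCases ?_ (fun j => ?_) j
    · rw [Fin.snoc_last, Fin.snoc_last, strangeRep_fromBlocks, quad_single]; simp
    · rw [Fin.snoc_castSucc, Fin.snoc_castSucc, strangeRep_fromBlocks, quadN_single]; simp
  | Y i => rw [chevalleyMatrix, classicalGen, strangeRep_fromBlocks, quadN_single]; simp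
  | T i =>
    rw [chevalleyMatrix, classicalGen, strangeRep_fromBlocks, map_sub, quadN_single, quadN_single]
    simp only [one_smul, map_zero, add_zero]
    abel
  | D =>
    rw [chevalleyMatrix, classicalGen, strangeRep_fromBlocks, map_smul, quadN_apply, quad_one,
      quad_one]
    simp only [map_zero, add_zero, smul_add]

variable {am ap fm fp}
variable (hb : IsBosons am ap) (hf : IsFermions fm fp)
  (hm : ∀ i j, Commute (am i) (fm j) ∧ Commute (am i) (fp j) ∧ Commute (ap i) (fm j) ∧
    Commute (ap i) (fp j))

include hb hf hm

theorem strangeRep_superBracket {M M' : SMat (l + 1)} (h : IsStrange M) (h' : IsStrange M') :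
    strangeRep am ap fm fp (superBracket M M') =
      strangeRep am ap fm fp M * strangeRep am ap fm fp M' -
        strangeRep am ap fm fp M' * strangeRep am ap fm fp M +
        2 * (strangeRep am ap fm fp (oddPart M') * strangeRep am ap fm fp (oddPart M)) := by
  obtain ⟨-, hS, hR⟩ := id h
  obtain ⟨-, hS', hR'⟩ := id h'
  rw [oddPart, oddPart, h.eq_fromBlocks, h'.eq_fromBlocks, superBracket_fromBlocks]
  simp only [strangeRep_fromBlocks, toBlocks_fromBlocks₁₂, toBlocks_fromBlocks₂₁, map_zero,
    zero_add]
  generalize M.toBlocks₁₁ = N, M.toBlocks₁₂ = S, M.toBlocks₂₁ = R,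
    M'.toBlocks₁₁ = N', M'.toBlocks₁₂ = S', M'.toBlocks₂₁ = R' at *
  -- a symmetric and an antisymmetric matrix: the anticommutator has no scalar term
  have key : ∀ {S R : Matrix (Fin (l + 1)) (Fin (l + 1)) ℂ}, Sᵀ = S → Rᵀ = -R →
      quad ap fp S * quad fm am R + quad fm am R * quad ap fp S =
        quadN am ap fm fp (S * R) := by
    intro S R hS hR
    have ht : (S * R).trace = 0 := by
      have e := trace_transpose (S * R)
      rw [transpose_mul, hS, hR, neg_mul, trace_neg, trace_mul_comm] at e
      linear_combination (-1 / 2 : ℂ) * e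
    rw [quad_anticommutator hb hf hm, ht, hS, hR, mul_neg, map_neg, zero_smul, add_zero,
      sub_neg_eq_add, quadN_apply]
  have k1 := quadN_commutator_quadN hb hf hm N N'
  have k2 := quadN_commutator_plus hb hf hm N S'
  have k3 := quadN_commutator_plus hb hf hm N' S
  have k4 := quadN_commutator_minus hb hf hm N R'
  have k5 := quadN_commutator_minus hb hf hm N' R
  have k6 := quad_plus_anticommute hb hf hm S S'
  have k7 := quad_minus_anticommute hb hf hm R R'
  have k8 := key hS hR'
  have k9 := key hS' hR
  rw [map_add (quadN am ap fm fp) (_ - _), map_add (quadN am ap fm fp) (_ * _),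
    map_sub (quad ap fp), map_sub (quad fm am), ← k1, ← k2, ← k3, ← k8, ← k9,
    ← neg_eq_iff_eq_neg.2 k4, ← neg_eq_iff_eq_neg.2 k5]
  linear_combination (norm := noncomm_ring) (-1 : ℤ) • k6 + (-1 : ℤ) • k7

theorem strangeRep_injective [Nontrivial A] {M : SMat (l + 1)} (h : IsStrange M)
    (h0 : strangeRep am ap fm fp M = 0) : M = 0 := by
  rw [h.eq_fromBlocks, strangeRep_fromBlocks] at h0
  obtain ⟨h1, h2, h3⟩ := quad_eq_zero hb hf hm h0
  rw [h.eq_fromBlocks, h1, h2, h3]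
  simp

end Representation

end Strange

/-! ### The tensor product decomposition of the limit algebra -/

theorem neg_one_qcomm {A : Type*} [Ring A] [Algebra ℂ A] {x y : A} (h : QComm (-1) x y) :
    x * y = -(y * x) := by
  rw [h, neg_one_smul]

theorem RootBranch.numB_eq_chiN_add {q : ℂ} {k l : ℕ} (w : RootBranch q k) (H : IsRootDatum q k)
    (i : Fin (l + 1)) :
    numB i = chiN k w.limAm w.limAp i + (k : ℂ) • (w.limAp i * w.limAm i) := by
  rw [w.chiN_eq H, w.limAp_mul_limAm H, smul_diagOp, diagOp_add, numB]
  congr 1; ext x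
  rw [← Nat.cast_mul, ← Nat.cast_add, Nat.mod_add_div]

/-- A subalgebra that contains two oscillators contains the right hand side of their relation. -/
theorem osc_mem {A : Type*} [Ring A] [Algebra ℂ A] {U : Subalgebra ℂ A} {x y z : A} {c : ℂ}
    (h : x * y - c • (y * x) = z) (hx : x ∈ U) (hy : y ∈ U) : z ∈ U :=
  h ▸ sub_mem (mul_mem hx hy) (U.smul_mem (mul_mem hy hx) c)

section Generators

variable {A : Type*} [Ring A] [Algebra ℂ A] {l : ℕ} {am ap fm fp : Fin (l + 1) → A}
  {P : Subalgebra ℂ A} (ha : ∀ i, am i ∈ P ∧ ap i ∈ P ∧ fm i ∈ P ∧ fp i ∈ P)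

include ha

theorem strangeRep_mem (M : SMat (l + 1)) : strangeRep am ap fm fp M ∈ P := by
  have hq : ∀ {x y : Fin (l + 1) → A}, (∀ i, x i ∈ P) → (∀ i, y i ∈ P) → ∀ N, quad x y N ∈ P :=
    fun {x y} hx hy N => by
      rw [quad_apply]
      exact sum_mem fun i _ => sum_mem fun j _ => P.smul_mem (mul_mem (hx i) (hy j)) _
  exact add_mem (add_mem (add_mem (hq (fun i => (ha i).2.1) (fun i => (ha i).1) _)
    (hq (fun i => (ha i).2.2.2) (fun i => (ha i).2.2.1) _))
    (hq (fun i => (ha i).2.1) (fun i => (ha i).2.2.2) _))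
    (hq (fun i => (ha i).2.2.1) (fun i => (ha i).1) _)

theorem classicalGen_mem (g : PGen l) : classicalGen am ap fm fp g ∈ P := by
  rw [← strangeRep_chevalleyMatrix]
  exact strangeRep_mem ha _

end Generators

/-- `q ^ N` is a quadratic expression in the `k`-fermions, so that the generators of `U_q(sl(n))`
are built from `χ⁻`, `χ⁺`. -/
theorem kFermionGen_mem {B : Type*} {l k : ℕ} {q : ℂ}
    {cm cp N : Fin (l + 1) → Module.End ℂ (B →₀ ℂ)}
    (H : IsKFermions q k cm cp N) (hq : q ≠ 0) (hN : ∀ i, IsDiag (N i))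
    {U : Subalgebra ℂ (Module.End ℂ (B →₀ ℂ))} (hc : ∀ i, cm i ∈ U ∧ cp i ∈ U) (g : UqGen l) :
    kFermionGen q cm cp N g ∈ U := by
  have hp : ∀ i, opPow q (N i) ∈ U := fun i =>
    osc_mem (A := Module.End ℂ (B →₀ ℂ)) (U := U) (H.rel_plus i) (hc i).1 (hc i).2
  have hn : ∀ i, opPow q (-N i) ∈ U := fun i =>
    osc_mem (A := Module.End ℂ (B →₀ ℂ)) (U := U) (H.rel_minus i) (hc i).1 (hc i).2
  choose c hc' using hN
  have hadd : ∀ c d : B → ℂ, opPow q (-diagOp c + diagOp d) =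
      opPow q (-diagOp c) * opPow q (diagOp d) := fun c d => by
    rw [neg_diagOp, diagOp_add, opPow_diagOp, opPow_diagOp, opPow_diagOp, diagOp_mul]
    simp only [Complex.cpow_add _ _ hq]
  have hsub : ∀ c d : B → ℂ, opPow q (-(-diagOp c + diagOp d)) =
      opPow q (diagOp c) * opPow q (-diagOp d) := fun c d => by
    rw [neg_diagOp, neg_diagOp, diagOp_add, neg_diagOp, opPow_diagOp, opPow_diagOp, opPow_diagOp,
      diagOp_mul]
    simp only [neg_add, neg_neg, Complex.cpow_add _ _ hq]
  cases g with
  | E i => exact mul_mem (hc _).1 (hc _).2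
  | F i => exact mul_mem (hc _).2 (hc _).1
  | K i =>
    have e : kFermionGen q cm cp N (UqGen.K i) =
        opPow q (-N i.castSucc) * opPow q (N i.succ) := by
      rw [kFermionGen, hc', hc', hadd]
    rw [e]
    exact mul_mem (hn _) (hp _)
  | Kinv i =>
    have e : kFermionGen q cm cp N (UqGen.Kinv i) =
        opPow q (N i.castSucc) * opPow q (-N i.succ) := by
      rw [kFermionGen, hc', hc', hsub]
    rw [e]
    exact mul_mem (hp _) (hn _)

end QStrange

theorem mainTheorem1 (r : ℕ) (hr : 3 ≤ r) (l : ℕ) (q : ℂ) (hq : q = rootOfUnity r)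
    (k : ℕ) (hk : k = rootOrder r) :
    -- square roots of the `Q`-numbers can be chosen, and the choice is arbitrary
    Nonempty (RootBranch q k) ∧ ∀ w : RootBranch q k,
    -- the oscillator realization of `P̃_Q(n)`, `n = l + 1`
    (∀ Q : ℂ, Q ≠ 0 → Q ^ 2 ≠ 1 →
      IsQBosons Q (w.Am Q) (w.Ap Q) (numB : Fin (l + 1) → Op l) ∧
      IsQFermions Q (ferM : Fin (l + 1) → Op l) ferP numF ∧
      IsFermions (phiM Q : Fin (l + 1) → Op l) (phiP Q) ∧
      ∃ τ : QUStrange l Q →ₐ[ℂ] Op l, ∀ g, τ (QUStrange.gen Q g) = w.realization Q g) ∧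
    -- the limit `Q → q` of the oscillators
    ∃ am ap fm fp cm cp N : Fin (l + 1) → Op l,
      (∀ i, HasOpLim (fun Q => w.preBosM Q i) q (am i) ∧
        HasOpLim (fun Q => w.preBosP Q i) q (ap i) ∧
        HasOpLim (fun Q => phiM Q i) q (fm i) ∧ HasOpLim (fun Q => phiP Q i) q (fp i) ∧
        cm i = w.chiM am ap i ∧ cp i = w.chiP am ap i ∧ N i = chiN k am ap i) ∧
      IsBosons am ap ∧ IsFermions fm fp ∧ IsKFermions q k cm cp N ∧
      (∀ i j, ∀ c ∈ ({cm i, cp i, N i} : Set (Op l)), ∀ a ∈ ({am j, ap j, fm j, fp j} : Set (Op l)),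
        Commute c a) ∧
      (∀ i j, ∀ a ∈ ({am i, ap i} : Set (Op l)), ∀ f ∈ ({fm j, fp j} : Set (Op l)),
        Commute a f) ∧
      (∀ i, HasOpLim (fun Q => w.Am Q i) q (cm i * opPow q ((k / 2 : ℂ) • (ap i * am i))) ∧
        HasOpLim (fun Q => w.Ap Q i) q (cp i * opPow q ((k / 2 : ℂ) • (ap i * am i))) ∧
        numB i = N i + (k : ℂ) • (ap i * am i) ∧ numF i = fp i * fm i) ∧
      (∀ g : QPGen l, HasOpLim (fun Q => w.realization Q g) q (w.realization q g)) ∧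
      FockSplits q k am ap fm fp cm cp N ∧
      -- `U_q(sl(n))` and `P̃(n)` are realized, and the limit algebra is their tensor product
      ∃ (π : UqSl l q →ₐ[ℂ] Op l) (σ : UStrange l →ₐ[ℂ] Op l),
        (∀ g, π (UqSl.gen q g) = kFermionGen q cm cp N g) ∧
        (∀ g, σ (UStrange.gen g) = classicalGen am ap fm fp g) ∧
        (∀ u, Commute (parity l) (π u)) ∧
        (∀ g, g ≠ PGen.X (Fin.last l) → Commute (parity l) (σ (UStrange.gen g))) ∧
        parity l * σ (UStrange.gen (PGen.X (Fin.last l))) =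
          -(σ (UStrange.gen (PGen.X (Fin.last l))) * parity l) ∧
        IsInternalTensor π.range σ.range (limitAlgebra q am ap fm fp cm cp N) ∧
        -- the realization extends to the whole matrix Lie superalgebra `P̃(n)`
        ∃ ρ : SMat (l + 1) →ₗ[ℂ] Op l,
          (∀ M M' : SMat (l + 1), IsStrange M → IsStrange M' →
            IsStrange (superBracket M M') ∧
            ρ (superBracket M M') =
              ρ M * ρ M' - ρ M' * ρ M + 2 * (ρ (oddPart M') * ρ (oddPart M))) ∧
          (∀ M : SMat (l + 1), IsStrange M → ρ M = 0 → M = 0) ∧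
          (∀ g, IsStrange (chevalleyMatrix (l := l) g) ∧
            ρ (chevalleyMatrix g) = classicalGen am ap fm fp g) ∧
          IsInternalTensor π.range (Algebra.adjoin ℂ (ρ '' {M | IsStrange M}))
            (π.range ⊔ Algebra.adjoin ℂ (ρ '' {M | IsStrange M})) := by
  subst hq hk
  have H := isRootDatum r hr
  set q := rootOfUnity r with hq
  set k := rootOrder r with hk
  refine ⟨H.nonempty_rootBranch, fun w => ⟨fun Q hQ hQ2 => ⟨?_, isQFermions_fer hQ, ?_,
    exists_realization w hQ hQ2⟩, w.limAm, w.limAp, ferM, ferP, w.chiM w.limAm w.limAp,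
    w.chiP w.limAm w.limAp, chiN k w.limAm w.limAp, fun i => ⟨w.hasOpLim_preBosM H i,
    w.hasOpLim_preBosP H i, ?_, ?_, rfl, rfl, rfl⟩, w.isBosons_lim H, isFermions_fer,
    w.isKFermions_lim H, ?_, ?_, fun i => ⟨?_, ?_, ?_, (ferP_mul_ferM i).symm⟩,
    w.hasOpLim_realization H, w.fockSplits_lim H, ?_⟩⟩
  · exact isQBosons_bos hQ hQ2 (w := fun m => w.w m Q) fun m => w.sq m Q
  · rw [show (phiM Q : Fin (l + 1) → Op l) = ferM from funext (phiM_eq Q),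
      show (phiP Q : Fin (l + 1) → Op l) = ferP from funext (phiP_eq Q)]
    exact isFermions_fer
  · simp only [phiM_eq]; exact hasOpLim_const _ _
  · simp only [phiP_eq]; exact hasOpLim_const _ _
  · obtain ⟨Θ, hΘ⟩ := w.fockSplits_lim (l := l) H
    intro i j c hc a ha
    refine commute_of_mem_ops (Θ := Θ) ?_ ?_
    · rcases hc with rfl | rfl | rfl
      · exact ⟨_, fun v => (hΘ i v).1⟩
      · exact ⟨_, fun v => (hΘ i v).2.1⟩
      · exact ⟨_, fun v => (hΘ i v).2.2.1⟩
    · rcases ha with rfl | rfl | rfl | rfl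
      · exact ⟨_, fun v => (hΘ j v).2.2.2.1⟩
      · exact ⟨_, fun v => (hΘ j v).2.2.2.2.1⟩
      · exact ⟨_, fun v => (hΘ j v).2.2.2.2.2.1⟩
      · exact ⟨_, fun v => (hΘ j v).2.2.2.2.2.2⟩
  · have h := w.lim_commute_fer (l := l)
    rintro i j a (rfl | rfl) f (rfl | rfl)
    exacts [(h i j).1, (h i j).2.1, (h i j).2.2.1, (h i j).2.2.2]
  · rw [w.chiM_mul_opPow H]; exact w.hasOpLim_Am H i
  · rw [w.chiP_mul_opPow H]; exact w.hasOpLim_Ap H i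
  · exact w.numB_eq_chiN_add H i
  · have hb := w.isBosons_lim (l := l) H
    have hf := isFermions_fer (l := l)
    have hm := w.lim_commute_fer (l := l)
    obtain ⟨Θ, hΘ⟩ := w.fockSplits_lim (l := l) H
    obtain ⟨π, hπ⟩ := w.exists_uqSl_lim (l := l) H
    obtain ⟨σ, hσ⟩ := exists_classical hb hf hm
    have hπr := range_eq_adjoin (r := Uq.Rel l q) (A := Op l) π hπ
    have hσr := range_eq_adjoin (r := P.Rel l) (A := Op l) σ hσ
    have ha : ∀ i, w.limAm i ∈ rightOps Θ ∧ w.limAp i ∈ rightOps Θ ∧ ferM i ∈ rightOps Θ ∧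
        ferP i ∈ rightOps Θ := fun i =>
      ⟨⟨_, fun v => (hΘ i v).2.2.2.1⟩, ⟨_, fun v => (hΘ i v).2.2.2.2.1⟩,
        ⟨_, fun v => (hΘ i v).2.2.2.2.2.1⟩, ⟨_, fun v => (hΘ i v).2.2.2.2.2.2⟩⟩
    have hU : π.range ≤ leftOps Θ := by
      rw [hπr, Algebra.adjoin_le_iff]
      rintro _ ⟨g, rfl⟩
      exact kFermionGen_mem (U := leftOps Θ) (w.isKFermions_lim H) H.q_ne
        (fun i => ⟨_, w.chiN_eq H i⟩)
        (fun i => ⟨⟨_, fun v => (hΘ i v).1⟩, ⟨_, fun v => (hΘ i v).2.1⟩⟩) g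
    have hP : σ.range ≤ rightOps Θ := by
      rw [hσr, Algebra.adjoin_le_iff]
      rintro _ ⟨g, rfl⟩
      exact classicalGen_mem (A := Op l) (P := rightOps Θ) ha g
    refine ⟨π, σ, hπ, hσ, fun u => ?_, fun g hg => ?_, ?_, ?_, strangeRep w.limAm w.limAp ferM ferP,
      fun M M' h h' => ⟨h.superBracket h', strangeRep_superBracket hb hf hm h h'⟩,
      fun M h h0 => strangeRep_injective hb hf hm h h0,
      fun g => ⟨isStrange_chevalleyMatrix g, strangeRep_chevalleyMatrix _ _ _ _ g⟩, ?_⟩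
    · have hle : π.range ≤ Subalgebra.centralizer ℂ {parity l} := by
        rw [hπr, Algebra.adjoin_le_iff]
        rintro _ ⟨g, rfl⟩
        rintro _ rfl
        exact (w.parity_commute_kFermionGen H g).eq
      exact hle ⟨u, rfl⟩ _ rfl
    · rw [hσ]; exact w.parity_commute_classicalGen hg
    · rw [hσ]; exact neg_one_qcomm w.parity_anticommute_classicalGen
    · rw [limitAlgebra, Algebra.adjoin_union, ← hπr, ← hσr]
      exact isInternalTensor_of_mem_ops hU hP
    · refine isInternalTensor_of_mem_ops hU ?_
      rw [Algebra.adjoin_le_iff]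
      rintro _ ⟨M, -, rfl⟩
      exact strangeRep_mem (A := Op l) (P := rightOps Θ) ha M
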